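/- Let $G$ be a second-countable locally compact group, $A$ a separable and $B$ a $\sigma$-unital $C^*$-algebra, and let $\alpha: G\curvearrowright A$ and $\beta: G\curvearrowright B$ be point-norm continuous actions; $\beta_g$ also denotes the canonical extension to the multiplier algebra $\mathcal M(B)$. Assume that $\beta$ is strongly stable, i.e. $(B,\beta)$ is conjugate to $(B\otimes\mathcal K,\beta\otimes\mathrm{id}_{\mathcal K})$, where $\mathcal K$ denotes the compact operators on $\ell^2(\mathbb N)$. A cocycle representation $(\phi,u):(A,\alpha)\to(\mathcal M(B),\beta)$ consists of a $*$-homomorphism $\phi:A\to\mathcal M(B)$ and a strictly continuous map $u:G\to\mathcal U(\mathcal M(B))$ with $u_{gh}=u_g\beta_g(u_h)$ and $u_g\beta_g(\phi(a))u_g^*=\phi(\alpha_g(a))$ for all $g,h\in G$, $a\in A$. The set of all cocycle representations carries the topology $\tau(\alpha,\beta)$ of point-strict convergence in $\phi$ and strict convergence, uniformly over compact subsets of $G$, in $u$. Given isometries $t_1,t_2\in\mathcal M(B)^\beta$ with $t_1t_1^*+t_2t_2^*=1$, the Cuntz sum is $(\phi,u)\oplus(\psi,v)=(t_1\phi t_1^*+t_2\psi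 t_2^*,\ t_1ut_1^*+t_2vt_2^*)$; given isometries $t_n\in\mathcal M(B)^\beta$ $(n\in\mathbb N)$ with $\sum_n t_nt_n^*=1$ strictly, $\bigoplus_n(\phi^{(n)},u^{(n)})$ is given by the pointwise strict sums $\sum_n t_n\phi^{(n)}(a)t_n^*$ and $\sum_n t_nu^{(n)}_gt_n^*$. (Up to conjugation by unitaries in $\mathcal M(B)^\beta$ these do not depend on the choice of the isometries.) Write $(\phi,u)\asymp(\psi,v)$ if there is a norm-continuous path $w:[1,\infty)\to\mathcal U(\mathcal M(B))$ such that, for all $a\in A$ and every compact $K\subseteq G$, one has $\lim_{t\to\infty}\|\psi(a)-w_t\phi(a)w_t^*\|=0$ and $\lim_{t\to\infty}\sup_{g\in K}\|v_g-w_tu_g\beta_g(w_t)^*\|=0$, and such that $\psi(a)-w_t\phi(a)w_t^*\in B$ and $v_g-w_tu_g\beta_g(w_t)^*\in B$ for all $a\in A$, $g\in G$, $t\ge 1$. Let $\mathfrak C$ be a non-empty set of cocycle representations $(A,\alpha)\to(\mathcal M(B),\beta)$ that is $\sigma$-additive, i.e. closed under unitary equivalence with respect to unitaries in $\mathcal M(B)^\beta$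 and under countable Cuntz sums $\bigoplus_{n\in\mathbb N}(\phi^{(n)},u^{(n)})$ of sequences in $\mathfrak C$. If $\mathfrak C$ is separable with respect to $\tau(\alpha,\beta)$, then $\mathfrak C$ contains an absorbing element, i.e. there is $(\theta,x)\in\mathfrak C$ with $(\theta,x)\oplus(\phi,u)\asymp(\theta,x)$ for all $(\phi,u)\in\mathfrak C$. In particular, if $B$ is separable, then every non-empty $\sigma$-additive set of cocycle representations has an absorbing element. -/

import Mathlib

open Filter Topology
open scoped MultiplierAlgebra

noncomputable section

/-! ### Extending automorphisms to the multiplier algebra, and actions -/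

section Multiplier

variable {B : Type*} [NonUnitalCStarAlgebra B]

/-- A `*`-automorphism of a C⋆-algebra as a (bounded) linear map. -/
def autCLM (κ : B ≃⋆ₐ[ℂ] B) : B →L[ℂ] B where
  toFun := κ
  map_add' := map_add κ
  map_smul' := map_smul κ
  cont := (StarAlgEquiv.isometry κ).continuous

/-- The canonical extension of a `*`-automorphism `κ` of `B` to the multiplier algebra:
`κ(x) b = κ (x κ⁻¹(b))` and `b κ(x) = κ (κ⁻¹(b) x)`. -/
def multiplierFun (κ : B ≃⋆ₐ[ℂ] B) (x : 𝓜(ℂ, B)) : 𝓜(ℂ, B) where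
  fst := (autCLM κ).comp (x.fst.comp (autCLM κ.symm))
  snd := (autCLM κ).comp (x.snd.comp (autCLM κ.symm))
  central := fun a b => by
    have h := congrArg κ (x.central (κ.symm a) (κ.symm b))
    simpa [autCLM] using h

theorem multiplierFun_fst (κ : B ≃⋆ₐ[ℂ] B) (x : 𝓜(ℂ, B)) (b : B) :
    (multiplierFun κ x).fst b = κ (x.fst (κ.symm b)) := rfl

theorem multiplierFun_snd (κ : B ≃⋆ₐ[ℂ] B) (x : 𝓜(ℂ, B)) (b : B) :
    (multiplierFun κ x).snd b = κ (x.snd (κ.symm b)) := rfl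

theorem multiplier_ext {x y : 𝓜(ℂ, B)} (h₁ : ∀ b, x.fst b = y.fst b)
    (h₂ : ∀ b, x.snd b = y.snd b) : x = y :=
  DoubleCentralizer.ext ℂ B _ _
    (Prod.ext (ContinuousLinearMap.ext h₁) (ContinuousLinearMap.ext h₂))

/-- The canonical extension of a `*`-automorphism of `B` to a `*`-automorphism of `𝓜(ℂ, B)`. -/
def multiplierAut (κ : B ≃⋆ₐ[ℂ] B) : 𝓜(ℂ, B) ≃⋆ₐ[ℂ] 𝓜(ℂ, B) where
  toFun := multiplierFun κ
  invFun := multiplierFun κ.symm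
  left_inv x := by
    apply multiplier_ext <;> intro b <;> simp [multiplierFun_fst, multiplierFun_snd]
  right_inv x := by
    apply multiplier_ext <;> intro b <;> simp [multiplierFun_fst, multiplierFun_snd]
  map_mul' x y := by
    apply multiplier_ext <;> intro b <;> simp [multiplierFun_fst, multiplierFun_snd]
  map_add' x y := by
    apply multiplier_ext <;> intro b <;> simp [multiplierFun_fst, multiplierFun_snd]
  map_star' x := by
    apply multiplier_ext <;> intro b <;>
      simp [multiplierFun_fst, multiplierFun_snd, map_star]
  map_smul' c x := by
    apply multiplier_ext <;> intro b <;> simp [multiplierFun_fst, multiplierFun_snd]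

/-- The multiplier `x` lies in the ideal `B` of `𝓜(ℂ, B)`. -/
def MemIdeal (x : 𝓜(ℂ, B)) : Prop :=
  ∃ b : B, DoubleCentralizer.coe ℂ b = x

/-- The multiplier algebra equipped with its strict topology. -/
def StrictMultiplier (B : Type*) [NonUnitalCStarAlgebra B] : Type _ := 𝓜(ℂ, B)

/-- The identity map from the multiplier algebra to its copy with the strict topology. -/
def toStrict (x : 𝓜(ℂ, B)) : StrictMultiplier B := x

/-- The identity map back from the copy with the strict topology. -/
def ofStrict (x : StrictMultiplier B) : 𝓜(ℂ, B) := x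

/-- The strict uniformity, defined by the seminorms `x ↦ ‖x b‖` and `x ↦ ‖b x‖`, `b ∈ B`. -/
instance StrictMultiplier.instUniformSpace : UniformSpace (StrictMultiplier B) :=
  UniformSpace.comap
    (fun x => ((fun b => (ofStrict x).fst b, fun b => (ofStrict x).snd b) : (B → B) × (B → B)))
    inferInstance

/-- `s = ∑ₙ xₙ` in the strict topology (limit of the partial sums). -/
def HasStrictSum (x : ℕ → 𝓜(ℂ, B)) (s : 𝓜(ℂ, B)) : Prop :=
  Tendsto (fun N => toStrict (∑ n ∈ Finset.range N, x n)) atTop (𝓝 (toStrict s))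

variable (B) in
/-- `B` is σ-unital: it has a sequential contractive approximate unit. -/
def IsSigmaUnital : Prop :=
  ∃ e : ℕ → B, (∀ n, ‖e n‖ ≤ 1) ∧
    ∀ b, Tendsto (fun n => e n * b) atTop (𝓝 b) ∧ Tendsto (fun n => b * e n) atTop (𝓝 b)

end Multiplier

/-- A point-norm continuous action of `G` on the C⋆-algebra `A` by `*`-automorphisms. -/
structure CStarAction (G A : Type*) [Group G] [TopologicalSpace G] [NonUnitalCStarAlgebra A] where
  /-- the underlying group homomorphism into the automorphism group -/
  toHom : G →* (A ≃⋆ₐ[ℂ] A)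
  continuous_apply : ∀ a : A, Continuous fun g => toHom g a

/-! ### The stabilization `B ⊗ 𝒦` and strong stability -/

section Stabilization

variable {B : Type*} [NonUnitalCStarAlgebra B]
  {H : Type*} [NormedAddCommGroup H] [InnerProductSpace ℂ H] [CompleteSpace H]

/-- The operator `π(b) ⊗ e_{i,j}` on the Hilbert space `H ⊗ ℓ²(ℕ) = ℓ²(ℕ, H)`, where `e_{i,j}` are
the standard matrix units on `ℓ²(ℕ)`. -/
def elementaryTensor (π : B →⋆ₙₐ[ℂ] (H →L[ℂ] H)) (b : B) (i j : ℕ) :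
    lp (fun _ : ℕ => H) 2 →L[ℂ] lp (fun _ : ℕ => H) 2 :=
  (lp.singleContinuousLinearMap ℂ (fun _ : ℕ => H) 2 i).comp
    ((π b).comp (lp.evalCLM ℂ (fun _ : ℕ => H) 2 j))

/-- The spatial tensor product `π(B) ⊗ 𝒦` on `H ⊗ ℓ²(ℕ)`, with `𝒦` the compact operators on
`ℓ²(ℕ)`: the C⋆-algebra generated by the elementary tensors `π(b) ⊗ e_{i,j}`. When `π` is faithful
this is the C⋆-tensor product `B ⊗ 𝒦`. -/
def spatialStabilization (π : B →⋆ₙₐ[ℂ] (H →L[ℂ] H)) :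
    NonUnitalStarSubalgebra ℂ (lp (fun _ : ℕ => H) 2 →L[ℂ] lp (fun _ : ℕ => H) 2) :=
  (NonUnitalStarAlgebra.adjoin ℂ
    {T | ∃ (b : B) (i j : ℕ), T = elementaryTensor π b i j}).topologicalClosure

instance spatialStabilization.instModule (π : B →⋆ₙₐ[ℂ] (H →L[ℂ] H)) :
    Module ℂ (spatialStabilization π) :=
  SMulMemClass.toModule' _ ℂ ℂ _ (spatialStabilization π)

/-- The elementary tensor `b ⊗ e_{i,j}` as an element of `B ⊗ 𝒦`. -/
def stabilizationTensor (π : B →⋆ₙₐ[ℂ] (H →L[ℂ] H)) (b : B) (i j : ℕ) :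
    spatialStabilization π :=
  ⟨elementaryTensor π b i j,
    subset_closure (NonUnitalStarAlgebra.subset_adjoin ℂ _ ⟨b, i, j, rfl⟩)⟩

end Stabilization

namespace CStarAction

variable {G : Type*} [Group G] [TopologicalSpace G]

/-- `β` is strongly stable: `(B, β)` is conjugate to `(B ⊗ 𝒦, β ⊗ id)`. Here `B ⊗ 𝒦` is formed in a
faithful representation of `B` on a Hilbert space, and `β_g ⊗ id` is the automorphism of `B ⊗ 𝒦`
that maps `b ⊗ e_{i,j}` to `β_g(b) ⊗ e_{i,j}`; so the last clause says that `e ∘ β_g ∘ e⁻¹` is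
`β_g ⊗ id`. -/
def IsStronglyStable.{v} {B : Type v} [NonUnitalCStarAlgebra B] (β : CStarAction G B) : Prop :=
  ∃ (H : Type v) (_ : NormedAddCommGroup H) (_ : InnerProductSpace ℂ H) (_ : CompleteSpace H)
    (π : B →⋆ₙₐ[ℂ] (H →L[ℂ] H)) (_ : Function.Injective π)
    (e : B ≃⋆ₐ[ℂ] spatialStabilization π),
    ∀ (g : G) (b : B) (i j : ℕ),
      e (β.toHom g (e.symm (stabilizationTensor π b i j))) =
        stabilizationTensor π (β.toHom g b) i j

variable {B : Type*} [NonUnitalCStarAlgebra B]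

/-- The (algebraic) extension of the automorphism `β_g` to the multiplier algebra. -/
def mult (β : CStarAction G B) (g : G) : 𝓜(ℂ, B) ≃⋆ₐ[ℂ] 𝓜(ℂ, B) :=
  multiplierAut (β.toHom g)

/-- `t` is an isometry in the fixed point algebra `𝓜(B)^β`. -/
structure IsFixedIsometry (β : CStarAction G B) (t : 𝓜(ℂ, B)) : Prop where
  isometry : star t * t = 1
  fixed : ∀ g, β.mult g t = t

/-- `t₁, t₂` are isometries in `𝓜(B)^β` with `t₁t₁* + t₂t₂* = 1`. -/
structure IsCuntzPair (β : CStarAction G B) (t₁ t₂ : 𝓜(ℂ, B)) : Prop where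
  left : β.IsFixedIsometry t₁
  right : β.IsFixedIsometry t₂
  sum_eq_one : t₁ * star t₁ + t₂ * star t₂ = 1

/-- `(tₙ)` is a sequence of isometries in `𝓜(B)^β` with `∑ₙ tₙtₙ* = 1` strictly. -/
structure IsCuntzSequence (β : CStarAction G B) (t : ℕ → 𝓜(ℂ, B)) : Prop where
  isometry : ∀ n, β.IsFixedIsometry (t n)
  sum_eq_one : HasStrictSum (fun n => t n * star (t n)) 1

end CStarAction

/-! ### Cocycle representations -/

section CocycleRep

variable {G A B : Type*} [Group G] [TopologicalSpace G]
  [NonUnitalCStarAlgebra A] [NonUnitalCStarAlgebra B]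

/-- A cocycle representation `(φ, u) : (A, α) → (𝓜(B), β)`. -/
structure CocycleRep (α : CStarAction G A) (β : CStarAction G B) where
  /-- the `*`-homomorphism -/
  hom : A →⋆ₙₐ[ℂ] 𝓜(ℂ, B)
  /-- the cocycle -/
  coc : G → unitary 𝓜(ℂ, B)
  continuous_coc : Continuous fun g => toStrict (coc g : 𝓜(ℂ, B))
  coc_mul : ∀ g h, (coc (g * h) : 𝓜(ℂ, B)) = coc g * β.mult g (coc h)
  equivariant : ∀ g a,
    (coc g : 𝓜(ℂ, B)) * β.mult g (hom a) * star (coc g : 𝓜(ℂ, B)) = hom (α.toHom g a)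

/-- The Cuntz sum `x ⊕ y = t₁ x t₁* + t₂ y t₂*` of two multipliers. -/
def cuntzAdd (t₁ t₂ x y : 𝓜(ℂ, B)) : 𝓜(ℂ, B) := t₁ * x * star t₁ + t₂ * y * star t₂

theorem star_cuntzAdd (t₁ t₂ x y : 𝓜(ℂ, B)) :
    star (cuntzAdd t₁ t₂ x y) = cuntzAdd t₁ t₂ (star x) (star y) := by
  simp [cuntzAdd, mul_assoc]

theorem CStarAction.IsCuntzPair.orthogonal {β : CStarAction G B} {t₁ t₂ : 𝓜(ℂ, B)}
    (h : β.IsCuntzPair t₁ t₂) : star t₁ * t₂ = 0 := by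
  rw [← CStarRing.mul_star_self_eq_zero_iff]
  have h₂ : t₂ * star t₂ = 1 - t₁ * star t₁ := eq_sub_of_add_eq' h.sum_eq_one
  calc star t₁ * t₂ * star (star t₁ * t₂) = star t₁ * (t₂ * star t₂) * t₁ := by
        simp [mul_assoc]
    _ = star t₁ * t₁ - (star t₁ * t₁) * (star t₁ * t₁) := by rw [h₂]; noncomm_ring
    _ = 0 := by rw [h.left.isometry]; simp

theorem CStarAction.IsCuntzPair.cuntzAdd_mul {β : CStarAction G B} {t₁ t₂ : 𝓜(ℂ, B)}
    (h : β.IsCuntzPair t₁ t₂) (x y x' y' : 𝓜(ℂ, B)) :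
    cuntzAdd t₁ t₂ x y * cuntzAdd t₁ t₂ x' y' = cuntzAdd t₁ t₂ (x * x') (y * y') := by
  have h₁₂ := h.orthogonal
  have h₂₁ : star t₂ * t₁ = 0 := by simpa using congrArg star h₁₂
  calc cuntzAdd t₁ t₂ x y * cuntzAdd t₁ t₂ x' y'
      = t₁ * x * (star t₁ * t₁) * x' * star t₁ + t₁ * x * (star t₁ * t₂) * y' * star t₂
        + t₂ * y * (star t₂ * t₁) * x' * star t₁ + t₂ * y * (star t₂ * t₂) * y' * star t₂ := by
        simp only [cuntzAdd]; noncomm_ring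
    _ = cuntzAdd t₁ t₂ (x * x') (y * y') := by
        rw [h₁₂, h₂₁, h.left.isometry, h.right.isometry]; simp [cuntzAdd, mul_assoc]

theorem CStarAction.IsCuntzPair.cuntzAdd_one {β : CStarAction G B} {t₁ t₂ : 𝓜(ℂ, B)}
    (h : β.IsCuntzPair t₁ t₂) : cuntzAdd t₁ t₂ 1 1 = 1 := by
  simpa [cuntzAdd] using h.sum_eq_one

theorem CStarAction.IsCuntzPair.mult_cuntzAdd {β : CStarAction G B} {t₁ t₂ : 𝓜(ℂ, B)}
    (h : β.IsCuntzPair t₁ t₂) (g : G) (x y : 𝓜(ℂ, B)) :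
    β.mult g (cuntzAdd t₁ t₂ x y) = cuntzAdd t₁ t₂ (β.mult g x) (β.mult g y) := by
  simp [cuntzAdd, map_star, h.left.fixed g, h.right.fixed g]

theorem continuous_toStrict_iff {X : Type*} [TopologicalSpace X] {f : X → 𝓜(ℂ, B)} :
    (Continuous fun x => toStrict (f x)) ↔
      (∀ b, Continuous fun x => (f x).fst b) ∧ ∀ b, Continuous fun x => (f x).snd b := by
  have : (StrictMultiplier.instUniformSpace (B := B)).toTopologicalSpace =
      TopologicalSpace.induced (fun x : StrictMultiplier B =>
        ((fun b => (ofStrict x).fst b, fun b => (ofStrict x).snd b) : (B → B) × (B → B)))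
        inferInstance := rfl
  rw [this, continuous_induced_rng, continuous_prodMk, continuous_pi_iff, continuous_pi_iff]
  rfl

namespace CocycleRep

variable {α : CStarAction G A} {β : CStarAction G B}

/-- The Cuntz sum `(φ, u) ⊕ (ψ, v)` of two cocycle representations with respect to `t₁, t₂`. -/
def sum {t₁ t₂ : 𝓜(ℂ, B)} (h : β.IsCuntzPair t₁ t₂) (Φ Ψ : CocycleRep α β) :
    CocycleRep α β where
  hom :=
    { toFun := fun a => cuntzAdd t₁ t₂ (Φ.hom a) (Ψ.hom a)
      map_smul' := fun c a => by simp [cuntzAdd]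
      map_zero' := by simp [cuntzAdd]
      map_add' := fun a b => by simp only [cuntzAdd, map_add]; noncomm_ring
      map_mul' := fun a b => by rw [h.cuntzAdd_mul, map_mul, map_mul]
      map_star' := fun a => by rw [star_cuntzAdd, map_star, map_star] }
  coc := fun g =>
    ⟨cuntzAdd t₁ t₂ (Φ.coc g) (Ψ.coc g), by
      rw [Unitary.mem_iff, star_cuntzAdd, h.cuntzAdd_mul, h.cuntzAdd_mul]
      simp [h.cuntzAdd_one]⟩
  continuous_coc := by
    have h₁ := continuous_toStrict_iff.mp Φ.continuous_coc
    have h₂ := continuous_toStrict_iff.mp Ψ.continuous_coc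
    refine continuous_toStrict_iff.mpr ⟨fun b => ?_, fun b => ?_⟩
    · exact (t₁.fst.continuous.comp (h₁.1 ((star t₁).fst b))).add
        (t₂.fst.continuous.comp (h₂.1 ((star t₂).fst b)))
    · exact ((star t₁).snd.continuous.comp (h₁.2 (t₁.snd b))).add
        ((star t₂).snd.continuous.comp (h₂.2 (t₂.snd b)))
  coc_mul := fun g k => by
    simp only [h.mult_cuntzAdd, h.cuntzAdd_mul, Φ.coc_mul, Ψ.coc_mul]
  equivariant := fun g a => by
    change cuntzAdd t₁ t₂ (Φ.coc g) (Ψ.coc g) *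
      β.mult g (cuntzAdd t₁ t₂ (Φ.hom a) (Ψ.hom a)) *
        star (cuntzAdd t₁ t₂ (Φ.coc g) (Ψ.coc g)) =
      cuntzAdd t₁ t₂ (Φ.hom (α.toHom g a)) (Ψ.hom (α.toHom g a))
    rw [h.mult_cuntzAdd, star_cuntzAdd, h.cuntzAdd_mul, h.cuntzAdd_mul, Φ.equivariant,
      Ψ.equivariant]

/-- `Ψ` is the countable Cuntz sum `⨁ₙ Φₙ` formed with the isometries `tₙ`: its components are the
pointwise strict sums `∑ₙ tₙ φₙ(a) tₙ*` and `∑ₙ tₙ uₙ(g) tₙ*`. -/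
structure IsCountableSum (t : ℕ → 𝓜(ℂ, B)) (Φ : ℕ → CocycleRep α β) (Ψ : CocycleRep α β) :
    Prop where
  hom : ∀ a, HasStrictSum (fun n => t n * (Φ n).hom a * star (t n)) (Ψ.hom a)
  coc : ∀ g, HasStrictSum (fun n => t n * ((Φ n).coc g : 𝓜(ℂ, B)) * star (t n)) (Ψ.coc g)

/-- `Ψ = Ad(w) ∘ Φ`, that is, `ψ = w φ(·) w*` and `v_g = w u_g β_g(w)*`. -/
structure IsConjBy (w : unitary 𝓜(ℂ, B)) (Φ Ψ : CocycleRep α β) : Prop where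
  hom : ∀ a, Ψ.hom a = (w : 𝓜(ℂ, B)) * Φ.hom a * star (w : 𝓜(ℂ, B))
  coc : ∀ g, (Ψ.coc g : 𝓜(ℂ, B)) = (w : 𝓜(ℂ, B)) * Φ.coc g * star (β.mult g (w : 𝓜(ℂ, B)))

/-- The relation `Φ ≍ Ψ`: asymptotic unitary equivalence through a norm-continuous path of
unitaries `w_t ∈ 𝓜(B)`, `t ∈ [1, ∞)`, with all the differences in `B`. -/
def AsympEquiv (Φ Ψ : CocycleRep α β) : Prop :=
  ∃ w : Set.Ici (1 : ℝ) → unitary 𝓜(ℂ, B), Continuous w ∧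
    (∀ a, Tendsto (fun t => (w t : 𝓜(ℂ, B)) * Φ.hom a * star (w t : 𝓜(ℂ, B))) atTop
      (𝓝 (Ψ.hom a))) ∧
    (∀ a t, MemIdeal (Ψ.hom a - (w t : 𝓜(ℂ, B)) * Φ.hom a * star (w t : 𝓜(ℂ, B)))) ∧
    (∀ K : Set G, IsCompact K →
      TendstoUniformlyOn
        (fun t g => (w t : 𝓜(ℂ, B)) * (Φ.coc g : 𝓜(ℂ, B)) * star (β.mult g (w t : 𝓜(ℂ, B))))
        (fun g => (Ψ.coc g : 𝓜(ℂ, B))) atTop K) ∧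
    (∀ t g, MemIdeal ((Ψ.coc g : 𝓜(ℂ, B)) -
      (w t : 𝓜(ℂ, B)) * (Φ.coc g : 𝓜(ℂ, B)) * star (β.mult g (w t : 𝓜(ℂ, B)))))

/-- The topology on the set of cocycle representations: point-strict convergence in the first
variable and strict convergence, uniformly over compact subsets of `G`, in the second. -/
instance instTopologicalSpace : TopologicalSpace (CocycleRep α β) :=
  TopologicalSpace.induced
    (fun Φ => ((fun a => toStrict (Φ.hom a),
      UniformOnFun.ofFun {K : Set G | IsCompact K} fun g => toStrict (Φ.coc g : 𝓜(ℂ, B))) :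
        (A → StrictMultiplier B) × (UniformOnFun G (StrictMultiplier B) {K | IsCompact K})))
    inferInstance

/-- A σ-additive set of cocycle representations: closed under conjugation by unitaries in
`𝓜(B)^β` and under countable Cuntz sums. -/
structure IsSigmaAdditive (C : Set (CocycleRep α β)) : Prop where
  conj_mem : ∀ Φ ∈ C, ∀ w : unitary 𝓜(ℂ, B), (∀ g, β.mult g (w : 𝓜(ℂ, B)) = w) →
    ∀ Ψ, IsConjBy w Φ Ψ → Ψ ∈ C
  sum_mem : ∀ Φ : ℕ → CocycleRep α β, (∀ n, Φ n ∈ C) →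
    ∀ t, β.IsCuntzSequence t → ∀ Ψ, IsCountableSum t Φ Ψ → Ψ ∈ C

/-- `Θ` is an absorbing element of `C`: it belongs to `C` and `Θ ⊕ Φ ≍ Θ` for all `Φ ∈ C`
(for every choice of the isometries defining the Cuntz sum). -/
structure IsAbsorbing (C : Set (CocycleRep α β)) (Θ : CocycleRep α β) : Prop where
  mem : Θ ∈ C
  absorbs : ∀ Φ ∈ C, ∀ (t₁ t₂ : 𝓜(ℂ, B)) (h : β.IsCuntzPair t₁ t₂),
    AsympEquiv (sum h Θ Φ) Θ

end CocycleRep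

end CocycleRep

end

/-!
By strong stability there is a sequence of isometries `tₙ` in `𝓜(B)^β` with `∑ tₙtₙ* = 1`
strictly. Let `Φₙ` be dense in `C`, let `Ω = ⨁ₙ Φₙ` and let `Θ` be the infinite repeat of `Ω`. For
`Φ ∈ C` let `Ψ` be the infinite repeat of `Φ` and `Ψ'` that of `Ψ`. Since `Ψ' ∈ C` is a limit of
summands of `Ω`, gluing the isometries `t_m t_{k(m)}` along a partition of unity in `B` which is
quasicentral for `Ψ'` gives an isometry `s` that intertwines `Ψ'` and `Θ` up to an error in `B`. A
norm-continuous path of isometries intertwining `Ψ` and `Ψ'` exactly, which runs off to infinity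
and thereby kills every element of `B`, turns `s` into a path of isometries `s_τ` that intertwine
`Ψ` and `Θ` up to an error in `B` tending to zero. Then `Θ` absorbs `Ψ`, and hence `Φ`, by the
usual swindle applied to the copy `s_τ Ψ s_τ*` of `Ψ = Φ ⊕ Ψ` inside `Θ`.
-/

noncomputable section

section CStarRing

variable {E : Type*} [NonUnitalNormedRing E] [StarRing E] [CStarRing E]

theorem eq_of_forall_mul_left_eq {a b : E} (h : ∀ c, c * a = c * b) : a = b := by
  have h' := h (star (a - b))
  rw [← sub_eq_zero, ← mul_sub, CStarRing.star_mul_self_eq_zero_iff] at h'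
  exact sub_eq_zero.mp h'

theorem eq_of_forall_mul_right_eq {a b : E} (h : ∀ c, a * c = b * c) : a = b := by
  have h' := h (star (a - b))
  rw [← sub_eq_zero, ← sub_mul, CStarRing.mul_star_self_eq_zero_iff] at h'
  exact sub_eq_zero.mp h'

theorem norm_le_one_of_star_mul_self_eq_one {M : Type*} [NormedRing M] [StarRing M] [CStarRing M]
    {t : M} (h : star t * t = 1) : ‖t‖ ≤ 1 := by
  have ht : ‖t‖ * ‖t‖ ≤ 1 := by
    rw [← CStarRing.norm_star_mul_self, h]
    exact (IsStarProjection.one M).norm_le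
  exact abs_le_one_iff_mul_self_le_one.mpr ht |> (abs_norm t).symm.trans_le

theorem norm_coe_unitary_le_one {M : Type*} [NormedRing M] [StarRing M] [CStarRing M]
    (u : unitary M) : ‖(u : M)‖ ≤ 1 :=
  norm_le_one_of_star_mul_self_eq_one (Unitary.coe_star_mul_self u)

end CStarRing

section MultiplierBasics

variable {B : Type*} [NonUnitalCStarAlgebra B]

variable (B) in
/-- The canonical inclusion of a C⋆-algebra into its multiplier algebra. -/
def incl : B →⋆ₙₐ[ℂ] 𝓜(ℂ, B) := DoubleCentralizer.coeHom

theorem incl_fst (a b : B) : (incl B a).fst b = a * b := rfl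

theorem incl_injective : Function.Injective (incl B) := fun a b h =>
  eq_of_forall_mul_right_eq fun c => by rw [← incl_fst, h, incl_fst]

theorem norm_incl (b : B) : ‖incl B b‖ = ‖b‖ :=
  NonUnitalStarAlgHom.norm_map (incl B) incl_injective b

theorem isometry_incl : Isometry (incl B) :=
  AddMonoidHomClass.isometry_of_norm _ norm_incl

theorem continuous_incl : Continuous (incl B) := isometry_incl.continuous

theorem fst_mul (x : 𝓜(ℂ, B)) (b c : B) : x.fst (b * c) = x.fst b * c :=
  eq_of_forall_mul_left_eq fun d => by
    rw [← x.central, ← mul_assoc, ← mul_assoc, x.central]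

theorem multiplier_ext_fst {x y : 𝓜(ℂ, B)} (h : ∀ b, x.fst b = y.fst b) : x = y :=
  multiplier_ext h fun b => eq_of_forall_mul_right_eq fun c => by rw [x.central, y.central, h]

theorem mul_incl (x : 𝓜(ℂ, B)) (b : B) : x * incl B b = incl B (x.fst b) :=
  multiplier_ext_fst fun c => by
    simp [incl_fst, fst_mul]

theorem incl_mul (x : 𝓜(ℂ, B)) (b : B) : incl B b * x = incl B (x.snd b) :=
  multiplier_ext_fst fun c => by
    simp [incl_fst, x.central]

theorem multiplier_ext_mul_right {x y : 𝓜(ℂ, B)}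
    (h : ∀ b, x * incl B b = y * incl B b) : x = y :=
  multiplier_ext_fst fun b => incl_injective <| by rw [← mul_incl, ← mul_incl, h]

theorem multiplier_ext_mul_left {x y : 𝓜(ℂ, B)}
    (h : ∀ b, incl B b * x = incl B b * y) : x = y := by
  rw [← star_inj]
  refine multiplier_ext_mul_right fun b => ?_
  rw [← star_inj]
  simpa [map_star] using h (star b)

theorem memIdeal_iff_mem_range {x : 𝓜(ℂ, B)} :
    MemIdeal x ↔ x ∈ NonUnitalStarAlgHom.range (incl B) := Iff.rfl

theorem memIdeal_incl (b : B) : MemIdeal (incl B b) := ⟨b, rfl⟩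

theorem memIdeal_zero : MemIdeal (0 : 𝓜(ℂ, B)) :=
  zero_mem (NonUnitalStarAlgHom.range (incl B))

namespace MemIdeal

variable {x y : 𝓜(ℂ, B)}

theorem add (hx : MemIdeal x) (hy : MemIdeal y) : MemIdeal (x + y) :=
  add_mem (memIdeal_iff_mem_range.mp hx) hy

theorem sub (hx : MemIdeal x) (hy : MemIdeal y) : MemIdeal (x - y) :=
  sub_mem (memIdeal_iff_mem_range.mp hx) hy

theorem star (hx : MemIdeal x) : MemIdeal (Star.star x) :=
  star_mem (memIdeal_iff_mem_range.mp hx)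

theorem mul_left (hx : MemIdeal x) (y : 𝓜(ℂ, B)) : MemIdeal (y * x) := by
  obtain ⟨a, rfl⟩ := hx
  exact ⟨_, (mul_incl y a).symm⟩

theorem mul_right (hx : MemIdeal x) (y : 𝓜(ℂ, B)) : MemIdeal (x * y) := by
  obtain ⟨a, rfl⟩ := hx
  exact ⟨_, (incl_mul y a).symm⟩

end MemIdeal

theorem isClosed_memIdeal : IsClosed {x : 𝓜(ℂ, B) | MemIdeal x} :=
  (isometry_incl (B := B)).isClosedEmbedding.isClosed_range

theorem memIdeal_sum {ι : Type*} {x : ι → 𝓜(ℂ, B)} (s : Finset ι)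
    (h : ∀ i, MemIdeal (x i)) : MemIdeal (∑ i ∈ s, x i) :=
  sum_mem fun i _ => memIdeal_iff_mem_range.mp (h i)

theorem memIdeal_tsum {x : ℕ → 𝓜(ℂ, B)} (h : ∀ n, MemIdeal (x n)) : MemIdeal (∑' n, x n) := by
  by_cases hs : Summable x
  · exact isClosed_memIdeal.mem_of_tendsto hs.hasSum.tendsto_sum_nat
      (Eventually.of_forall fun N => memIdeal_sum _ h)
  · rw [tsum_eq_zero_of_not_summable hs]
    exact memIdeal_zero

theorem tendsto_toStrict_iff {ι : Type*} {l : Filter ι} {f : ι → 𝓜(ℂ, B)} {x : 𝓜(ℂ, B)} :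
    Tendsto (fun i => toStrict (f i)) l (𝓝 (toStrict x)) ↔
      (∀ b, Tendsto (fun i => f i * incl B b) l (𝓝 (x * incl B b))) ∧
        ∀ b, Tendsto (fun i => incl B b * f i) l (𝓝 (incl B b * x)) := by
  have : (StrictMultiplier.instUniformSpace (B := B)).toTopologicalSpace =
      TopologicalSpace.induced (fun x : StrictMultiplier B =>
        ((fun b => (ofStrict x).fst b, fun b => (ofStrict x).snd b) : (B → B) × (B → B)))
        inferInstance := rfl
  rw [this, nhds_induced, tendsto_comap_iff, nhds_prod_eq, tendsto_prod_iff', tendsto_pi_nhds,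
    tendsto_pi_nhds]
  simp_rw [mul_incl, incl_mul,
    (isometry_incl (B := B)).isEmbedding.tendsto_nhds_iff]
  rfl

theorem exists_tendsto_of_cauchySeq_incl {f : ℕ → B} (h : CauchySeq fun n => incl B (f n)) :
    ∃ b, Tendsto f atTop (𝓝 b) :=
  cauchySeq_tendsto_of_complete <|
    (isometry_incl (B := B)).isUniformInducing.cauchy_map_iff.mp (by rwa [Filter.map_map])

theorem exists_strict_limit {f : ℕ → 𝓜(ℂ, B)}
    (h₁ : ∀ b, CauchySeq fun n => f n * incl B b) (h₂ : ∀ b, CauchySeq fun n => incl B b * f n) :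
    ∃ x, Tendsto (fun n => toStrict (f n)) atTop (𝓝 (toStrict x)) := by
  simp_rw [mul_incl] at h₁
  simp_rw [incl_mul] at h₂
  choose L hL using fun b => exists_tendsto_of_cauchySeq_incl (h₁ b)
  choose R hR using fun b => exists_tendsto_of_cauchySeq_incl (h₂ b)
  let x : 𝓜(ℂ, B) :=
    { fst := continuousLinearMapOfTendsto (fun n => (f n).fst) (tendsto_pi_nhds.mpr hL)
      snd := continuousLinearMapOfTendsto (fun n => (f n).snd) (tendsto_pi_nhds.mpr hR)
      central := fun a b => by
        refine tendsto_nhds_unique ((hR a).mul_const b) ?_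
        simp_rw [(f _).central]
        exact (hL b).const_mul a }
  refine ⟨x, tendsto_toStrict_iff.mpr ⟨fun b => ?_, fun b => ?_⟩⟩
  · simp_rw [mul_incl]
    exact (continuous_incl.tendsto _).comp (hL b)
  · simp_rw [incl_mul]
    exact (continuous_incl.tendsto _).comp (hR b)

theorem mul_strict_limit_eq {f : ℕ → 𝓜(ℂ, B)} {x y z : 𝓜(ℂ, B)}
    (h : Tendsto (fun n => toStrict (f n)) atTop (𝓝 (toStrict x)))
    (h' : ∀ᶠ n in atTop, y * f n = z) : y * x = z := by
  refine multiplier_ext_mul_right fun b => ?_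
  rw [mul_assoc]
  refine tendsto_nhds_unique (((tendsto_toStrict_iff.mp h).1 b).const_mul y) ?_
  refine tendsto_const_nhds.congr' ?_
  filter_upwards [h'] with n hn
  rw [← hn, mul_assoc]

end MultiplierBasics

section ActionBasics

theorem continuous_starAlgEquiv_apply {X B : Type*} [TopologicalSpace X]
    [NonUnitalCStarAlgebra B] {κ : X → B ≃⋆ₐ[ℂ] B} (hκ : ∀ b, Continuous fun x => κ x b)
    {f : X → B} (hf : Continuous f) : Continuous fun x => κ x (f x) :=
  (continuous_prod_of_continuous_lipschitzWith' (fun p : X × B => κ p.1 p.2) 1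
    (fun x => (AddMonoidHomClass.isometry_of_norm (κ x) (StarAlgEquiv.norm_map (κ x))).lipschitz)
    hκ).comp (continuous_id.prodMk hf)

variable {G B : Type*} [Group G] [TopologicalSpace G] [NonUnitalCStarAlgebra B]
  (β : CStarAction G B)

namespace CStarAction

theorem mult_incl (g : G) (b : B) : β.mult g (incl B b) = incl B (β.toHom g b) :=
  multiplier_ext_fst fun c => by
    change β.toHom g (b * (β.toHom g).symm c) = β.toHom g b * c
    simp

theorem norm_mult (g : G) (x : 𝓜(ℂ, B)) : ‖β.mult g x‖ = ‖x‖ :=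
  StarAlgEquiv.norm_map (β.mult g) x

theorem toHom_one_apply (b : B) : β.toHom 1 b = b := by
  rw [map_one]; rfl

theorem toHom_mul_apply (g h : G) (b : B) : β.toHom (g * h) b = β.toHom g (β.toHom h b) := by
  rw [map_mul]; rfl

theorem toHom_symm_apply (g : G) (b : B) : (β.toHom g).symm b = β.toHom g⁻¹ b := by
  rw [StarAlgEquiv.symm_apply_eq, ← toHom_mul_apply, mul_inv_cancel, toHom_one_apply]

theorem mult_one_apply (x : 𝓜(ℂ, B)) : β.mult 1 x = x :=
  multiplier_ext_fst fun b => by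
    change β.toHom 1 (x.fst ((β.toHom 1).symm b)) = x.fst b
    rw [β.toHom_symm_apply, inv_one, β.toHom_one_apply, β.toHom_one_apply]

end CStarAction

end ActionBasics

section OrthogonalIsometries

/-- A family of isometries with pairwise orthogonal ranges, in a ring with involution. -/
structure OrthogonalIsometries {ι M : Type*} [Ring M] [StarRing M] (t : ι → M) : Prop where
  star_mul_self : ∀ i, star (t i) * t i = 1
  star_mul_of_ne : ∀ i j, i ≠ j → star (t i) * t j = 0

namespace OrthogonalIsometries

variable {ι : Type*}

section Ring

variable {M : Type*} [Ring M] [StarRing M] {t : ι → M}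

theorem star_mul_mul_self (ht : OrthogonalIsometries t) (i : ι) (x : M) :
    star (t i) * (t i * x) = x := by
  rw [← mul_assoc, ht.star_mul_self, one_mul]

theorem star_mul_mul_of_ne (ht : OrthogonalIsometries t) {i j : ι} (h : i ≠ j) (x : M) :
    star (t i) * (t j * x) = 0 := by
  rw [← mul_assoc, ht.star_mul_of_ne i j h, zero_mul]

theorem star_mul_sum (ht : OrthogonalIsometries t) (s : Finset ι) (y : ι → M) {i : ι}
    (hi : i ∈ s) : star (t i) * ∑ j ∈ s, t j * y j = y i := by
  rw [Finset.mul_sum, Finset.sum_eq_single_of_mem i hi, ht.star_mul_mul_self]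
  exact fun j _ hj => ht.star_mul_mul_of_ne hj.symm _

theorem proj_mul_sum (ht : OrthogonalIsometries t) {s s' : Finset ι} (y : ι → M) (h : s ⊆ s') :
    (∑ i ∈ s, t i * star (t i)) * ∑ i ∈ s', t i * y i = ∑ i ∈ s, t i * y i := by
  rw [Finset.sum_mul]
  exact Finset.sum_congr rfl fun i hi => by rw [mul_assoc, ht.star_mul_sum s' y (h hi)]

theorem star_sum_mul_sum (ht : OrthogonalIsometries t) (s : Finset ι) (x y : ι → M) :
    star (∑ i ∈ s, t i * x i) * ∑ i ∈ s, t i * y i = ∑ i ∈ s, star (x i) * y i := by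
  rw [star_sum, Finset.sum_mul]
  exact Finset.sum_congr rfl fun i hi => by rw [star_mul, mul_assoc, ht.star_mul_sum s y hi]

end Ring

section CStarAlgebra

variable {M : Type*} [CStarAlgebra M] {t : ι → M}

theorem norm_le_one (ht : OrthogonalIsometries t) (i : ι) : ‖t i‖ ≤ 1 :=
  norm_le_one_of_star_mul_self_eq_one (ht.star_mul_self i)

theorem norm_sum_proj_le (ht : OrthogonalIsometries t) (s : Finset ι) :
    ‖∑ i ∈ s, t i * star (t i)‖ ≤ 1 := by
  refine IsStarProjection.norm_le _ ⟨?_, isSelfAdjoint_sum s fun i _ => .mul_star_self (t i)⟩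
  exact ht.proj_mul_sum _ subset_rfl

theorem norm_sq_sum (ht : OrthogonalIsometries t) (s : Finset ι) (y : ι → M) :
    ‖∑ i ∈ s, t i * y i‖ ^ 2 = ‖∑ i ∈ s, star (y i) * y i‖ := by
  rw [← ht.star_sum_mul_sum, CStarRing.norm_star_mul_self, sq]

theorem norm_sum_diag_le (ht : OrthogonalIsometries t) (s : Finset ι) {x : ι → M} {C : ℝ}
    (hC : 0 ≤ C) (hx : ∀ i, ‖x i‖ ≤ C) : ‖∑ i ∈ s, t i * (x i * star (t i))‖ ≤ C := by
  let _ := CStarAlgebra.spectralOrder M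
  have := CStarAlgebra.spectralOrderedRing M
  have hle : ∀ i, star (x i * star (t i)) * (x i * star (t i)) ≤
      (C ^ 2 : ℝ) • (t i * star (t i)) := fun i => by
    have hi : star (x i) * x i ≤ algebraMap ℝ M (C ^ 2) :=
      CStarAlgebra.star_mul_le_algebraMap_norm_sq.trans
        (algebraMap_mono M (by have := hx i; gcongr))
    have := star_right_conjugate_le_conjugate hi (t i)
    rw [Algebra.algebraMap_eq_smul_one, mul_smul_comm, mul_one, smul_mul_assoc] at this
    simpa [mul_assoc] using this
  refine le_of_sq_le_sq ?_ hC
  calc ‖∑ i ∈ s, t i * (x i * star (t i))‖ ^ 2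
      = ‖∑ i ∈ s, star (x i * star (t i)) * (x i * star (t i))‖ := ht.norm_sq_sum s _
    _ ≤ ‖(C ^ 2 : ℝ) • ∑ i ∈ s, t i * star (t i)‖ := by
        rw [Finset.smul_sum]
        exact CStarAlgebra.norm_le_norm_of_nonneg_of_le
          (Finset.sum_nonneg fun i _ => star_mul_self_nonneg _)
          (Finset.sum_le_sum fun i _ => hle i)
    _ ≤ C ^ 2 := by
        rw [norm_smul, Real.norm_of_nonneg (by positivity)]
        exact mul_le_of_le_one_right (by positivity) (ht.norm_sum_proj_le s)

end CStarAlgebra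

end OrthogonalIsometries

end OrthogonalIsometries

section CuntzSequence

theorem star_mul_mul_eq_zero_of_tendsto {M : Type*} [CStarAlgebra M] {t : ℕ → M}
    (ht : ∀ n, star (t n) * t n = 1) {m n : ℕ} (hmn : m ≠ n) {x : M}
    (hx : Tendsto (fun N => (∑ k ∈ Finset.range N, t k * star (t k)) * (t n * x)) atTop
      (𝓝 (t n * x))) : star (t m) * (t n * x) = 0 := by
  let _ := CStarAlgebra.spectralOrder M
  have := CStarAlgebra.spectralOrderedRing M
  -- `y* (tₘ tₘ* + tₙ tₙ*) y ≤ y* y` for `y = tₙ x`, and `y* tₙ tₙ* y = y* y`.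
  have hle : star (t n * x) * ((t m * star (t m) + t n * star (t n)) * (t n * x)) ≤
      star (t n * x) * (t n * x) := by
    refine ge_of_tendsto (hx.const_mul _) ?_
    filter_upwards [eventually_gt_atTop m, eventually_gt_atTop n] with N hm hn
    rw [← mul_assoc, ← mul_assoc (star (t n * x))]
    exact star_left_conjugate_le_conjugate (Finset.add_le_sum
      (fun k _ => mul_star_self_nonneg (t k)) (by simpa using hm) (by simpa using hn) hmn) _
  rw [add_mul, mul_add, mul_assoc (t n), ← mul_assoc (star (t n)) (t n), ht, one_mul,
    add_le_iff_nonpos_left] at hle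
  rw [← CStarRing.star_mul_self_eq_zero_iff]
  refine le_antisymm (le_of_eq_of_le ?_ hle) (star_mul_self_nonneg _)
  simp only [star_mul, star_star, mul_assoc]

variable {G B : Type*} [Group G] [TopologicalSpace G] [NonUnitalCStarAlgebra B]
  {β : CStarAction G B} {t : ℕ → 𝓜(ℂ, B)}

namespace CStarAction.IsCuntzSequence

theorem fixed (ht : β.IsCuntzSequence t) (n : ℕ) (g : G) : β.mult g (t n) = t n :=
  (ht.isometry n).fixed g

theorem tendsto_proj_mul (ht : β.IsCuntzSequence t) (b : B) :
    Tendsto (fun N => (∑ n ∈ Finset.range N, t n * star (t n)) * incl B b) atTop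
      (𝓝 (incl B b)) := by
  simpa using (tendsto_toStrict_iff.mp ht.sum_eq_one).1 b

theorem tendsto_mul_proj (ht : β.IsCuntzSequence t) (b : B) :
    Tendsto (fun N => incl B b * (∑ n ∈ Finset.range N, t n * star (t n))) atTop
      (𝓝 (incl B b)) := by
  simpa using (tendsto_toStrict_iff.mp ht.sum_eq_one).2 b

theorem star_mul_of_ne (ht : β.IsCuntzSequence t) {m n : ℕ} (h : m ≠ n) :
    star (t m) * t n = 0 := by
  refine multiplier_ext_mul_right fun b => ?_
  rw [zero_mul, mul_assoc]
  refine star_mul_mul_eq_zero_of_tendsto (fun k => (ht.isometry k).isometry) h ?_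
  simpa only [mul_incl] using ht.tendsto_proj_mul ((t n).fst b)

theorem orthogonalIsometries (ht : β.IsCuntzSequence t) : OrthogonalIsometries t :=
  ⟨fun n => (ht.isometry n).isometry, fun _ _ => ht.star_mul_of_ne⟩

theorem ext_left (ht : β.IsCuntzSequence t) {x y : 𝓜(ℂ, B)}
    (h : ∀ n, star (t n) * x = star (t n) * y) : x = y := by
  refine multiplier_ext_mul_left fun b => ?_
  refine tendsto_nhds_unique ((ht.tendsto_mul_proj b).mul_const x) ?_
  refine ((ht.tendsto_mul_proj b).mul_const y).congr fun N => ?_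
  simp only [mul_assoc, Finset.sum_mul, h]

theorem ext_right (ht : β.IsCuntzSequence t) {x y : 𝓜(ℂ, B)} (h : ∀ n, x * t n = y * t n) :
    x = y := by
  rw [← star_inj]
  refine ht.ext_left fun n => ?_
  rw [← star_mul, ← star_mul, h]

end CStarAction.IsCuntzSequence

end CuntzSequence

theorem exists_multiplier {B L : Type*} [NonUnitalCStarAlgebra B] [CStarAlgebra L] (j : B →⋆ₙₐ[ℂ] L)
    (hinj : Function.Injective j) {V : L} (h₁ : ∀ b, ∃ c, j c = V * j b)
    (h₂ : ∀ b, ∃ c, j c = j b * V) :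
    ∃ t : 𝓜(ℂ, B), (∀ b, j (t.fst b) = V * j b) ∧ ∀ b, j (t.snd b) = j b * V := by
  have hn := NonUnitalStarAlgHom.norm_map j hinj
  choose l hl using h₁
  choose r hr using h₂
  let L : B →ₗ[ℂ] B :=
    { toFun := l
      map_add' := fun a b => hinj <| by rw [map_add, hl, hl, hl, map_add, mul_add]
      map_smul' := fun c a => hinj <| by
        rw [map_smul, hl, hl, map_smul, mul_smul_comm]; rfl }
  let R : B →ₗ[ℂ] B :=
    { toFun := r
      map_add' := fun a b => hinj <| by rw [map_add, hr, hr, hr, map_add, add_mul]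
      map_smul' := fun c a => hinj <| by
        rw [map_smul, hr, hr, map_smul, smul_mul_assoc]; rfl }
  refine ⟨{ fst := L.mkContinuous ‖V‖ fun b => ?_
            snd := R.mkContinuous ‖V‖ fun b => ?_
            central := fun a b => hinj ?_ }, hl, hr⟩
  · rw [← hn, ← hn b]
    exact (congrArg norm (hl b)).trans_le (norm_mul_le _ _)
  · rw [← hn, ← hn b, mul_comm]
    exact (congrArg norm (hr b)).trans_le (norm_mul_le _ _)
  · rw [map_mul, map_mul]
    change j (r a) * _ = _ * j (l b)
    rw [hl, hr, mul_assoc]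

section Amplification

variable {H : Type*} [NormedAddCommGroup H] [InnerProductSpace ℂ H]

/-- The inclusion of `H` as the `i`-th coordinate subspace of `ℓ²(ℕ, H)`. -/
def lpSingleIsometry (i : ℕ) : H →ₗᵢ[ℂ] lp (fun _ : ℕ => H) 2 where
  toLinearMap := lp.lsingle (E := fun _ : ℕ => H) 2 i
  norm_map' x := lp.norm_single (E := fun _ : ℕ => H) (p := 2) (by norm_num) i x

theorem lpSingleIsometry_apply (i : ℕ) (x : H) :
    lpSingleIsometry i x = lp.single (E := fun _ : ℕ => H) 2 i x := rfl

theorem orthogonalFamily_lpSingle (n : ℕ) :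
    OrthogonalFamily ℂ (fun _ : ℕ => H) fun j => lpSingleIsometry (H := H) (Nat.pair n j) := by
  intro i j hij x y
  rw [lpSingleIsometry_apply, lpSingleIsometry_apply, lp.inner_single_left, lp.single_apply_ne]
  · simp
  · simpa using hij

variable [CompleteSpace H]

/-- The isometry `1 ⊗ vₙ` on `ℓ²(ℕ, H)`, where `vₙ δⱼ = δ_{⟨n, j⟩}`. -/
def ampIsometry (n : ℕ) : lp (fun _ : ℕ => H) 2 →L[ℂ] lp (fun _ : ℕ => H) 2 :=
  (orthogonalFamily_lpSingle n).linearIsometry.toContinuousLinearMap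

theorem ampIsometry_single (n j : ℕ) (x : H) :
    ampIsometry n (lp.single (E := fun _ : ℕ => H) 2 j x) = lp.single 2 (Nat.pair n j) x :=
  (orthogonalFamily_lpSingle n).linearIsometry_apply_single x

theorem ampIsometry_apply_of_ne {m n : ℕ} (h : m ≠ n) (j : ℕ) (f : lp (fun _ : ℕ => H) 2) :
    ampIsometry n f (Nat.pair m j) = 0 := by
  have h₁ := (lp.evalCLM ℂ (fun _ : ℕ => H) 2 (Nat.pair m j)).hasSum
    ((orthogonalFamily_lpSingle (H := H) n).hasSum_linearIsometry f)
  refine h₁.unique ?_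
  have : ∀ i, lp.evalCLM ℂ (fun _ : ℕ => H) 2 (Nat.pair m j)
      (lpSingleIsometry (Nat.pair n i) (f i)) = 0 := fun i => by
    change lp.single (E := fun _ : ℕ => H) 2 (Nat.pair n i) (f i) (Nat.pair m j) = 0
    rw [lp.single_apply_ne]
    simp [h]
  simp_rw [this]
  exact hasSum_zero

theorem star_ampIsometry_mul_self (n : ℕ) :
    star (ampIsometry (H := H) n) * ampIsometry n = 1 := by
  rw [ContinuousLinearMap.star_eq_adjoint]
  exact (ContinuousLinearMap.norm_map_iff_adjoint_comp_self _).mp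
    (orthogonalFamily_lpSingle (H := H) n).linearIsometry.norm_map

theorem star_ampIsometry_single_of_ne {m n : ℕ} (h : m ≠ n) (j : ℕ) (x : H) :
    star (ampIsometry (H := H) n) (lp.single (E := fun _ : ℕ => H) 2 (Nat.pair m j) x) = 0 := by
  rw [← inner_self_eq_zero (𝕜 := ℂ), ContinuousLinearMap.star_eq_adjoint,
    ContinuousLinearMap.adjoint_inner_left, lp.inner_single_left, ampIsometry_apply_of_ne h,
    inner_zero_right]

theorem star_ampIsometry_mul_of_ne {m n : ℕ} (h : m ≠ n) :
    star (ampIsometry (H := H) n) * ampIsometry m = 0 := by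
  ext1 f
  have h₁ := (star (ampIsometry (H := H) n)).hasSum
    ((orthogonalFamily_lpSingle (H := H) m).hasSum_linearIsometry f)
  refine h₁.unique ?_
  have : ∀ i, star (ampIsometry (H := H) n) (lpSingleIsometry (Nat.pair m i) (f i)) = 0 := fun i =>
    star_ampIsometry_single_of_ne h i (f i)
  simp_rw [this]
  exact hasSum_zero

variable {B : Type*} [NonUnitalCStarAlgebra B] (π : B →⋆ₙₐ[ℂ] (H →L[ℂ] H))

theorem elementaryTensor_apply (b : B) (i j : ℕ) (f : lp (fun _ : ℕ => H) 2) :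
    elementaryTensor π b i j f = lp.single (E := fun _ : ℕ => H) 2 i (π b (f j)) := rfl

theorem ampIsometry_mul_elementaryTensor (n : ℕ) (b : B) (i j : ℕ) :
    ampIsometry n * elementaryTensor π b i j = elementaryTensor π b (Nat.pair n i) j := by
  ext1 f
  rw [mul_apply_eq_comp, elementaryTensor_apply, ampIsometry_single,
    elementaryTensor_apply]

theorem star_ampIsometry_mul_elementaryTensor (n : ℕ) (b : B) (i j : ℕ) :
    star (ampIsometry (H := H) n) * elementaryTensor π b (Nat.pair n i) j =
      elementaryTensor π b i j := by
  rw [← ampIsometry_mul_elementaryTensor, ← mul_assoc, star_ampIsometry_mul_self, one_mul]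

theorem star_ampIsometry_mul_elementaryTensor_of_ne {m n : ℕ} (h : m ≠ n) (b : B) (i j : ℕ) :
    star (ampIsometry (H := H) n) * elementaryTensor π b (Nat.pair m i) j = 0 := by
  rw [← ampIsometry_mul_elementaryTensor, ← mul_assoc, star_ampIsometry_mul_of_ne h, zero_mul]

theorem star_elementaryTensor (b : B) (i j : ℕ) :
    star (elementaryTensor π b i j) = elementaryTensor π (star b) j i := by
  rw [ContinuousLinearMap.star_eq_adjoint]
  symm
  rw [ContinuousLinearMap.eq_adjoint_iff]
  intro f g
  rw [elementaryTensor_apply, elementaryTensor_apply, lp.inner_single_left, lp.inner_single_right,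
    map_star, ContinuousLinearMap.star_eq_adjoint, ContinuousLinearMap.adjoint_inner_left]

theorem elementaryTensor_mem (b : B) (i j : ℕ) :
    elementaryTensor π b i j ∈ spatialStabilization π :=
  (stabilizationTensor π b i j).2

/-- The identifications of `B` with the stabilization `π(B) ⊗ 𝒦 ⊆ 𝓑(ℓ²(ℕ, H))`. -/
abbrev StabilizationEquiv : Type _ := B ≃⋆ₐ[ℂ] spatialStabilization π

variable {π} (e : StabilizationEquiv π)

/-- The embedding of a stable C⋆-algebra into the operators on `ℓ²(ℕ, H)`. -/
def stabEmbedding :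
    B →⋆ₙₐ[ℂ] (lp (fun _ : ℕ => H) 2 →L[ℂ] lp (fun _ : ℕ => H) 2) where
  toFun b := e b
  map_smul' c b := congrArg Subtype.val (e.map_smul' c b)
  map_zero' := congrArg Subtype.val (map_zero e)
  map_add' a b := congrArg Subtype.val (map_add e a b)
  map_mul' a b := congrArg Subtype.val (map_mul e a b)
  map_star' a := congrArg Subtype.val (map_star e a)

/-- The elementary tensor `b ⊗ e_{ij}`, as an element of the stable C⋆-algebra `B ≅ π(B) ⊗ 𝒦`. -/
def stabTensor (b : B) (i j : ℕ) : B := e.symm (stabilizationTensor π b i j)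

theorem stabEmbedding_injective : Function.Injective (stabEmbedding e) :=
  fun _ _ h => e.injective (Subtype.ext h)

theorem isometry_stabEmbedding : Isometry (stabEmbedding e) :=
  AddMonoidHomClass.isometry_of_norm _ fun b =>
    NonUnitalStarAlgHom.norm_map (stabEmbedding e) (stabEmbedding_injective e) b

theorem stabEmbedding_mem (b : B) : stabEmbedding e b ∈ spatialStabilization π := (e b).2

theorem stabEmbedding_symm {T : lp (fun _ : ℕ => H) 2 →L[ℂ] lp (fun _ : ℕ => H) 2}
    (hT : T ∈ spatialStabilization π) : stabEmbedding e (e.symm ⟨T, hT⟩) = T := by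
  change ((e (e.symm ⟨T, hT⟩) : spatialStabilization π) : _ →L[ℂ] _) = T
  rw [StarAlgEquiv.apply_symm_apply]

theorem stabEmbedding_stabTensor (b : B) (i j : ℕ) :
    stabEmbedding e (stabTensor e b i j) = elementaryTensor π b i j :=
  stabEmbedding_symm e _

theorem spatialStabilization_induction
    {p : (lp (fun _ : ℕ => H) 2 →L[ℂ] lp (fun _ : ℕ => H) 2) → Prop}
    (tensor : ∀ b i j, p (elementaryTensor π b i j)) (add : ∀ S T, p S → p T → p (S + T))
    (smul : ∀ (c : ℂ) T, p T → p (c • T)) (mul : ∀ S T, p S → p T → p (S * T))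
    (closed : IsClosed {T | p T}) {T : lp (fun _ : ℕ => H) 2 →L[ℂ] lp (fun _ : ℕ => H) 2}
    (hT : T ∈ spatialStabilization π) : p T := by
  refine closure_minimal (fun S hS => ?_) closed hT
  rw [SetLike.mem_coe, ← NonUnitalStarSubalgebra.mem_toNonUnitalSubalgebra,
    NonUnitalStarAlgebra.adjoin_toNonUnitalSubalgebra] at hS
  induction hS using NonUnitalAlgebra.adjoin_induction with
  | mem S hS =>
    rcases hS with ⟨b, i, j, rfl⟩ | ⟨b, i, j, hS⟩
    · exact tensor b i j
    · rw [← star_star S, hS, star_elementaryTensor]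
      exact tensor _ _ _
  | add S T _ _ hS hT => exact add S T hS hT
  | zero => simpa using smul 0 _ (tensor 0 0 0)
  | mul S T _ _ hS hT => exact mul S T hS hT
  | smul c S _ hS => exact smul c S hS

theorem stab_induction {p : B → Prop}
    (tensor : ∀ b i j, p (stabTensor e b i j))
    (add : ∀ a b, p a → p b → p (a + b)) (smul : ∀ (c : ℂ) a, p a → p (c • a))
    (mul : ∀ a b, p a → p b → p (a * b)) (closed : IsClosed {b | p b}) (b : B) : p b := by
  suffices h : stabEmbedding e b ∈ stabEmbedding e '' {b | p b} by
    obtain ⟨a, ha, hab⟩ := h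
    rwa [stabEmbedding_injective e hab] at ha
  refine spatialStabilization_induction (p := (· ∈ stabEmbedding e '' {b | p b}))
    (fun b i j => ⟨_, tensor b i j, stabEmbedding_stabTensor e b i j⟩) ?_ ?_ ?_
    ((isometry_stabEmbedding e).isClosedEmbedding.isClosedMap _ closed) (stabEmbedding_mem e b)
  · rintro _ _ ⟨a, ha, rfl⟩ ⟨b, hb, rfl⟩
    exact ⟨a + b, add a b ha hb, map_add _ _ _⟩
  · rintro c _ ⟨a, ha, rfl⟩
    exact ⟨c • a, smul c a ha, map_smul _ _ _⟩
  · rintro _ _ ⟨a, ha, rfl⟩ ⟨b, hb, rfl⟩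
    exact ⟨a * b, mul a b ha hb, map_mul _ _ _⟩

theorem ampIsometry_mul_mem (n : ℕ) (b : B) :
    ampIsometry n * stabEmbedding e b ∈ spatialStabilization π := by
  induction b using stab_induction e with
  | tensor b i j =>
    rw [stabEmbedding_stabTensor, ampIsometry_mul_elementaryTensor]
    exact elementaryTensor_mem _ _ _ _
  | add a b ha hb => rw [map_add, mul_add]; exact add_mem ha hb
  | smul c a ha =>
    rw [map_smul, mul_smul_comm]
    exact (spatialStabilization π).smul_mem' c ha
  | mul a b ha _ =>
    rw [map_mul, ← mul_assoc]
    exact mul_mem ha (stabEmbedding_mem e b)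
  | closed =>
    exact isClosed_closure.preimage
      (continuous_const.mul (isometry_stabEmbedding e).continuous)

theorem star_ampIsometry_mul_mem (n : ℕ) (b : B) :
    star (ampIsometry (H := H) n) * stabEmbedding e b ∈ spatialStabilization π := by
  induction b using stab_induction e with
  | tensor b i j =>
    rw [stabEmbedding_stabTensor, ← Nat.pair_unpair i]
    by_cases h : (Nat.unpair i).1 = n
    · rw [h, star_ampIsometry_mul_elementaryTensor]
      exact elementaryTensor_mem _ _ _ _
    · rw [star_ampIsometry_mul_elementaryTensor_of_ne π h]
      exact zero_mem _
  | add a b ha hb => rw [map_add, mul_add]; exact add_mem ha hb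
  | smul c a ha =>
    rw [map_smul, mul_smul_comm]
    exact (spatialStabilization π).smul_mem' c ha
  | mul a b ha _ =>
    rw [map_mul, ← mul_assoc]
    exact mul_mem ha (stabEmbedding_mem e b)
  | closed =>
    exact isClosed_closure.preimage
      (continuous_const.mul (isometry_stabEmbedding e).continuous)

theorem mul_ampIsometry_mem (n : ℕ) (b : B) :
    stabEmbedding e b * ampIsometry n ∈ spatialStabilization π := by
  have := star_mem (star_ampIsometry_mul_mem e n (star b))
  simpa [map_star] using this

theorem exists_multiplier_ampIsometry (n : ℕ) : ∃ t : 𝓜(ℂ, B),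
    (∀ b, stabEmbedding e (t.fst b) = ampIsometry n * stabEmbedding e b) ∧
      ∀ b, stabEmbedding e (t.snd b) = stabEmbedding e b * ampIsometry n :=
  exists_multiplier (stabEmbedding e) (stabEmbedding_injective e)
    (fun b => ⟨_, stabEmbedding_symm e (ampIsometry_mul_mem e n b)⟩)
    (fun b => ⟨_, stabEmbedding_symm e (mul_ampIsometry_mem e n b)⟩)

/-- The isometry `1 ⊗ vₙ`, as a multiplier of the stable C⋆-algebra `B ≅ π(B) ⊗ 𝒦`. -/
def stabIsometry (n : ℕ) : 𝓜(ℂ, B) := (exists_multiplier_ampIsometry e n).choose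

theorem stabEmbedding_stabIsometry_fst (n : ℕ) (b : B) :
    stabEmbedding e ((stabIsometry e n).fst b) = ampIsometry n * stabEmbedding e b :=
  (exists_multiplier_ampIsometry e n).choose_spec.1 b

theorem stabEmbedding_star_stabIsometry_fst (n : ℕ) (b : B) :
    stabEmbedding e ((star (stabIsometry e n)).fst b) =
      star (ampIsometry (H := H) n) * stabEmbedding e b := by
  rw [DoubleCentralizer.star_fst, map_star, stabIsometry,
    (exists_multiplier_ampIsometry e n).choose_spec.2, star_mul, map_star, star_star]

theorem stabIsometry_fst_tensor (n : ℕ) (b : B) (i j : ℕ) :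
    (stabIsometry e n).fst (stabTensor e b i j) =
      stabTensor e b (Nat.pair n i) j :=
  stabEmbedding_injective e <| by
    rw [stabEmbedding_stabIsometry_fst, stabEmbedding_stabTensor, stabEmbedding_stabTensor,
      ampIsometry_mul_elementaryTensor]

theorem orthogonalIsometries_stabIsometry : OrthogonalIsometries (stabIsometry e) where
  star_mul_self n := multiplier_ext_fst fun b => stabEmbedding_injective e <| by
    change stabEmbedding e ((star (stabIsometry e n)).fst ((stabIsometry e n).fst b)) =
      stabEmbedding e b
    rw [stabEmbedding_star_stabIsometry_fst, stabEmbedding_stabIsometry_fst, ← mul_assoc,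
      star_ampIsometry_mul_self, one_mul]
  star_mul_of_ne m n h := multiplier_ext_fst fun b => stabEmbedding_injective e <| by
    change stabEmbedding e ((star (stabIsometry e m)).fst ((stabIsometry e n).fst b)) =
      stabEmbedding e 0
    rw [stabEmbedding_star_stabIsometry_fst, stabEmbedding_stabIsometry_fst, ← mul_assoc,
      star_ampIsometry_mul_of_ne h.symm, zero_mul, map_zero]

theorem sum_stabIsometry_proj_fst_tensor {i N : ℕ} (hN : (Nat.unpair i).1 < N) (b : B) (j : ℕ) :
    (∑ n ∈ Finset.range N, stabIsometry e n * star (stabIsometry e n)).fst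
        (stabTensor e b i j) = stabTensor e b i j := by
  have ht := orthogonalIsometries_stabIsometry e
  have hproj : (∑ n ∈ Finset.range N, stabIsometry e n * star (stabIsometry e n)) *
      stabIsometry e (Nat.unpair i).1 = stabIsometry e (Nat.unpair i).1 := by
    simp only [Finset.sum_mul, mul_assoc]
    rw [Finset.sum_eq_single_of_mem _ (Finset.mem_range.mpr hN), ht.star_mul_self, mul_one]
    exact fun n _ hn => by rw [ht.star_mul_of_ne _ _ hn, mul_zero]
  rw [← Nat.pair_unpair i, ← stabIsometry_fst_tensor]
  exact congrArg (fun x : 𝓜(ℂ, B) => x.fst _) hproj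

theorem tendsto_sum_stabIsometry_proj_fst (b : B) :
    Tendsto (fun N => (∑ n ∈ Finset.range N, stabIsometry e n * star (stabIsometry e n)).fst b)
      atTop (𝓝 b) := by
  induction b using stab_induction e with
  | tensor b i j =>
    refine tendsto_const_nhds.congr' ?_
    filter_upwards [eventually_gt_atTop (Nat.unpair i).1] with N hN
    exact (sum_stabIsometry_proj_fst_tensor e hN b j).symm
  | add a b ha hb => simpa only [map_add] using ha.add hb
  | smul c a ha => simpa only [map_smul] using ha.const_smul c
  | mul a b ha => simpa only [fst_mul] using ha.mul_const b
  | closed =>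
    refine Equicontinuous.isClosed_setOfPred_tendsto ?_ continuous_id
    refine (LipschitzWith.uniformEquicontinuous _ 1 fun N => ?_).equicontinuous
    refine AddMonoidHomClass.lipschitz_of_bound_nnnorm _ 1 fun b => ?_
    refine ContinuousLinearMap.le_of_opNorm_le _ ?_ b
    rw [DoubleCentralizer.norm_fst]
    exact (orthogonalIsometries_stabIsometry e).norm_sum_proj_le _

theorem hasStrictSum_stabIsometry_proj :
    HasStrictSum (fun n => stabIsometry e n * star (stabIsometry e n)) 1 := by
  have h : ∀ b, Tendsto (fun N => (∑ n ∈ Finset.range N, stabIsometry e n *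
      star (stabIsometry e n)) * incl B b) atTop (𝓝 (incl B b)) := fun b => by
    simp_rw [mul_incl]
    exact (continuous_incl.tendsto _).comp (tendsto_sum_stabIsometry_proj_fst e b)
  refine tendsto_toStrict_iff.mpr ⟨fun b => by simpa using h b, fun b => ?_⟩
  have := (continuous_star.tendsto _).comp (h (star b))
  simpa [Function.comp_def, map_star] using this

variable {G : Type*} [Group G] [TopologicalSpace G] {β : CStarAction G B}

theorem stabIsometry_fst_toHom
    (htensor : ∀ g b i j, β.toHom g (stabTensor e b i j) =
      stabTensor e (β.toHom g b) i j) (n : ℕ) (g : G) (b : B) :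
    (stabIsometry e n).fst (β.toHom g b) = β.toHom g ((stabIsometry e n).fst b) := by
  induction b using stab_induction e with
  | tensor b i j => rw [htensor, stabIsometry_fst_tensor, stabIsometry_fst_tensor, htensor]
  | add a b ha hb => simp only [map_add, ha, hb]
  | smul c a ha => simp only [map_smul, ha]
  | mul a b ha => rw [map_mul, fst_mul, ha, fst_mul, map_mul]
  | closed =>
    have hg := (StarAlgEquiv.isometry (β.toHom g)).continuous
    exact isClosed_eq ((stabIsometry e n).fst.continuous.comp hg)
      (hg.comp (stabIsometry e n).fst.continuous)

end Amplification

theorem CStarAction.IsStronglyStable.exists_isCuntzSequence {G B : Type*} [Group G]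
    [TopologicalSpace G] [NonUnitalCStarAlgebra B] {β : CStarAction G B}
    (hβ : β.IsStronglyStable) : ∃ t, β.IsCuntzSequence t := by
  obtain ⟨H, _, _, _, π, -, e, he⟩ := hβ
  refine ⟨stabIsometry e, fun n => ⟨(orthogonalIsometries_stabIsometry e).star_mul_self n,
    fun g => multiplier_ext_fst fun b => ?_⟩, hasStrictSum_stabIsometry_proj e⟩
  change β.toHom g ((stabIsometry e n).fst ((β.toHom g).symm b)) = _
  rw [← stabIsometry_fst_toHom e fun g b i j => by
    rw [stabTensor, stabTensor, ← he, StarAlgEquiv.symm_apply_apply],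
    StarAlgEquiv.apply_symm_apply]

section StrictSums

theorem cauchySeq_of_modulus {E F : Type*} [SeminormedAddCommGroup E] [SeminormedAddCommGroup F]
    {f : ℕ → E} {g : ℕ → F} (hg : CauchySeq g)
    (h : ∀ ε > 0, ∃ δ > 0, ∀ N M, N ≤ M → ‖g M - g N‖ < δ → ‖f M - f N‖ < ε) : CauchySeq f := by
  rw [Metric.cauchySeq_iff']
  intro ε hε
  obtain ⟨δ, hδ, hfg⟩ := h ε hε
  obtain ⟨N, hN⟩ := Metric.cauchySeq_iff'.mp hg δ hδ
  refine ⟨N, fun M hM => ?_⟩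
  rw [dist_eq_norm]
  exact hfg N M hM (by rw [← dist_eq_norm]; exact hN M hM)

theorem cauchySeq_of_norm_sub_le {E F : Type*} [SeminormedAddCommGroup E]
    [SeminormedAddCommGroup F] {f : ℕ → E} {g : ℕ → F} (hg : CauchySeq g) {C : ℝ} (hC : 0 ≤ C)
    (h : ∀ N M, N ≤ M → ‖f M - f N‖ ≤ C * ‖g M - g N‖) : CauchySeq f := by
  refine cauchySeq_of_modulus hg fun ε hε => ⟨ε / (C + 1), by positivity, fun N M hNM hlt => ?_⟩
  calc ‖f M - f N‖ ≤ C * ‖g M - g N‖ := h N M hNM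
    _ ≤ (C + 1) * ‖g M - g N‖ := by gcongr; linarith
    _ < (C + 1) * (ε / (C + 1)) := by gcongr
    _ = ε := by field_simp

theorem OrthogonalIsometries.cauchySeq_sum_mul {M : Type*} [CStarAlgebra M] {t : ℕ → M}
    (ht : OrthogonalIsometries t) {y : ℕ → M} {b : M}
    (h : CauchySeq fun N => (∑ n ∈ Finset.range N, star (y n) * y n) * b) :
    CauchySeq fun N => (∑ n ∈ Finset.range N, t n * y n) * b := by
  refine cauchySeq_of_modulus h fun ε hε =>
    ⟨ε ^ 2 / (‖b‖ + 1), by positivity, fun N M hNM hlt => ?_⟩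
  rw [← sub_mul, ← Finset.sum_Ico_eq_sub _ hNM] at hlt ⊢
  refine lt_of_pow_lt_pow_left₀ 2 hε.le ?_
  calc ‖(∑ n ∈ Finset.Ico N M, t n * y n) * b‖ ^ 2
      = ‖star b * ((∑ n ∈ Finset.Ico N M, star (y n) * y n) * b)‖ := by
        rw [sq, ← CStarRing.norm_star_mul_self, star_mul, mul_assoc,
          ← mul_assoc (star (∑ n ∈ _, _)), ht.star_sum_mul_sum]
    _ ≤ ‖b‖ * ‖(∑ n ∈ Finset.Ico N M, star (y n) * y n) * b‖ := by
        rw [← norm_star b]; exact norm_mul_le _ _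
    _ ≤ (‖b‖ + 1) * ‖(∑ n ∈ Finset.Ico N M, star (y n) * y n) * b‖ := by gcongr; linarith
    _ < (‖b‖ + 1) * (ε ^ 2 / (‖b‖ + 1)) := by gcongr
    _ = ε ^ 2 := by field_simp

variable {G B : Type*} [Group G] [TopologicalSpace G] [NonUnitalCStarAlgebra B]
  {β : CStarAction G B} {t : ℕ → 𝓜(ℂ, B)}

namespace CStarAction.IsCuntzSequence

theorem cauchySeq_mul_sum (ht : β.IsCuntzSequence t) {y : ℕ → 𝓜(ℂ, B)} {C : ℝ} (hC : 0 ≤ C)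
    (hy : ∀ N, ‖∑ n ∈ Finset.range N, t n * y n‖ ≤ C) (b : B) :
    CauchySeq fun N => incl B b * ∑ n ∈ Finset.range N, t n * y n := by
  refine cauchySeq_of_norm_sub_le (ht.tendsto_mul_proj b).cauchySeq hC fun N M hNM => ?_
  have hproj : ∀ k ≤ M, ∑ n ∈ Finset.range k, t n * y n =
      (∑ n ∈ Finset.range k, t n * star (t n)) * ∑ n ∈ Finset.range M, t n * y n := fun k hk =>
    (ht.orthogonalIsometries.proj_mul_sum y (Finset.range_mono hk)).symm
  calc ‖incl B b * ∑ n ∈ Finset.range M, t n * y n - incl B b * ∑ n ∈ Finset.range N, t n * y n‖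
      = ‖(incl B b * ∑ n ∈ Finset.range M, t n * star (t n) -
          incl B b * ∑ n ∈ Finset.range N, t n * star (t n)) *
            ∑ n ∈ Finset.range M, t n * y n‖ := by
        rw [hproj N hNM, sub_mul, mul_assoc, mul_assoc, ← hproj M le_rfl]
    _ ≤ C * _ := by
        rw [mul_comm C]
        exact (norm_mul_le _ _).trans (by gcongr; exact hy M)

theorem exists_column (ht : β.IsCuntzSequence t) (y : ℕ → 𝓜(ℂ, B)) {C : ℝ} (hC : 0 ≤ C)
    (hbdd : ∀ N, ‖∑ n ∈ Finset.range N, star (y n) * y n‖ ≤ C ^ 2)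
    (hcau : ∀ b, CauchySeq fun N => (∑ n ∈ Finset.range N, star (y n) * y n) * incl B b) :
    ∃ s : 𝓜(ℂ, B), HasStrictSum (fun n => t n * y n) s ∧ ∀ n, star (t n) * s = y n := by
  have ho := ht.orthogonalIsometries
  have hS : ∀ N, ‖∑ n ∈ Finset.range N, t n * y n‖ ≤ C := fun N =>
    (pow_le_pow_iff_left₀ (norm_nonneg _) hC two_ne_zero).mp (by rw [ho.norm_sq_sum]; exact hbdd N)
  obtain ⟨s, hs⟩ := exists_strict_limit (fun b => ho.cauchySeq_sum_mul (hcau b))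
    (fun b => ht.cauchySeq_mul_sum hC hS b)
  refine ⟨s, hs, fun n => mul_strict_limit_eq hs ?_⟩
  filter_upwards [eventually_gt_atTop n] with N hN
  exact ho.star_mul_sum _ y (Finset.mem_range.mpr hN)

theorem isometry_of_column (ht : β.IsCuntzSequence t) {s : 𝓜(ℂ, B)} {y : ℕ → 𝓜(ℂ, B)}
    (hs : ∀ n, star (t n) * s = y n)
    (h : ∀ b, Tendsto (fun N => (∑ n ∈ Finset.range N, star (y n) * y n) * incl B b) atTop
      (𝓝 (incl B b))) : star s * s = 1 := by
  refine multiplier_ext_mul_right fun b => ?_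
  rw [one_mul, mul_assoc, mul_incl s]
  refine tendsto_nhds_unique ((ht.tendsto_proj_mul (s.fst b)).const_mul (star s)) ?_
  refine (h b).congr fun N => ?_
  have hN : star s * (∑ n ∈ Finset.range N, t n * star (t n)) * s =
      ∑ n ∈ Finset.range N, star (y n) * y n := by
    rw [Finset.mul_sum, Finset.sum_mul]
    refine Finset.sum_congr rfl fun n _ => ?_
    rw [← mul_assoc, mul_assoc, hs, ← hs n, star_mul, star_star]
  rw [← mul_incl, ← mul_assoc, ← mul_assoc, hN]

theorem norm_sum_star_diag_mul_diag_le (ht : β.IsCuntzSequence t) (s : Finset ℕ)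
    {x : ℕ → 𝓜(ℂ, B)} {C : ℝ} (hC : 0 ≤ C) (hx : ∀ n, ‖x n‖ ≤ C) :
    ‖∑ n ∈ s, star (x n * star (t n)) * (x n * star (t n))‖ ≤ C ^ 2 := by
  rw [← ht.orthogonalIsometries.norm_sq_sum]
  have := ht.orthogonalIsometries.norm_sum_diag_le s hC hx
  gcongr

theorem exists_diag (ht : β.IsCuntzSequence t) (x : ℕ → 𝓜(ℂ, B)) {C : ℝ} (hC : 0 ≤ C)
    (hx : ∀ n, ‖x n‖ ≤ C) :
    ∃ s : 𝓜(ℂ, B), HasStrictSum (fun n => t n * x n * star (t n)) s ∧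
      (∀ n, star (t n) * s = x n * star (t n)) ∧ ∀ n, s * t n = t n * x n := by
  have ho := ht.orthogonalIsometries
  obtain ⟨s, hs, hs'⟩ := ht.exists_column (fun n => x n * star (t n)) hC
    (fun N => ht.norm_sum_star_diag_mul_diag_le _ hC hx) fun b => by
      refine cauchySeq_of_norm_sub_le (ht.tendsto_proj_mul b).cauchySeq (sq_nonneg C)
        fun N M hNM => ?_
      rw [← sub_mul, ← sub_mul, ← Finset.sum_Ico_eq_sub _ hNM, ← Finset.sum_Ico_eq_sub _ hNM]
      have hproj : ∑ n ∈ Finset.Ico N M, star (x n * star (t n)) * (x n * star (t n)) =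
          (∑ n ∈ Finset.Ico N M, star (x n * star (t n)) * (x n * star (t n))) *
            ∑ n ∈ Finset.Ico N M, t n * star (t n) := by
        rw [Finset.sum_mul]
        refine Finset.sum_congr rfl fun n hn => ?_
        rw [mul_assoc, mul_assoc, ho.star_mul_sum _ _ hn]
      rw [hproj, mul_assoc]
      refine (norm_mul_le _ _).trans ?_
      gcongr
      exact ht.norm_sum_star_diag_mul_diag_le _ hC hx
  refine ⟨s, by simpa only [mul_assoc] using hs, hs', fun n => ht.ext_left fun m => ?_⟩
  rw [← mul_assoc, hs', mul_assoc]
  rcases eq_or_ne m n with rfl | h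
  · rw [ho.star_mul_self, mul_one, ho.star_mul_mul_self]
  · rw [ho.star_mul_of_ne _ _ h, mul_zero, ho.star_mul_mul_of_ne h]

theorem exists_star_mul_eq_shift (ht : β.IsCuntzSequence t) :
    ∃ s : 𝓜(ℂ, B), star s * s = 1 ∧ star (t 0) * s = 0 ∧
      ∀ n, star (t (n + 1)) * s = star (t n) := by
  let y : ℕ → 𝓜(ℂ, B) := fun n => Nat.casesOn n 0 fun m => star (t m)
  have hy : ∀ N, ∑ n ∈ Finset.range (N + 1), star (y n) * y n =
      ∑ n ∈ Finset.range N, t n * star (t n) := fun N => by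
    rw [Finset.sum_range_succ']
    simp [y]
  have hlim : ∀ b, Tendsto (fun N => (∑ n ∈ Finset.range N, star (y n) * y n) * incl B b) atTop
      (𝓝 (incl B b)) := fun b => by
    rw [← tendsto_add_atTop_iff_nat 1]
    simp_rw [hy]
    exact ht.tendsto_proj_mul b
  have hbdd : ∀ N, ‖∑ n ∈ Finset.range N, star (y n) * y n‖ ≤ 1 ^ 2
    | 0 => by simp
    | N + 1 => by rw [hy, one_pow]; exact ht.orthogonalIsometries.norm_sum_proj_le _
  obtain ⟨s, -, hs⟩ := ht.exists_column y zero_le_one hbdd fun b => (hlim b).cauchySeq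
  exact ⟨s, ht.isometry_of_column hs hlim, hs 0, fun n => hs (n + 1)⟩

theorem exists_shift (ht : β.IsCuntzSequence t) :
    ∃ s : 𝓜(ℂ, B), β.IsCuntzPair s (t 0) ∧ ∀ n, s * t n = t (n + 1) := by
  obtain ⟨s, hs, hs₀, hsucc⟩ := ht.exists_star_mul_eq_shift
  have ho := ht.orthogonalIsometries
  have hstar₀ : star s * t 0 = 0 := by simpa using congrArg star hs₀
  have hstar : ∀ n, star s * t (n + 1) = t n := fun n => by simpa using congrArg star (hsucc n)
  have hshift : ∀ n, s * t n = t (n + 1) := fun n => ht.ext_left fun m => by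
    rw [← mul_assoc]
    rcases m with _ | m
    · rw [hs₀, zero_mul, ho.star_mul_of_ne _ _ (by simp)]
    · rw [hsucc]
      rcases eq_or_ne m n with rfl | h
      · rw [ho.star_mul_self, ho.star_mul_self]
      · rw [ho.star_mul_of_ne _ _ h, ho.star_mul_of_ne _ _ (by simpa using h)]
  refine ⟨s, ⟨⟨hs, fun g => ht.ext_left fun n => ?_⟩, ht.isometry 0, ht.ext_right fun n => ?_⟩,
    hshift⟩
  · conv_lhs => rw [← ht.fixed n g, ← map_star, ← map_mul]
    rcases n with _ | n
    · rw [hs₀, map_zero]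
    · rw [hsucc, map_star, ht.fixed]
  · rw [add_mul, one_mul, mul_assoc, mul_assoc]
    rcases n with _ | n
    · rw [hstar₀, ho.star_mul_self, mul_zero, mul_one, zero_add]
    · rw [hstar, hshift, ho.star_mul_of_ne _ _ (by simp), mul_zero, add_zero]

end CStarAction.IsCuntzSequence

end StrictSums

section CountableSum

variable {G A B : Type*} [Group G] [TopologicalSpace G]
  [NonUnitalCStarAlgebra A] [NonUnitalCStarAlgebra B]
  {α : CStarAction G A} {β : CStarAction G B}

theorem continuous_toStrict_iff_incl {X : Type*} [TopologicalSpace X] {f : X → 𝓜(ℂ, B)} :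
    (Continuous fun x => toStrict (f x)) ↔
      (∀ b, Continuous fun x => f x * incl B b) ∧ ∀ b, Continuous fun x => incl B b * f x := by
  rw [continuous_toStrict_iff]
  simp_rw [mul_incl, incl_mul, (isometry_incl (B := B)).isEmbedding.continuous_iff]
  rfl

theorem continuous_toStrict_star {X : Type*} [TopologicalSpace X] {f : X → 𝓜(ℂ, B)}
    (hf : Continuous fun x => toStrict (f x)) : Continuous fun x => toStrict (star (f x)) := by
  rw [continuous_toStrict_iff_incl] at hf ⊢
  refine ⟨fun b => ?_, fun b => ?_⟩
  · simpa [map_star] using (hf.2 (star b)).star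
  · simpa [map_star] using (hf.1 (star b)).star

namespace CocycleRep

theorem norm_coc_le (Φ : CocycleRep α β) (g : G) : ‖(Φ.coc g : 𝓜(ℂ, B))‖ ≤ 1 :=
  norm_coe_unitary_le_one _

theorem norm_hom_le (Φ : CocycleRep α β) (a : A) : ‖Φ.hom a‖ ≤ ‖a‖ :=
  NonUnitalStarAlgHom.norm_apply_le Φ.hom a

/-- The cocycle representation `Ψ` restricts along the isometry `t` to `Φ`. -/
structure Intertwines (t : 𝓜(ℂ, B)) (Φ Ψ : CocycleRep α β) : Prop where
  hom : ∀ a, Ψ.hom a * t = t * Φ.hom a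
  coc : ∀ g, (Ψ.coc g : 𝓜(ℂ, B)) * t = t * Φ.coc g

end CocycleRep

namespace CStarAction.IsCuntzSequence

variable {t : ℕ → 𝓜(ℂ, B)}

theorem continuous_mul_incl_of_mul_eq (ht : β.IsCuntzSequence t) {X : Type*} [TopologicalSpace X]
    {f : ℕ → X → 𝓜(ℂ, B)} (hf : ∀ n, Continuous fun x => toStrict (f n x)) {u : X → 𝓜(ℂ, B)}
    {C : ℝ} (hu : ∀ x, ‖u x‖ ≤ C) (huf : ∀ x n, u x * t n = t n * f n x) (b : B) :
    Continuous fun x => u x * incl B b := by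
  have hunif : TendstoUniformly
      (fun N x => u x * ((∑ n ∈ Finset.range N, t n * star (t n)) * incl B b))
      (fun x => u x * incl B b) atTop := by
    have h := (tendsto_iff_norm_sub_tendsto_zero.mp (ht.tendsto_proj_mul b)).const_mul C
    rw [mul_zero] at h
    refine Metric.tendstoUniformly_iff.mpr fun ε hε => ?_
    filter_upwards [h.eventually_lt_const hε] with N hN x
    rw [dist_comm, dist_eq_norm, ← mul_sub]
    exact ((norm_mul_le _ _).trans (by gcongr; exact hu x)).trans_lt hN
  refine hunif.continuous (Frequently.of_forall fun N => ?_)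
  simp_rw [Finset.sum_mul, Finset.mul_sum, mul_assoc, ← mul_assoc (u _), huf, mul_incl (star _),
    mul_assoc]
  exact continuous_finsetSum _ fun n _ =>
    ((continuous_toStrict_iff_incl.mp (hf n)).1 _).const_mul (t n)

theorem continuous_toStrict_of_mul_eq (ht : β.IsCuntzSequence t) {X : Type*} [TopologicalSpace X]
    {f : ℕ → X → 𝓜(ℂ, B)} (hf : ∀ n, Continuous fun x => toStrict (f n x)) {u : X → 𝓜(ℂ, B)}
    {C : ℝ} (hu : ∀ x, ‖u x‖ ≤ C) (huf : ∀ x n, u x * t n = t n * f n x)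
    (huf' : ∀ x n, star (u x) * t n = t n * star (f n x)) :
    Continuous fun x => toStrict (u x) := by
  refine continuous_toStrict_iff_incl.mpr
    ⟨ht.continuous_mul_incl_of_mul_eq hf hu huf, fun b => ?_⟩
  have := ht.continuous_mul_incl_of_mul_eq (fun n => continuous_toStrict_star (hf n))
    (fun x => (norm_star (u x)).trans_le (hu x)) huf' (star b)
  simpa [map_star] using this.star

theorem mult_mul_eq (ht : β.IsCuntzSequence t) (g : G) {n : ℕ} {x y : 𝓜(ℂ, B)}
    (h : x * t n = t n * y) : β.mult g x * t n = t n * β.mult g y := by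
  simpa only [map_mul, ht.fixed] using congrArg (β.mult g) h

theorem mem_unitary_of_mul_eq (ht : β.IsCuntzSequence t) {u : 𝓜(ℂ, B)} {v : ℕ → unitary 𝓜(ℂ, B)}
    (hu : ∀ n, u * t n = t n * v n) (hu' : ∀ n, star u * t n = t n * star (v n : 𝓜(ℂ, B))) :
    u ∈ unitary 𝓜(ℂ, B) := by
  refine Unitary.mem_iff.mpr ⟨ht.ext_right fun n => ?_, ht.ext_right fun n => ?_⟩
  · rw [mul_assoc, hu, ← mul_assoc, hu', mul_assoc, Unitary.coe_star_mul_self, mul_one, one_mul]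
  · rw [mul_assoc, hu', ← mul_assoc, hu, mul_assoc,
      Unitary.mul_star_self_of_mem (v n).2, mul_one, one_mul]

end CStarAction.IsCuntzSequence

theorem CocycleRep.exists_isCountableSum {t : ℕ → 𝓜(ℂ, B)} (ht : β.IsCuntzSequence t)
    (Φ : ℕ → CocycleRep α β) :
    ∃ Ψ, IsCountableSum t Φ Ψ ∧ ∀ n, Intertwines (t n) (Φ n) Ψ := by
  choose φ hφ hφ' hφt using fun a => ht.exists_diag (fun n => (Φ n).hom a) (norm_nonneg a)
    (fun n => (Φ n).norm_hom_le a)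
  choose u hu hu' hut using fun g => ht.exists_diag (fun n => ((Φ n).coc g : 𝓜(ℂ, B)))
    zero_le_one (fun n => (Φ n).norm_coc_le g)
  have hφs : ∀ a n, star (φ a) * t n = t n * star ((Φ n).hom a) := fun a n => by
    simpa using congrArg star (hφ' a n)
  have hus : ∀ g n, star (u g) * t n = t n * star ((Φ n).coc g : 𝓜(ℂ, B)) := fun g n => by
    simpa using congrArg star (hu' g n)
  have hmem : ∀ g, u g ∈ unitary 𝓜(ℂ, B) := fun g =>
    ht.mem_unitary_of_mul_eq (v := fun n => (Φ n).coc g) (hut g) (hus g)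
  let Ψ : CocycleRep α β :=
    { hom :=
        { toFun := φ
          map_smul' := fun c a => ht.ext_right fun n => by
            rw [hφt, map_smul, mul_smul_comm, MonoidHom.id_apply, smul_mul_assoc, hφt]
          map_zero' := ht.ext_right fun n => by rw [hφt, map_zero, mul_zero, zero_mul]
          map_add' := fun a b => ht.ext_right fun n => by
            rw [hφt, map_add, mul_add, add_mul, hφt, hφt]
          map_mul' := fun a b => ht.ext_right fun n => by
            rw [hφt, map_mul, mul_assoc, hφt, ← mul_assoc, ← mul_assoc, hφt]
          map_star' := fun a => ht.ext_right fun n => by rw [hφt, hφs, map_star] }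
      coc := fun g => ⟨u g, hmem g⟩
      continuous_coc := ht.continuous_toStrict_of_mul_eq (fun n => (Φ n).continuous_coc)
        (fun g => norm_coe_unitary_le_one ⟨u g, hmem g⟩) hut hus
      coc_mul := fun g h => ht.ext_right fun n => by
        change u (g * h) * t n = u g * β.mult g (u h) * t n
        rw [hut, (Φ n).coc_mul, mul_assoc, ht.mult_mul_eq g (hut h n), ← mul_assoc, ← mul_assoc,
          hut]
      equivariant := fun g a => ht.ext_right fun n => by
        change u g * β.mult g (φ a) * star (u g) * t n = φ (α.toHom g a) * t n
        rw [hφt, ← (Φ n).equivariant, mul_assoc, hus, mul_assoc (u g),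
          ← mul_assoc (β.mult g (φ a)), ht.mult_mul_eq g (hφt a n), ← mul_assoc, ← mul_assoc, hut]
        simp only [mul_assoc] }
  exact ⟨Ψ, ⟨hφ, hu⟩, fun n => ⟨fun a => hφt a n, fun g => hut g n⟩⟩

end CountableSum

section Averaging

variable {M : Type*} [CStarAlgebra M]

theorem norm_sq_sum_range_le {y : ℕ → M} {C δ : ℝ} (hy : ∀ k, ‖y k‖ ≤ C)
    (h : ∀ j k, j < k → ‖star (y j) * y k‖ ≤ δ) (hδ : 0 ≤ δ) (N : ℕ) :
    ‖∑ k ∈ Finset.range N, y k‖ ^ 2 ≤ N * C ^ 2 + N ^ 2 * δ := by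
  have hoff : ∀ j k, j ≠ k → ‖star (y j) * y k‖ ≤ δ := fun j k hjk => by
    rcases lt_or_gt_of_ne hjk with hlt | hlt
    · exact h j k hlt
    · rw [← norm_star, star_mul, star_star]
      exact h k j hlt
  have hall : ∀ j k, ‖star (y j) * y k‖ ≤ (if j = k then C ^ 2 else 0) + δ := fun j k => by
    split_ifs with hjk
    · subst hjk
      rw [CStarRing.norm_star_mul_self, ← sq]
      linarith [pow_le_pow_left₀ (norm_nonneg _) (hy j) 2]
    · linarith [hoff j k hjk]
  have hrow : ∀ j ∈ Finset.range N,
      ∑ k ∈ Finset.range N, ((if j = k then C ^ 2 else 0) + δ) = C ^ 2 + N * δ := fun j hj => by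
    rw [Finset.sum_add_distrib, Finset.sum_ite_eq, if_pos hj, Finset.sum_const, Finset.card_range,
      nsmul_eq_mul]
  rw [sq, ← CStarRing.norm_star_mul_self, star_sum, Finset.sum_mul_sum]
  calc ‖∑ j ∈ Finset.range N, ∑ k ∈ Finset.range N, star (y j) * y k‖
      ≤ ∑ j ∈ Finset.range N, ∑ k ∈ Finset.range N, ((if j = k then C ^ 2 else 0) + δ) :=
        norm_sum_le_of_le _ fun j _ => norm_sum_le_of_le _ fun k _ => hall j k
    _ = N * C ^ 2 + N ^ 2 * δ := by
        rw [Finset.sum_congr rfl hrow, Finset.sum_const, Finset.card_range, nsmul_eq_mul]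
        ring

theorem norm_sq_average_le {y : ℕ → M} {C δ : ℝ} (hy : ∀ k, ‖y k‖ ≤ C)
    (h : ∀ j k, j < k → ‖star (y j) * y k‖ ≤ δ) (hδ : 0 ≤ δ) {N : ℕ} (hN : 0 < N) :
    ‖∑ k ∈ Finset.range N, (N : ℝ)⁻¹ • y k‖ ^ 2 ≤ C ^ 2 / N + δ := by
  rw [← Finset.smul_sum, norm_smul, mul_pow, norm_inv, Real.norm_natCast]
  calc ((N : ℝ)⁻¹) ^ 2 * ‖∑ k ∈ Finset.range N, y k‖ ^ 2
      ≤ ((N : ℝ)⁻¹) ^ 2 * (N * C ^ 2 + N ^ 2 * δ) := by gcongr; exact norm_sq_sum_range_le hy h hδ N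
    _ = C ^ 2 / N + δ := by field_simp

/-- This replaces the Hahn–Banach argument that is customary for quasicentral approximate units:
averages of almost orthogonal elements are small. -/
theorem exists_mem_forall_norm_le {E I : Type*} [AddCommGroup E] [Module ℝ E]
    {l : Filter E} [l.NeBot] (D : I → E →ₗ[ℝ] M) {C : ℝ}
    (hD : ∀ᶠ e in l, ∀ i, ‖D i e‖ ≤ C)
    (horth : ∀ᶠ e₀ in l, ∀ δ > 0, ∀ᶠ e in l, ∀ i, ‖star (D i e₀) * D i e‖ ≤ δ)
    {S : Set E} (hS : S ∈ l) (hconv : Convex ℝ S) {ε : ℝ} (hε : 0 < ε) :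
    ∃ e ∈ S, ∀ i, ‖D i e‖ ≤ ε := by
  obtain ⟨N, hN⟩ := exists_nat_gt (C ^ 2 / (ε ^ 2 / 2))
  have hN₀ : (0 : ℝ) < N := lt_of_le_of_lt (by positivity) hN
  obtain ⟨f, hf, hff⟩ := exists_seq_of_forall_finset_exists
    (fun e => e ∈ S ∧ (∀ i, ‖D i e‖ ≤ C) ∧
      ∀ δ > 0, ∀ᶠ e' in l, ∀ i, ‖star (D i e) * D i e'‖ ≤ δ)
    (fun e e' => ∀ i, ‖star (D i e) * D i e'‖ ≤ ε ^ 2 / 2) (fun s hs => by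
      have h₁ : ∀ᶠ e in l, ∀ x ∈ s, ∀ i, ‖star (D i x) * D i e‖ ≤ ε ^ 2 / 2 :=
        (Filter.eventually_all_finset s).mpr fun x hx => (hs x hx).2.2 _ (by positivity)
      obtain ⟨e, he₁, he₂, he₃, he₄⟩ :=
        ((Filter.eventually_mem_set.mpr hS).and (hD.and (horth.and h₁))).exists
      exact ⟨e, ⟨he₁, he₂, he₃⟩, he₄⟩)
  refine ⟨∑ k ∈ Finset.range N, (N : ℝ)⁻¹ • f k, ?_, fun i => ?_⟩
  · refine hconv.sum_mem (fun _ _ => by positivity) ?_ fun k _ => (hf k).1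
    simp [hN₀.ne']
  · simp_rw [map_sum, map_smul]
    have haverage := norm_sq_average_le (fun k => (hf k).2.1 i) (fun j k hjk => hff j k hjk i)
      (by positivity) (N := N) (by exact_mod_cast hN₀)
    have hdiag : C ^ 2 / N ≤ ε ^ 2 / 2 := by
      rw [div_lt_iff₀ (by positivity)] at hN
      rw [div_le_iff₀ hN₀]
      linarith
    exact abs_le_of_sq_le_sq' (haverage.trans (by linarith)) hε.le |>.2

end Averaging

section SquareRoot

theorem norm_pow_mul_sub_mul_pow_le {M : Type*} [NormedRing M] {d d' : M} (hd : ‖d‖ ≤ 1)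
    (hd' : ‖d'‖ ≤ 1) (x : M) (n : ℕ) : ‖d ^ n * x - x * d' ^ n‖ ≤ n * ‖d * x - x * d'‖ := by
  induction n with
  | zero => simp
  | succ n ih =>
    have hsplit : d ^ (n + 1) * x - x * d' ^ (n + 1) =
        d * (d ^ n * x - x * d' ^ n) + (d * x - x * d') * d' ^ n := by
      rw [pow_succ', pow_succ']
      noncomm_ring
    have hfirst : ‖d * (d ^ n * x - x * d' ^ n)‖ ≤ n * ‖d * x - x * d'‖ :=
      (norm_mul_le _ _).trans ((mul_le_of_le_one_left (norm_nonneg _) hd).trans ih)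
    have hsecond : ‖(d * x - x * d') * d' ^ n‖ ≤ ‖d * x - x * d'‖ := by
      rcases n with _ | n
      · simp
      · refine (norm_mul_le _ _).trans (mul_le_of_le_one_right (norm_nonneg _) ?_)
        exact (norm_pow_le' d' n.succ_pos).trans (pow_le_one₀ (norm_nonneg _) hd')
    rw [hsplit]
    refine (norm_add_le _ _).trans ?_
    push_cast
    linarith

theorem exists_norm_aeval_mul_sub_mul_aeval_le {M : Type*} [NormedRing M] [NormedAlgebra ℝ M]
    (p : Polynomial ℝ) :
    ∃ L : ℝ, 0 ≤ L ∧ ∀ d d' x : M, ‖d‖ ≤ 1 → ‖d'‖ ≤ 1 →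
      ‖Polynomial.aeval d p * x - x * Polynomial.aeval d' p‖ ≤ L * ‖d * x - x * d'‖ := by
  induction p using Polynomial.induction_on' with
  | add p q hp hq =>
    obtain ⟨L, hL, h⟩ := hp
    obtain ⟨L', hL', h'⟩ := hq
    refine ⟨L + L', by positivity, fun d d' x hd hd' => ?_⟩
    have hsplit : Polynomial.aeval d (p + q) * x - x * Polynomial.aeval d' (p + q) =
        (Polynomial.aeval d p * x - x * Polynomial.aeval d' p) +
          (Polynomial.aeval d q * x - x * Polynomial.aeval d' q) := by
      simp only [map_add]
      noncomm_ring
    rw [hsplit, add_mul]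
    exact norm_add_le_of_le (h d d' x hd hd') (h' d d' x hd hd')
  | monomial n a =>
    refine ⟨‖a‖ * n, by positivity, fun d d' x hd hd' => ?_⟩
    have hmonomial : Polynomial.aeval d (Polynomial.monomial n a) * x -
        x * Polynomial.aeval d' (Polynomial.monomial n a) = a • (d ^ n * x - x * d' ^ n) := by
      rw [Polynomial.aeval_monomial, Polynomial.aeval_monomial, smul_sub,
        Algebra.algebraMap_eq_smul_one, smul_mul_assoc, smul_mul_assoc, one_mul, smul_mul_assoc,
        one_mul, mul_smul_comm]
    rw [hmonomial, norm_smul, mul_assoc]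
    exact mul_le_mul_of_nonneg_left (norm_pow_mul_sub_mul_pow_le hd hd' x n) (norm_nonneg _)

variable (M : Type*) [CStarAlgebra M] [PartialOrder M] [StarOrderedRing M]

theorem exists_norm_sub_aeval_mul_self_le {η : ℝ} (hη : 0 < η) :
    ∃ p : Polynomial ℝ, ∀ f : M, 0 ≤ f → ‖f‖ ≤ 1 → ‖f - Polynomial.aeval (f * f) p‖ ≤ η := by
  obtain ⟨p, hp⟩ := exists_polynomial_near_of_continuousOn 0 1 Real.sqrt
    Real.continuous_sqrt.continuousOn η hη
  refine ⟨p, fun f hf hf₁ => ?_⟩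
  have hcfc : f - Polynomial.aeval (f * f) p =
      cfc (fun t : ℝ => (Polynomial.X - p.comp (Polynomial.X ^ 2) : Polynomial ℝ).eval t) f := by
    rw [cfc_polynomial (Polynomial.X - p.comp (Polynomial.X ^ 2)) f (.of_nonneg hf)]
    simp [Polynomial.aeval_comp, sq]
  rw [hcfc]
  refine norm_cfc_le hη.le fun t ht => ?_
  have ht₀ : 0 ≤ t := spectrum_nonneg_of_nonneg hf ht
  have ht₁ : t ≤ 1 := by
    obtain _ | _ := subsingleton_or_nontrivial M
    · simp [spectrum.of_subsingleton] at ht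
    · exact ((le_abs_self t).trans (spectrum.norm_le_norm_of_mem ht)).trans hf₁
  have hnear := hp (t ^ 2) ⟨by positivity, by nlinarith⟩
  rw [Real.sqrt_sq ht₀, abs_sub_comm] at hnear
  simpa using hnear.le

theorem exists_norm_mul_sub_mul_le_of_mul_self {C ε : ℝ} (hC : 0 ≤ C) (hε : 0 < ε) :
    ∃ δ > 0, ∀ f f' x : M, 0 ≤ f → 0 ≤ f' → ‖f‖ ≤ 1 → ‖f'‖ ≤ 1 → ‖x‖ ≤ C →
      ‖f * f * x - x * (f' * f')‖ ≤ δ → ‖f * x - x * f'‖ ≤ ε := by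
  obtain ⟨p, hp⟩ := exists_norm_sub_aeval_mul_self_le M (η := ε / (4 * (C + 1))) (by positivity)
  obtain ⟨L, hL, hLp⟩ := exists_norm_aeval_mul_sub_mul_aeval_le (M := M) p
  refine ⟨ε / (2 * (L + 1)), by positivity, fun f f' x hf hf' hf₁ hf₁' hx h => ?_⟩
  have hsq : ∀ f : M, ‖f‖ ≤ 1 → ‖f * f‖ ≤ 1 := fun f hf =>
    (norm_mul_le _ _).trans (mul_le_one₀ hf (norm_nonneg _) hf)
  have hsplit : f * x - x * f' = (f - Polynomial.aeval (f * f) p) * x +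
      (Polynomial.aeval (f * f) p * x - x * Polynomial.aeval (f' * f') p) -
      x * (f' - Polynomial.aeval (f' * f') p) := by noncomm_ring
  have hε₄ : ε / (4 * (C + 1)) * C ≤ ε / 4 := by
    calc ε / (4 * (C + 1)) * C ≤ ε / (4 * (C + 1)) * (C + 1) := by gcongr; linarith
      _ = ε / 4 := by field_simp
  have hleft : ‖(f - Polynomial.aeval (f * f) p) * x‖ ≤ ε / 4 :=
    (norm_mul_le_of_le (hp f hf hf₁) hx).trans hε₄
  have hright : ‖x * (f' - Polynomial.aeval (f' * f') p)‖ ≤ ε / 4 :=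
    (norm_mul_le_of_le hx (hp f' hf' hf₁')).trans ((mul_comm _ _).trans_le hε₄)
  have hmiddle :
      ‖Polynomial.aeval (f * f) p * x - x * Polynomial.aeval (f' * f') p‖ ≤ ε / 2 := by
    refine (hLp _ _ _ (hsq f hf₁) (hsq f' hf₁')).trans ?_
    calc L * ‖f * f * x - x * (f' * f')‖ ≤ (L + 1) * (ε / (2 * (L + 1))) := by
          gcongr
          linarith
      _ = ε / 2 := by field_simp
  rw [hsplit]
  refine (norm_sub_le_of_le (norm_add_le_of_le hleft hmiddle) hright).trans ?_
  linarith

end SquareRoot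

theorem eventually_forall_mem_norm_lt_of_isCompact {ι E F : Type*} [SeminormedAddCommGroup E]
    [SeminormedAddCommGroup F] {l : Filter ι} {f : ι → E →+ F} {C : ℝ} (hC : 0 ≤ C)
    (hf : ∀ᶠ i in l, ∀ x, ‖f i x‖ ≤ C * ‖x‖) {K : Set E} (hK : IsCompact K)
    (h : ∀ x, Tendsto (fun i => f i x) l (𝓝 0)) {ε : ℝ} (hε : 0 < ε) :
    ∀ᶠ i in l, ∀ x ∈ K, ‖f i x‖ < ε := by
  obtain ⟨s, -, hs, hcover⟩ := hK.finite_cover_balls (e := ε / (2 * (C + 1))) (by positivity)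
  have hcentres : ∀ᶠ i in l, ∀ x ∈ s, ‖f i x‖ < ε / 2 :=
    (Filter.eventually_all_finite hs).mpr fun x _ =>
      (h x).norm.eventually_lt_const (by rw [norm_zero]; positivity)
  filter_upwards [hcentres, hf] with i hi hfi x hx
  obtain ⟨y, hy, hxy⟩ := Set.mem_iUnion₂.mp (hcover hx)
  rw [Metric.mem_ball, dist_eq_norm] at hxy
  have hdiff : ‖f i (x - y)‖ ≤ ε / 2 := by
    refine (hfi _).trans ?_
    calc C * ‖x - y‖ ≤ (C + 1) * (ε / (2 * (C + 1))) := by gcongr; linarith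
      _ = ε / 2 := by field_simp
  calc ‖f i x‖ = ‖f i (x - y) + f i y‖ := by rw [← map_add, sub_add_cancel]
    _ ≤ ‖f i (x - y)‖ + ‖f i y‖ := norm_add_le _ _
    _ < ε := by linarith [hi y hy]

section StrictContinuity

variable {B : Type*} [NonUnitalCStarAlgebra B] {I : Type*} [TopologicalSpace I] {x : I → 𝓜(ℂ, B)}

theorem exists_forall_norm_le_of_continuous_toStrict [CompactSpace I]
    (hx : Continuous fun i => toStrict (x i)) : ∃ C, 0 ≤ C ∧ ∀ i, ‖x i‖ ≤ C := by
  obtain ⟨C, hC⟩ := banach_steinhaus (g := fun i => (x i).fst) fun b => by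
    obtain ⟨C, hC⟩ := isCompact_univ.exists_bound_of_continuousOn
      ((continuous_toStrict_iff.mp hx).1 b).continuousOn
    exact ⟨C, fun i => hC i trivial⟩
  exact ⟨max C 0, le_max_right _ _, fun i =>
    (DoubleCentralizer.norm_fst (x i)).symm.trans_le ((hC i).trans (le_max_left _ _))⟩

theorem continuous_fst_apply {C : ℝ} (hC : ∀ i, ‖x i‖ ≤ C)
    (hx : Continuous fun i => toStrict (x i)) {b : I → B} (hb : Continuous b) :
    Continuous fun i => (x i).fst (b i) :=
  (continuous_prod_of_continuous_lipschitzWith' (fun p : I × B => (x p.1).fst p.2) C.toNNReal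
    (fun i => ((x i).fst.lipschitz).weaken
      (NNReal.le_toNNReal_of_coe_le ((DoubleCentralizer.norm_fst _).trans_le (hC i))))
    (continuous_toStrict_iff.mp hx).1).comp (continuous_id.prodMk hb)

theorem continuous_snd_apply {C : ℝ} (hC : ∀ i, ‖x i‖ ≤ C)
    (hx : Continuous fun i => toStrict (x i)) {b : I → B} (hb : Continuous b) :
    Continuous fun i => (x i).snd (b i) :=
  (continuous_prod_of_continuous_lipschitzWith' (fun p : I × B => (x p.1).snd p.2) C.toNNReal
    (fun i => ((x i).snd.lipschitz).weaken
      (NNReal.le_toNNReal_of_coe_le ((DoubleCentralizer.norm_snd _).trans_le (hC i))))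
    (continuous_toStrict_iff.mp hx).2).comp (continuous_id.prodMk hb)

end StrictContinuity

section Quasicentral

variable {B : Type*} [NonUnitalCStarAlgebra B]

/-- The map `e ↦ e x - x κ(e)` measuring the failure of `x` to intertwine `κ(e)` and `e`. For `κ`
the identity it is the commutator with `x`; for `x = u_g` a cocycle value and `κ = β_g` it measures
how far `e` is from being invariant under `Ad(u_g) ∘ β_g`. -/
def twistedCommutator (x : 𝓜(ℂ, B)) (κ : B ≃⋆ₐ[ℂ] B) : B →ₗ[ℝ] 𝓜(ℂ, B) where
  toFun e := incl B e * x - x * incl B (κ e)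
  map_add' e e' := by simp only [map_add]; noncomm_ring
  map_smul' c e := by
    rw [← Complex.coe_smul c e, map_smul, map_smul, map_smul, smul_mul_assoc, mul_smul_comm,
      ← smul_sub, RingHom.id_apply, Complex.coe_smul]

theorem twistedCommutator_apply (x : 𝓜(ℂ, B)) (κ : B ≃⋆ₐ[ℂ] B) (e : B) :
    twistedCommutator x κ e = incl B e * x - x * incl B (κ e) := rfl

theorem norm_twistedCommutator_le (x : 𝓜(ℂ, B)) (κ : B ≃⋆ₐ[ℂ] B) (e : B) :
    ‖twistedCommutator x κ e‖ ≤ 2 * ‖x‖ * ‖e‖ := by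
  have hleft : ‖incl B e * x‖ ≤ ‖e‖ * ‖x‖ := norm_mul_le_of_le (norm_incl e).le le_rfl
  have hright : ‖x * incl B (κ e)‖ ≤ ‖x‖ * ‖e‖ :=
    norm_mul_le_of_le le_rfl ((norm_incl _).trans (StarAlgEquiv.norm_map κ e)).le
  rw [twistedCommutator_apply]
  linarith [norm_sub_le (incl B e * x) (x * incl B (κ e))]

theorem norm_star_twistedCommutator_mul_le (x : 𝓜(ℂ, B)) (κ : B ≃⋆ₐ[ℂ] B) (e₀ e : B) :
    ‖star (twistedCommutator x κ e₀) * twistedCommutator x κ e‖ ≤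
      ‖star (x.snd e₀ - x.fst (κ e₀)) * e - star (x.snd e₀ - x.fst (κ e₀))‖ * ‖x‖ +
      ‖κ.symm (x.snd (star (x.snd e₀ - x.fst (κ e₀)))) * e -
        κ.symm (x.snd (star (x.snd e₀ - x.fst (κ e₀))))‖ := by
  set d := star (x.snd e₀ - x.fst (κ e₀))
  have hstar : star (twistedCommutator x κ e₀) = incl B d := by
    rw [twistedCommutator_apply, mul_incl, incl_mul, ← map_sub, ← map_star]
  have hsplit : star (twistedCommutator x κ e₀) * twistedCommutator x κ e =
      incl B (d * e - d) * x - incl B (x.snd d * κ e - x.snd d) := by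
    rw [hstar, twistedCommutator_apply, mul_sub, ← mul_assoc, ← mul_assoc, incl_mul x d, map_sub,
      map_sub, map_mul, map_mul, sub_mul, incl_mul x d]
    abel
  have hκ : ‖x.snd d * κ e - x.snd d‖ = ‖κ.symm (x.snd d) * e - κ.symm (x.snd d)‖ := by
    rw [← StarAlgEquiv.norm_map κ (κ.symm (x.snd d) * e - κ.symm (x.snd d))]
    simp
  rw [hsplit, ← hκ, ← norm_incl (x.snd d * κ e - x.snd d)]
  exact norm_sub_le_of_le (norm_mul_le_of_le (norm_incl _).le le_rfl) le_rfl

theorem convex_setOf_forall_norm_mul_sub_le (F : Finset B) (ρ : ℝ) :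
    Convex ℝ {e : B | ∀ h ∈ F, ‖e * h - h‖ ≤ ρ} := by
  have hset : {e : B | ∀ h ∈ F, ‖e * h - h‖ ≤ ρ} =
      ⋂ h ∈ F, LinearMap.mulRight ℝ h ⁻¹' Metric.closedBall h ρ := by
    ext e
    simp [dist_eq_norm]
  rw [hset]
  exact convex_iInter₂ fun h _ => (convex_closedBall h ρ).linear_preimage _

section ApproximateUnit

variable [PartialOrder B] [StarOrderedRing B]

variable (B) in
/-- The canonical approximate unit of `B` cut down to the open unit ball, where every element can be
increased further. -/
def openApproximateUnit : Filter B :=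
  CStarAlgebra.approximateUnit B ⊓ 𝓟 (Metric.ball 0 1)

instance : (openApproximateUnit B).NeBot :=
  ((CStarAlgebra.hasBasis_approximateUnit B).inf_principal _).neBot_iff.mpr fun {a} ha =>
    ⟨a, ⟨le_rfl, by simpa using ha.2.le⟩, by simpa using ha.2⟩

theorem eventually_mem_ball_openApproximateUnit :
    ∀ᶠ e in openApproximateUnit B, e ∈ Metric.ball (0 : B) 1 :=
  mem_inf_of_right (mem_principal_self _)

theorem eventually_ge_openApproximateUnit {a : B} (ha : 0 ≤ a) (ha₁ : ‖a‖ < 1) :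
    ∀ᶠ e in openApproximateUnit B, a ≤ e :=
  mem_inf_of_left (mem_of_superset
    ((CStarAlgebra.hasBasis_approximateUnit B).mem_of_mem (i := a) ⟨ha, ha₁⟩) fun _ he => he.1)

theorem tendsto_mul_sub_openApproximateUnit (b : B) :
    Tendsto (fun e => b * e - b) (openApproximateUnit B) (𝓝 0) := by
  have h := (((CStarAlgebra.increasingApproximateUnit B).tendsto_mul_left b).mono_left
    (inf_le_left : openApproximateUnit B ≤ _)).sub_const b
  rwa [sub_self] at h

theorem eventually_forall_norm_mul_sub_le (F : Finset B) {ρ : ℝ} (hρ : 0 < ρ) :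
    ∀ᶠ e in openApproximateUnit B, ∀ h ∈ F, ‖e * h - h‖ ≤ ρ :=
  (Filter.eventually_all_finset F).mpr fun h _ =>
    (tendsto_iff_norm_sub_tendsto_zero.mp
      (((CStarAlgebra.increasingApproximateUnit B).tendsto_mul_right h).mono_left
        inf_le_left)).eventually_le_const hρ

theorem eventually_forall_mem_norm_mul_sub_lt {K : Set B} (hK : IsCompact K) {δ : ℝ} (hδ : 0 < δ) :
    ∀ᶠ e in openApproximateUnit B, ∀ b ∈ K, ‖b * e - b‖ < δ :=
  eventually_forall_mem_norm_lt_of_isCompact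
    (f := fun e => AddMonoidHom.mulRight e - AddMonoidHom.id B) zero_le_two
    (by
      filter_upwards [eventually_mem_ball_openApproximateUnit] with e he b
      rw [mem_ball_zero_iff] at he
      refine (norm_sub_le (b * e) b).trans ?_
      linarith [(norm_mul_le b e).trans (mul_le_of_le_one_right (norm_nonneg b) he.le)])
    hK tendsto_mul_sub_openApproximateUnit hδ

end ApproximateUnit

variable {I : Type*} [TopologicalSpace I] {x : I → 𝓜(ℂ, B)} {κ : I → B ≃⋆ₐ[ℂ] B}

theorem eventually_forall_norm_star_twistedCommutator_mul_le [PartialOrder B] [StarOrderedRing B]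
    [CompactSpace I] (hx : Continuous fun i => toStrict (x i))
    (hκ : ∀ b, Continuous fun i => κ i b) (hκ' : ∀ b, Continuous fun i => (κ i).symm b)
    (e₀ : B) {δ : ℝ} (hδ : 0 < δ) : ∀ᶠ e in openApproximateUnit B, ∀ i,
      ‖star (twistedCommutator (x i) (κ i) e₀) * twistedCommutator (x i) (κ i) e‖ ≤ δ := by
  obtain ⟨C, hC₀, hC⟩ := exists_forall_norm_le_of_continuous_toStrict hx
  have hd : Continuous fun i => star ((x i).snd e₀ - (x i).fst (κ i e₀)) :=
    ((continuous_snd_apply hC hx continuous_const).sub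
      (continuous_fst_apply hC hx (hκ e₀))).star
  have hxd : Continuous fun i =>
      (κ i).symm ((x i).snd (star ((x i).snd e₀ - (x i).fst (κ i e₀)))) :=
    continuous_starAlgEquiv_apply hκ' (continuous_snd_apply hC hx hd)
  filter_upwards [
    eventually_forall_mem_norm_mul_sub_lt (isCompact_range hd) (δ := δ / (2 * (C + 1)))
      (by positivity),
    eventually_forall_mem_norm_mul_sub_lt (isCompact_range hxd) (half_pos hδ)] with e he he' i
  refine (norm_star_twistedCommutator_mul_le _ _ _ _).trans ?_
  calc _ ≤ δ / (2 * (C + 1)) * (C + 1) + δ / 2 := by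
        gcongr
        · exact (he _ ⟨i, rfl⟩).le
        · exact (hC i).trans (by linarith)
        · exact (he' _ ⟨i, rfl⟩).le
    _ = δ := by field_simp; norm_num

theorem exists_quasicentral_ge [PartialOrder B] [StarOrderedRing B] [CompactSpace I]
    (hx : Continuous fun i => toStrict (x i)) (hκ : ∀ b, Continuous fun i => κ i b)
    (hκ' : ∀ b, Continuous fun i => (κ i).symm b) {a : B} (ha : 0 ≤ a) (ha₁ : ‖a‖ < 1)
    (F : Finset B) {ρ η : ℝ} (hρ : 0 < ρ) (hη : 0 < η) :
    ∃ e, a ≤ e ∧ ‖e‖ < 1 ∧ (∀ h ∈ F, ‖e * h - h‖ ≤ ρ) ∧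
      ∀ i, ‖twistedCommutator (x i) (κ i) e‖ ≤ η := by
  obtain ⟨C, -, hC⟩ := exists_forall_norm_le_of_continuous_toStrict hx
  obtain ⟨e, ⟨hae, he₁, hF⟩, he⟩ := exists_mem_forall_norm_le (l := openApproximateUnit B)
    (fun i => twistedCommutator (x i) (κ i)) (C := 2 * C)
    (by
      filter_upwards [eventually_mem_ball_openApproximateUnit] with e he i
      refine (norm_twistedCommutator_le _ _ e).trans ?_
      have := mul_le_of_le_one_right (norm_nonneg (x i)) (mem_ball_zero_iff.mp he).le
      linarith [hC i])
    (.of_forall fun e₀ _ => eventually_forall_norm_star_twistedCommutator_mul_le hx hκ hκ' e₀)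
    ((eventually_ge_openApproximateUnit ha ha₁).and
      (eventually_mem_ball_openApproximateUnit.and (eventually_forall_norm_mul_sub_le F hρ)))
    ((convex_Ici a).inter ((convex_ball 0 1).inter (convex_setOf_forall_norm_mul_sub_le F ρ))) hη
  exact ⟨e, hae, mem_ball_zero_iff.mp he₁, hF, he⟩

theorem tendsto_mul_of_forall_tendsto_mul {ι ι' : Type*} {l : Filter ι} {l' : Filter ι'} [l'.NeBot]
    {e : ι → B} {h : ι' → B} (he : ∀ n, ‖e n‖ ≤ 1)
    (hh : ∀ b, Tendsto (fun i => h i * b) l' (𝓝 b))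
    (heh : ∀ i, Tendsto (fun n => e n * h i) l (𝓝 (h i))) (b : B) :
    Tendsto (fun n => e n * b) l (𝓝 b) := by
  have hequi : Equicontinuous fun n c => e n * c :=
    (LipschitzWith.uniformEquicontinuous _ 1 fun n => LipschitzWith.of_dist_le_mul fun c d => by
      rw [dist_eq_norm, dist_eq_norm, ← mul_sub]
      exact norm_mul_le_of_le (he n) le_rfl).equicontinuous
  refine (hequi.isClosed_setOfPred_tendsto (l := l) continuous_id).mem_of_tendsto (hh b)
    (.of_forall fun i => ?_)
  simpa only [id, mul_assoc, Set.mem_ofPred_eq] using (heh i).mul_const b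

theorem exists_quasicentral_sequence [PartialOrder B] [StarOrderedRing B] (hB : IsSigmaUnital B)
    (hx : Continuous fun i => toStrict (x i)) (hκ : ∀ b, Continuous fun i => κ i b)
    (hκ' : ∀ b, Continuous fun i => (κ i).symm b) {S : ℕ → Set I} (hS : ∀ n, IsCompact (S n))
    {η : ℕ → ℝ} (hη : ∀ n, 0 < η n) :
    ∃ e : ℕ → B, e 0 = 0 ∧ Monotone e ∧ (∀ n, ‖e n‖ < 1) ∧
      (∀ b, Tendsto (fun n => e n * b) atTop (𝓝 b)) ∧
      ∀ n, ∀ i ∈ S n, ‖twistedCommutator (x i) (κ i) (e n)‖ ≤ η n := by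
  classical
  obtain ⟨h, -, hh⟩ := hB
  let P : ℕ → B → Prop := fun n e => 0 ≤ e ∧ ‖e‖ < 1 ∧ (∀ i < n, ‖e * h i - h i‖ ≤ (1 / 2) ^ n) ∧
    ∀ i ∈ S n, ‖twistedCommutator (x i) (κ i) e‖ ≤ η n
  have hzero : P 0 0 := ⟨le_rfl, by simp, by simp, fun i _ => by simpa using (hη 0).le⟩
  have hsucc : ∀ n e, P n e → ∃ e', P (n + 1) e' ∧ e ≤ e' := fun n e he => by
    have := isCompact_iff_compactSpace.mp (hS (n + 1))
    obtain ⟨e', hle, hnorm, hunit, hcomm⟩ := exists_quasicentral_ge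
      (I := S (n + 1)) (hx.comp continuous_subtype_val)
      (fun b => (hκ b).comp continuous_subtype_val) (fun b => (hκ' b).comp continuous_subtype_val)
      he.1 he.2.1 ((Finset.range (n + 1)).image h) (ρ := (1 / 2) ^ (n + 1)) (by positivity)
      (hη (n + 1))
    exact ⟨e', ⟨he.1.trans hle, hnorm, fun i hi =>
      hunit _ (Finset.mem_image_of_mem h (Finset.mem_range.mpr hi)), fun i hi => hcomm ⟨i, hi⟩⟩,
      hle⟩
  choose! next hnext hle using hsucc
  let e : ℕ → B := fun n => Nat.rec 0 next n
  have he : ∀ n, P n (e n) := fun n => Nat.rec hzero (fun n ih => hnext n _ ih) n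
  refine ⟨e, rfl, monotone_nat_of_le_succ fun n => hle n _ (he n), fun n => (he n).2.1,
    tendsto_mul_of_forall_tendsto_mul (fun n => (he n).2.1.le) (fun b => (hh b).1) fun i => ?_,
    fun n => (he n).2.2.2⟩
  rw [tendsto_iff_norm_sub_tendsto_zero]
  refine squeeze_zero' (.of_forall fun _ => norm_nonneg _) ?_
    (tendsto_pow_atTop_nhds_zero_of_lt_one (r := (1 / 2 : ℝ)) (by norm_num) (by norm_num))
  filter_upwards [eventually_gt_atTop i] with n hn
  exact (he n).2.2.1 i hn

theorem exists_norm_twistedCommutator_le_of_mul_self [PartialOrder B] [StarOrderedRing B]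
    {C ε : ℝ} (hC : 0 ≤ C) (hε : 0 < ε) :
    ∃ δ > 0, ∀ (y : 𝓜(ℂ, B)) (κ : B ≃⋆ₐ[ℂ] B) (f : B), 0 ≤ f → ‖f‖ ≤ 1 → ‖y‖ ≤ C →
      ‖twistedCommutator y κ (f * f)‖ ≤ δ → ‖twistedCommutator y κ f‖ ≤ ε := by
  let _ := CStarAlgebra.spectralOrder 𝓜(ℂ, B)
  have := CStarAlgebra.spectralOrderedRing 𝓜(ℂ, B)
  obtain ⟨δ, hδ, h⟩ := exists_norm_mul_sub_mul_le_of_mul_self 𝓜(ℂ, B) hC hε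
  refine ⟨δ, hδ, fun y κ f hf hf₁ hy hff => h (incl B f) (incl B (κ f)) y (map_nonneg (incl B) hf)
    (map_nonneg (incl B) (map_nonneg κ hf)) ?_ ?_ hy ?_⟩
  · rwa [norm_incl]
  · rwa [norm_incl, StarAlgEquiv.norm_map κ]
  · rwa [← map_mul, ← map_mul, ← map_mul]

theorem exists_quasicentral_partition (hB : IsSigmaUnital B)
    (hx : Continuous fun i => toStrict (x i)) (hκ : ∀ b, Continuous fun i => κ i b)
    (hκ' : ∀ b, Continuous fun i => (κ i).symm b) {S : ℕ → Set I} (hS : ∀ n, IsCompact (S n))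
    (hSm : Monotone S) {ε : ℕ → ℝ} (hε : ∀ n, 0 < ε n) :
    ∃ f : ℕ → B, (∀ n, star (f n) = f n) ∧
      (∀ N, ‖∑ n ∈ Finset.range N, f n * f n‖ ≤ 1) ∧
      (∀ b, Tendsto (fun N => (∑ n ∈ Finset.range N, f n * f n) * b) atTop (𝓝 b)) ∧
      ∀ n, ∀ i ∈ S n, ‖twistedCommutator (x i) (κ i) (f n)‖ ≤ ε n := by
  let _ := CStarAlgebra.spectralOrder B
  have := CStarAlgebra.spectralOrderedRing B
  have hbound : ∀ n, ∃ C, 0 ≤ C ∧ ∀ i ∈ S n, ‖x i‖ ≤ C := fun n => by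
    have := isCompact_iff_compactSpace.mp (hS n)
    obtain ⟨C, hC₀, hC⟩ :=
      exists_forall_norm_le_of_continuous_toStrict (I := S n) (hx.comp continuous_subtype_val)
    exact ⟨C, hC₀, fun i hi => hC ⟨i, hi⟩⟩
  choose C hC₀ hC using hbound
  choose δ hδ₀ hδ using fun n =>
    exists_norm_twistedCommutator_le_of_mul_self (B := B) (hC₀ n) (hε n)
  obtain ⟨e, he₀, hmono, he₁, hlim, hcomm⟩ := exists_quasicentral_sequence hB hx hκ hκ' hS
    (η := fun n => min (δ (n - 1)) (δ n) / 2) fun n => half_pos (lt_min (hδ₀ _) (hδ₀ _))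
  have hdiff : ∀ n, 0 ≤ e (n + 1) - e n := fun n => sub_nonneg.mpr (hmono n.le_succ)
  have hsq : ∀ n, CFC.sqrt (e (n + 1) - e n) * CFC.sqrt (e (n + 1) - e n) = e (n + 1) - e n :=
    fun n => CFC.sqrt_mul_sqrt_self _ (hdiff n)
  have hself : ∀ n, star (CFC.sqrt (e (n + 1) - e n)) = CFC.sqrt (e (n + 1) - e n) := fun n =>
    (IsSelfAdjoint.of_nonneg (CFC.sqrt_nonneg _)).star_eq
  have hdiff₁ : ∀ n, ‖e (n + 1) - e n‖ ≤ 1 := fun n =>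
    (CStarAlgebra.norm_le_norm_of_nonneg_of_le (hdiff n)
      (sub_le_self _ (he₀.symm.trans_le (hmono n.zero_le)))).trans (he₁ _).le
  have hsqrt₁ : ∀ n, ‖CFC.sqrt (e (n + 1) - e n)‖ ≤ 1 := fun n =>
    (CFC.norm_sqrt _ (hdiff n)).trans_le (Real.sqrt_le_one.mpr (hdiff₁ n))
  have hsum : ∀ N, ∑ n ∈ Finset.range N, CFC.sqrt (e (n + 1) - e n) * CFC.sqrt (e (n + 1) - e n) =
      e N := fun N => by simp_rw [hsq, Finset.sum_range_sub, he₀, sub_zero]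
  refine ⟨fun n => CFC.sqrt (e (n + 1) - e n), hself, fun N => (congrArg _ (hsum N)).trans_le
    (he₁ N).le, fun b => by simpa only [hsum] using hlim b, fun n i hi => ?_⟩
  refine hδ n _ _ _ (CFC.sqrt_nonneg _) (hsqrt₁ n) (hC n i hi) ?_
  have hn := hcomm n i hi
  have hn₁ := hcomm (n + 1) i (hSm n.le_succ hi)
  rw [hsq, map_sub]
  refine (norm_sub_le_of_le hn₁ hn).trans ?_
  rw [Nat.add_sub_cancel]
  linarith [min_le_left (δ n) (δ (n + 1)), min_le_right (δ (n - 1)) (δ n)]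

end Quasicentral

section CompactExhaustion

instance {X Y : Type*} [TopologicalSpace X] [TopologicalSpace Y] [WeaklyLocallyCompactSpace X]
    [WeaklyLocallyCompactSpace Y] : WeaklyLocallyCompactSpace (X ⊕ Y) where
  exists_compact_mem_nhds
    | .inl x => by
      obtain ⟨S, hS, hx⟩ := exists_compact_mem_nhds x
      exact ⟨_, hS.image continuous_inl, IsOpenEmbedding.inl.image_mem_nhds.mpr hx⟩
    | .inr y => by
      obtain ⟨S, hS, hy⟩ := exists_compact_mem_nhds y
      exact ⟨_, hS.image continuous_inr, IsOpenEmbedding.inr.image_mem_nhds.mpr hy⟩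

variable {X E : Type*} [TopologicalSpace X] [NormedAddCommGroup E] {K : CompactExhaustion X}
  {f : ℕ → X → E} {u : ℕ → ℝ}

theorem eventually_forall_norm_le_of_compactExhaustion (h : ∀ n, ∀ x ∈ K n, ‖f n x‖ ≤ u n)
    (N : ℕ) : ∀ᶠ n in atTop, ∀ x ∈ K N, ‖f n x‖ ≤ u n :=
  (eventually_ge_atTop N).mono fun n hn x hx => h n x (K.subset hn hx)

theorem summable_norm_of_compactExhaustion (hu : Summable u)
    (h : ∀ n, ∀ x ∈ K n, ‖f n x‖ ≤ u n) (x : X) : Summable fun n => ‖f n x‖ :=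
  hu.of_norm_bounded_eventually_nat <|
    (eventually_forall_norm_le_of_compactExhaustion h (K.find x)).mono fun n hn => by
      simpa only [norm_norm] using hn x (K.mem_find x)

theorem continuous_tsum_of_compactExhaustion [CompleteSpace E] (hf : ∀ n, Continuous (f n))
    (hu : Summable u) (h : ∀ n, ∀ x ∈ K n, ‖f n x‖ ≤ u n) : Continuous fun x => ∑' n, f n x :=
  continuous_iff_continuousAt.mpr fun x =>
    ((tendstoUniformlyOn_tsum_nat_eventually hu
      (eventually_forall_norm_le_of_compactExhaustion h (K.find x + 1))).continuousOn
        (Frequently.of_forall fun _ =>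
          (continuous_finsetSum _ fun n _ => hf n).continuousOn)).continuousAt
      (mem_interior_iff_mem_nhds.mp (K.subset_interior_succ _ (K.mem_find x)))

end CompactExhaustion

section IntertwiningIsometry

variable {G A B : Type*} [Group G] [TopologicalSpace G]
  [NonUnitalCStarAlgebra A] [NonUnitalCStarAlgebra B]
  {α : CStarAction G A} {β : CStarAction G B}

namespace CStarAction.IsCuntzSequence

variable {t : ℕ → 𝓜(ℂ, B)}

theorem hasSum_of_summable (ht : β.IsCuntzSequence t) {c : 𝓜(ℂ, B)} {w : ℕ → 𝓜(ℂ, B)}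
    (hc : ∀ n, star (t n) * c = w n) (hw : Summable fun n => ‖w n‖) :
    HasSum (fun n => t n * w n) c := by
  have ho := ht.orthogonalIsometries
  have hs : Summable fun n => t n * w n := .of_norm_bounded hw fun n =>
    (norm_mul_le _ _).trans (mul_le_of_le_one_left (norm_nonneg _) (ho.norm_le_one n))
  have hsum : c = ∑' n, t n * w n := ht.ext_left fun m => by
    rw [hc, ← hs.tsum_mul_left, tsum_eq_single m, ho.star_mul_mul_self]
    exact fun n hn => ho.star_mul_mul_of_ne hn.symm _
  rw [hsum]
  exact hs.hasSum

theorem exists_isometry_of_partition (ht : β.IsCuntzSequence t) {f : ℕ → B}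
    (hself : ∀ n, star (f n) = f n) (hbdd : ∀ N, ‖∑ n ∈ Finset.range N, f n * f n‖ ≤ 1)
    (hlim : ∀ b, Tendsto (fun N => (∑ n ∈ Finset.range N, f n * f n) * b) atTop (𝓝 b))
    (k : ℕ → ℕ) :
    ∃ s : 𝓜(ℂ, B), star s * s = 1 ∧ ∀ n, star (t n) * s = t (k n) * incl B (f n) := by
  have hsum : ∀ N, ∑ n ∈ Finset.range N,
      star (t (k n) * incl B (f n)) * (t (k n) * incl B (f n)) =
        incl B (∑ n ∈ Finset.range N, f n * f n) := fun N => by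
    rw [map_sum]
    refine Finset.sum_congr rfl fun n _ => ?_
    rw [star_mul, mul_assoc, ht.orthogonalIsometries.star_mul_mul_self, ← map_star, hself, map_mul]
  have hsumlim : ∀ b, Tendsto (fun N => (∑ n ∈ Finset.range N,
      star (t (k n) * incl B (f n)) * (t (k n) * incl B (f n))) * incl B b) atTop
      (𝓝 (incl B b)) := fun b => by
    simp_rw [hsum, ← map_mul]
    exact (continuous_incl.tendsto _).comp (hlim b)
  obtain ⟨s, -, hs⟩ := ht.exists_column (fun n => t (k n) * incl B (f n)) zero_le_one
    (fun N => by rw [hsum, norm_incl, one_pow]; exact hbdd N) fun b => (hsumlim b).cauchySeq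
  exact ⟨s, ht.isometry_of_column hs hsumlim, hs⟩

end CStarAction.IsCuntzSequence

namespace CocycleRep

theorem Intertwines.star_mul_hom {t : 𝓜(ℂ, B)} {Φ Ψ : CocycleRep α β} (h : Intertwines t Φ Ψ)
    (a : A) : star t * Ψ.hom a = Φ.hom a * star t := by
  simpa [map_star] using congrArg star (h.hom (star a))

theorem Intertwines.star_mul_coc {t : 𝓜(ℂ, B)} {Φ Ψ : CocycleRep α β} (h : Intertwines t Φ Ψ)
    (g : G) : star t * (Ψ.coc g : 𝓜(ℂ, B)) = Φ.coc g * star t := by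
  have hstar : star (Ψ.coc g : 𝓜(ℂ, B)) * t = t * star (Φ.coc g : 𝓜(ℂ, B)) := by
    calc star (Ψ.coc g : 𝓜(ℂ, B)) * t
        = star (Ψ.coc g : 𝓜(ℂ, B)) * (t * Φ.coc g) * star (Φ.coc g : 𝓜(ℂ, B)) := by
          rw [mul_assoc, mul_assoc t, Unitary.mul_star_self_of_mem (SetLike.coe_mem _), mul_one]
      _ = t * star (Φ.coc g : 𝓜(ℂ, B)) := by
          rw [← h.coc, ← mul_assoc, Unitary.star_mul_self_of_mem (SetLike.coe_mem _), one_mul]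
  simpa using congrArg star hstar

theorem continuous_hom (Φ : CocycleRep α β) : Continuous Φ.hom :=
  AddMonoidHomClass.continuous_of_bound Φ.hom 1 fun a => by simpa using Φ.norm_hom_le a

variable {J : Type*} {a : J → A}

/-- The component of an index in `J ⊕ G` that acts on `B`: an index `i : J` stands for an element of
`A` and acts trivially. -/
def groupIndex : J ⊕ G → G := Sum.elim (fun _ => 1) id

/-- The values `φ(aᵢ)` and `u_g` of a cocycle representation as a single family, so that the two
components can be handled simultaneously. -/
def values (a : J → A) (Φ : CocycleRep α β) : J ⊕ G → 𝓜(ℂ, B) :=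
  Sum.elim (fun i => Φ.hom (a i)) fun g => Φ.coc g

/-- The defects `θ(aᵢ) s - s ψ(aᵢ)` and `x_g β_g(s) - s v_g` of `s` as an intertwiner of
`(ψ, v)` and `(θ, x)`. -/
def intertwiningDefect (a : J → A) (Θ Ψ : CocycleRep α β) (s : 𝓜(ℂ, B)) (i : J ⊕ G) : 𝓜(ℂ, B) :=
  Θ.values a i * β.mult (groupIndex i) s - s * Ψ.values a i

/-- `Ψ` is a pointwise strict limit of members of the sequence `Φ`, uniformly on compact sets of
indices. The cocycles are compared on `β_g(b)`, as this is how they occur in the intertwining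
relation. -/
def Approximates [TopologicalSpace J] (a : J → A) (Φ : ℕ → CocycleRep α β) (Ψ : CocycleRep α β) :
    Prop :=
  ∀ (b : B) (S : Set (J ⊕ G)), IsCompact S → ∀ ε > 0, ∃ k, ∀ i ∈ S,
    ‖((Φ k).values a i - Ψ.values a i) * incl B (β.toHom (groupIndex i) b)‖ ≤ ε

theorem continuous_groupIndex [TopologicalSpace J] : Continuous (groupIndex : J ⊕ G → G) :=
  continuous_const.sumElim continuous_id

theorem Intertwines.values_mul {t : 𝓜(ℂ, B)} {Φ Ψ : CocycleRep α β} (h : Intertwines t Φ Ψ) :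
    ∀ i, Ψ.values a i * t = t * Φ.values a i :=
  Sum.rec (fun i => h.hom (a i)) h.coc

theorem Intertwines.star_mul_values {t : 𝓜(ℂ, B)} {Φ Ψ : CocycleRep α β}
    (h : Intertwines t Φ Ψ) : ∀ i, star t * Ψ.values a i = Φ.values a i * star t :=
  Sum.rec (fun i => h.star_mul_hom (a i)) h.star_mul_coc

theorem continuous_toStrict_values [TopologicalSpace J] [DiscreteTopology J]
    (Φ : CocycleRep α β) : Continuous fun i => toStrict (Φ.values a i) :=
  continuous_sum_dom.mpr ⟨continuous_of_discreteTopology, Φ.continuous_coc⟩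

theorem intertwiningDefect_incl (Φ Ψ : CocycleRep α β) (b : B) (i : J ⊕ G) :
    intertwiningDefect a Φ Ψ (incl B b) i =
      Φ.values a i * incl B (β.toHom (groupIndex i) b) - incl B b * Ψ.values a i := by
  rw [intertwiningDefect, β.mult_incl]

theorem memIdeal_intertwiningDefect_incl (Φ Ψ : CocycleRep α β) (b : B) (i : J ⊕ G) :
    MemIdeal (intertwiningDefect a Φ Ψ (incl B b) i) := by
  rw [intertwiningDefect_incl]
  exact ((memIdeal_incl _).mul_left _).sub ((memIdeal_incl b).mul_right _)

theorem continuous_intertwiningDefect_incl [TopologicalSpace J] [DiscreteTopology J]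
    (Φ Ψ : CocycleRep α β) (b : B) :
    Continuous (intertwiningDefect a Φ Ψ (incl B b)) := by
  refine continuous_sum_dom.mpr ⟨continuous_of_discreteTopology, ?_⟩
  have heq : intertwiningDefect a Φ Ψ (incl B b) ∘ Sum.inr = fun g =>
      incl B ((Φ.coc g : 𝓜(ℂ, B)).fst (β.toHom g b)) -
        incl B ((Ψ.coc g : 𝓜(ℂ, B)).snd b) := by
    funext g
    rw [← mul_incl, ← incl_mul]
    exact intertwiningDefect_incl Φ Ψ b (.inr g)
  rw [heq]
  exact (continuous_incl.comp
    (continuous_fst_apply Φ.norm_coc_le Φ.continuous_coc (β.continuous_apply b))).sub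
      (continuous_incl.comp
        (continuous_snd_apply Ψ.norm_coc_le Ψ.continuous_coc continuous_const))

theorem norm_intertwiningDefect_incl_le (Φ Ψ : CocycleRep α β) (b : B) (i : J ⊕ G) :
    ‖intertwiningDefect a Φ Ψ (incl B b) i‖ ≤
      ‖(Φ.values a i - Ψ.values a i) * incl B (β.toHom (groupIndex i) b)‖ +
        ‖twistedCommutator (Ψ.values a i) (β.toHom (groupIndex i)) b‖ := by
  refine le_of_eq_of_le (congrArg _ ?_) (norm_sub_le _ _)
  rw [intertwiningDefect_incl, twistedCommutator_apply, sub_mul]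
  abel

theorem star_mul_intertwiningDefect {t r s y : 𝓜(ℂ, B)} {Φ Ω Θ Ψ : CocycleRep α β}
    (ht : ∀ g, β.mult g t = t) (hr : ∀ g, β.mult g r = r) (hΘ : Intertwines t Ω Θ)
    (hΩ : Intertwines r Φ Ω) (hs : star t * s = r * y) (i : J ⊕ G) :
    star t * intertwiningDefect a Θ Ψ s i = r * intertwiningDefect a Φ Ψ y i := by
  have hmult : star t * β.mult (groupIndex i) s = r * β.mult (groupIndex i) y := by
    simpa only [map_mul, map_star, ht, hr] using congrArg (β.mult (groupIndex i)) hs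
  rw [intertwiningDefect, intertwiningDefect, mul_sub, ← mul_assoc, hΘ.star_mul_values, mul_assoc,
    hmult, ← mul_assoc, hΩ.values_mul, ← mul_assoc, hs, mul_sub, mul_assoc, mul_assoc]

variable {a : ℕ → A} [IsTopologicalGroup G] [SigmaCompactSpace G] [WeaklyLocallyCompactSpace G]

theorem exists_isometry_forall_memIdeal_intertwiningDefect (hB : IsSigmaUnital B)
    {t : ℕ → 𝓜(ℂ, B)} (ht : β.IsCuntzSequence t) {Φ : ℕ → CocycleRep α β} {Ω Θ Ψ : CocycleRep α β}
    (hΩ : ∀ n, Intertwines (t n) (Φ n) Ω) (hΘ : ∀ n, Intertwines (t n) Ω Θ)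
    (happ : Approximates a Φ Ψ) :
    ∃ s : 𝓜(ℂ, B), star s * s = 1 ∧ (∀ i, MemIdeal (intertwiningDefect a Θ Ψ s i)) ∧
      Continuous (intertwiningDefect a Θ Ψ s) := by
  have K := CompactExhaustion.choice (ℕ ⊕ G)
  obtain ⟨f, hself, hbdd, hlim, hcomm⟩ := exists_quasicentral_partition hB
    (Ψ.continuous_toStrict_values (a := a))
    (fun b => (β.continuous_apply b).comp continuous_groupIndex)
    (fun b => by
      simp_rw [CStarAction.toHom_symm_apply]
      exact (β.continuous_apply b).comp continuous_groupIndex.inv)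
    K.isCompact (fun _ _ h => K.subset h) (ε := fun n => (1 / 2 : ℝ) ^ n) fun n => by positivity
  choose k hk using fun n => happ (f n) (K n) (K.isCompact n) ((1 / 2) ^ n) (by positivity)
  obtain ⟨s, hs₁, hs⟩ := ht.exists_isometry_of_partition hself hbdd hlim k
  let c : ℕ → ℕ ⊕ G → 𝓜(ℂ, B) := fun n i =>
    t (k n) * intertwiningDefect a (Φ (k n)) Ψ (incl B (f n)) i
  have hcoord : ∀ i n, star (t n) * intertwiningDefect a Θ Ψ s i = c n i := fun i n =>
    star_mul_intertwiningDefect (ht.fixed n) (ht.fixed (k n)) (hΘ n) (hΩ (k n)) (hs n) i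
  have hnorm : ∀ n (x : 𝓜(ℂ, B)), ‖t n * x‖ ≤ ‖x‖ := fun n x => (norm_mul_le _ _).trans
    (mul_le_of_le_one_left (norm_nonneg _) (ht.orthogonalIsometries.norm_le_one n))
  have hc : ∀ n, ∀ i ∈ K n, ‖c n i‖ ≤ (1 / 2) ^ n + (1 / 2) ^ n := fun n i hi =>
    (hnorm _ _).trans ((norm_intertwiningDefect_incl_le _ _ _ _).trans
      (add_le_add (hk n i hi) (hcomm n i hi)))
  have hgeom : Summable fun n : ℕ => (1 / 2 : ℝ) ^ n + (1 / 2) ^ n :=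
    summable_geometric_two.add summable_geometric_two
  have hsum : ∀ i, ∑' n, t n * c n i = intertwiningDefect a Θ Ψ s i := fun i =>
    (ht.hasSum_of_summable (hcoord i) (summable_norm_of_compactExhaustion hgeom hc i)).tsum_eq
  refine ⟨s, hs₁, fun i => ?_, ?_⟩
  · rw [← hsum i]
    exact memIdeal_tsum fun n => ((memIdeal_intertwiningDefect_incl _ _ _ i).mul_left _).mul_left _
  · simp_rw [← funext hsum]
    exact continuous_tsum_of_compactExhaustion
      (fun n => ((continuous_intertwiningDefect_incl _ _ _).const_mul _).const_mul _) hgeom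
      fun n i hi => (hnorm _ _).trans (hc n i hi)

theorem exists_intertwining_isometry (hB : IsSigmaUnital B) {t : ℕ → 𝓜(ℂ, B)}
    (ht : β.IsCuntzSequence t) {Φ : ℕ → CocycleRep α β} {Ω Θ Ψ : CocycleRep α β}
    (hΩ : ∀ n, Intertwines (t n) (Φ n) Ω) (hΘ : ∀ n, Intertwines (t n) Ω Θ) (ha : DenseRange a)
    (happ : Approximates a Φ Ψ) :
    ∃ s : 𝓜(ℂ, B), star s * s = 1 ∧ (∀ i, MemIdeal (intertwiningDefect id Θ Ψ s i)) ∧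
      Continuous fun g => intertwiningDefect id Θ Ψ s (.inr g) := by
  obtain ⟨s, hs, hmem, hcont⟩ :=
    exists_isometry_forall_memIdeal_intertwiningDefect hB ht hΩ hΘ happ
  have hclosed : IsClosed {x : A | MemIdeal (Θ.hom x * β.mult 1 s - s * Ψ.hom x)} :=
    isClosed_memIdeal.preimage ((Θ.continuous_hom.mul_const _).sub (Ψ.continuous_hom.const_mul s))
  refine ⟨s, hs, ?_, hcont.comp continuous_inr⟩
  rintro (x | g)
  · exact ha.induction_on (p := fun x => MemIdeal (Θ.hom x * β.mult 1 s - s * Ψ.hom x)) x hclosed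
      fun i => hmem (.inl i)
  · exact hmem (.inr g)

end CocycleRep

end IntertwiningIsometry

section CuntzRelations

variable {M : Type*} [CStarAlgebra M]

/-- `t₁, t₂` are isometries satisfying the relations of the Cuntz algebra `𝒪₂`. -/
structure CuntzRelations (t₁ t₂ : M) : Prop where
  left : star t₁ * t₁ = 1
  right : star t₂ * t₂ = 1
  sum_eq_one : t₁ * star t₁ + t₂ * star t₂ = 1

namespace CuntzRelations

variable {s S T r q t₁ t₂ : M}

theorem star_left_mul_right (h : CuntzRelations t₁ t₂) : star t₁ * t₂ = 0 := by
  have hproj : t₂ * star t₂ = 1 - t₁ * star t₁ := eq_sub_of_add_eq' h.sum_eq_one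
  rw [← CStarRing.mul_star_self_eq_zero_iff]
  calc star t₁ * t₂ * star (star t₁ * t₂) = star t₁ * (t₂ * star t₂) * t₁ := by
        simp [mul_assoc]
    _ = star t₁ * t₁ - (star t₁ * t₁) * (star t₁ * t₁) := by rw [hproj]; noncomm_ring
    _ = 0 := by rw [h.left]; simp

theorem star_right_mul_left (h : CuntzRelations t₁ t₂) : star t₂ * t₁ = 0 := by
  simpa using congrArg star h.star_left_mul_right

theorem mem_unitary (h : CuntzRelations r q) (h' : CuntzRelations t₁ t₂) :
    r * star t₁ + q * star t₂ ∈ unitary M := by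
  have hstar : star (r * star t₁ + q * star t₂) = t₁ * star r + t₂ * star q := by simp
  rw [Unitary.mem_iff, hstar]
  constructor
  · calc (t₁ * star r + t₂ * star q) * (r * star t₁ + q * star t₂)
        = t₁ * (star r * r) * star t₁ + t₁ * (star r * q) * star t₂
          + t₂ * (star q * r) * star t₁ + t₂ * (star q * q) * star t₂ := by noncomm_ring
      _ = 1 := by
          rw [h.left, h.right, h.star_left_mul_right, h.star_right_mul_left]
          simpa using h'.sum_eq_one
  · calc (r * star t₁ + q * star t₂) * (t₁ * star r + t₂ * star q)
        = r * (star t₁ * t₁) * star r + r * (star t₁ * t₂) * star q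
          + q * (star t₂ * t₁) * star r + q * (star t₂ * t₂) * star q := by noncomm_ring
      _ = 1 := by
          rw [h'.left, h'.right, h'.star_left_mul_right, h'.star_right_mul_left]
          simpa using h.sum_eq_one

theorem compress (hs : star s * s = 1) (h : CuntzRelations S T) :
    CuntzRelations (s * S * star s + (1 - s * star s)) (s * T) := by
  have hstar : star (s * S * star s + (1 - s * star s)) =
      s * star S * star s + (1 - s * star s) := by simp [mul_assoc]
  -- `x ↦ s x s* + (1 - s s*)` is multiplicative for an isometry `s`
  have hmul : ∀ x y : M,
      (s * x * star s + (1 - s * star s)) * (s * y * star s + (1 - s * star s)) =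
        s * (x * y) * star s + (1 - s * star s) := fun x y => by
    calc (s * x * star s + (1 - s * star s)) * (s * y * star s + (1 - s * star s))
        = s * x * (star s * s) * y * star s + s * x * (star s - star s * s * star s)
          + (s - s * (star s * s)) * y * star s
          + (1 - s * star s - s * star s + s * (star s * s) * star s) := by noncomm_ring
      _ = s * (x * y) * star s + (1 - s * star s) := by rw [hs]; noncomm_ring
  refine ⟨?_, ?_, ?_⟩
  · rw [hstar, hmul, h.left]
    noncomm_ring
  · rw [star_mul, mul_assoc, ← mul_assoc (star s), hs, one_mul, h.right]
  · calc _ = s * (S * star S + T * star T) * star s + (1 - s * star s) := by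
          rw [hstar, hmul, star_mul]; noncomm_ring
      _ = 1 := by rw [h.sum_eq_one]; noncomm_ring

end CuntzRelations

/-- The operator `(s S s* + 1 - s s*) t₁* + s T t₂*`. If `X s ≈ s V`, where `V S = S V` and
`V T = T U`, then it approximately intertwines the Cuntz sum of `X` and `U` with `X`: on the range
of `s` the identity `V = S V S* + T U T*` makes room for the second summand. -/
def absorbingUnitary (s S T t₁ t₂ : M) : M :=
  (s * S * star s + (1 - s * star s)) * star t₁ + s * T * star t₂

variable {s S T t₁ t₂ X V U : M}

theorem CuntzRelations.absorbingUnitary_mem (h : CuntzRelations S T) (hs : star s * s = 1)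
    (h' : CuntzRelations t₁ t₂) : absorbingUnitary s S T t₁ t₂ ∈ unitary M :=
  (h.compress hs).mem_unitary h'

theorem CuntzRelations.absorbingUnitary_mul (h : CuntzRelations t₁ t₂) :
    absorbingUnitary s S T t₁ t₂ * (t₁ * X * star t₁ + t₂ * U * star t₂) =
      (s * S * star s + (1 - s * star s)) * X * star t₁ + s * T * U * star t₂ := by
  set r := s * S * star s + (1 - s * star s)
  calc absorbingUnitary s S T t₁ t₂ * (t₁ * X * star t₁ + t₂ * U * star t₂)
      = r * (star t₁ * t₁) * X * star t₁ + r * (star t₁ * t₂) * U * star t₂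
        + s * T * (star t₂ * t₁) * X * star t₁ + s * T * (star t₂ * t₂) * U * star t₂ := by
        change (r * star t₁ + s * T * star t₂) * _ = _
        noncomm_ring
    _ = r * X * star t₁ + s * T * U * star t₂ := by
        rw [h.left, h.right, h.star_left_mul_right, h.star_right_mul_left]; noncomm_ring

theorem sub_absorbingUnitary_conj (h : CuntzRelations S T) (hs : star s * s = 1)
    (h' : CuntzRelations t₁ t₂) (κ : M ≃⋆ₐ[ℂ] M) (hκS : κ S = S) (hκT : κ T = T)
    (hκ₁ : κ t₁ = t₁) (hκ₂ : κ t₂ = t₂) (hVS : V * S = S * V) (hVT : V * T = T * U) :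
    X - absorbingUnitary s S T t₁ t₂ * (t₁ * X * star t₁ + t₂ * U * star t₂) *
        star (κ (absorbingUnitary s S T t₁ t₂)) =
      (((X * κ s - s * V) * (S - 1) * star (κ s) -
        s * (S - 1) * (star s * X - V * star (κ s))) * star t₁ +
        (X * κ s - s * V) * T * star t₂) * star (κ (absorbingUnitary s S T t₁ t₂)) := by
  have hw := h.absorbingUnitary_mem hs h'
  have hκ : κ (absorbingUnitary s S T t₁ t₂) = absorbingUnitary (κ s) S T t₁ t₂ := by
    simp [absorbingUnitary, map_star, hκS, hκT, hκ₁, hκ₂]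
  have hleft : (X * κ s - s * V) * (S - 1) * star (κ s) -
      s * (S - 1) * (star s * X - V * star (κ s)) =
      X * κ s * (S - 1) * star (κ s) - s * (S - 1) * star s * X -
        s * (V * S - S * V) * star (κ s) := by noncomm_ring
  have hright : (X * κ s - s * V) * T = X * κ s * T - s * (V * T) := by noncomm_ring
  have hmain : X * κ (absorbingUnitary s S T t₁ t₂) -
      absorbingUnitary s S T t₁ t₂ * (t₁ * X * star t₁ + t₂ * U * star t₂) =
      ((X * κ s - s * V) * (S - 1) * star (κ s) -
        s * (S - 1) * (star s * X - V * star (κ s))) * star t₁ +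
        (X * κ s - s * V) * T * star t₂ := by
    rw [hκ, h'.absorbingUnitary_mul, hleft, hright, hVS, hVT, absorbingUnitary]
    noncomm_ring
  rw [← hmain, sub_mul, mul_assoc X, ← map_star, ← map_mul, Unitary.mul_star_self_of_mem hw,
    map_one, mul_one]

theorem norm_absorbingUnitary_defect_le {c c' s' w : M} (hs : ‖s‖ ≤ 1) (hs' : ‖s'‖ ≤ 1)
    (hS : ‖S‖ ≤ 1) (hT : ‖T‖ ≤ 1) (h₁ : ‖t₁‖ ≤ 1) (h₂ : ‖t₂‖ ≤ 1) (hw : ‖w‖ ≤ 1) :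
    ‖((c * (S - 1) * star s' - s * (S - 1) * c') * star t₁ + c * T * star t₂) * star w‖ ≤
      3 * ‖c‖ + 2 * ‖c'‖ := by
  have hone : ‖(1 : M)‖ ≤ 1 := norm_le_one_of_star_mul_self_eq_one (by simp)
  have hS' : ‖S - 1‖ ≤ 1 + 1 := norm_sub_le_of_le hS hone
  rw [← norm_star] at hs' h₁ h₂ hw
  have := norm_mul_le_of_le (norm_add_le_of_le
    (norm_mul_le_of_le (norm_sub_le_of_le
      (norm_mul_le_of_le (norm_mul_le_of_le (le_refl ‖c‖) hS') hs')
      (norm_mul_le_of_le (norm_mul_le_of_le hs hS') (le_refl ‖c'‖))) h₁)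
    (norm_mul_le_of_le (norm_mul_le_of_le (le_refl ‖c‖) hT) h₂)) hw
  linarith

theorem star_mul_sub_eq {σ σ' : M} (hX : star X * X = 1) (hV : V * star V = 1) :
    star σ * X - V * star σ' = -V * star (X * σ' - σ * V) * X := by
  have : -V * star (X * σ' - σ * V) * X =
      V * star V * star σ * X - V * star σ' * (star X * X) := by
    simp only [star_sub, star_mul]; noncomm_ring
  rw [this, hX, hV]
  noncomm_ring

end CuntzRelations

section IsometryPath

/-- The square root of the tent function around `n`; these form a partition of unity in squares. -/
def tentSqrt (n : ℕ) (τ : ℝ) : ℝ := Real.sqrt (1 - |τ - n|)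

theorem continuous_tentSqrt (n : ℕ) : Continuous (tentSqrt n) := by
  unfold tentSqrt; fun_prop

theorem tentSqrt_eq_zero {n : ℕ} {τ : ℝ} (h : 1 ≤ |τ - n|) : tentSqrt n τ = 0 :=
  Real.sqrt_eq_zero'.mpr (by linarith)

theorem tentSqrt_floor {τ : ℝ} (hτ : 0 ≤ τ) :
    tentSqrt ⌊τ⌋₊ τ ^ 2 + tentSqrt (⌊τ⌋₊ + 1) τ ^ 2 = 1 := by
  have h₁ := Nat.floor_le hτ
  have h₂ := Nat.lt_floor_add_one τ
  have h₃ : |τ - ⌊τ⌋₊| = τ - ⌊τ⌋₊ := abs_of_nonneg (by linarith)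
  have h₄ : |τ - ((⌊τ⌋₊ + 1 : ℕ) : ℝ)| = ⌊τ⌋₊ + 1 - τ := by
    push_cast
    rw [abs_sub_comm, abs_of_nonneg (by linarith)]
  rw [tentSqrt, tentSqrt, Real.sq_sqrt (by rw [h₃]; linarith), Real.sq_sqrt (by rw [h₄]; linarith),
    h₃, h₄]
  ring

variable {M : Type*} [CStarAlgebra M]

/-- The path `τ ↦ ∑ₙ √(1 - |τ - n|)₊ tₙ`. -/
def isometryPath (t : ℕ → M) (τ : ℝ) : M :=
  ∑ n ∈ Finset.range (⌊τ⌋₊ + 2), (tentSqrt n τ : ℂ) • t n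

theorem isometryPath_eq_sum (t : ℕ → M) {τ : ℝ} {N : ℕ} (hN : ⌊τ⌋₊ + 2 ≤ N) :
    isometryPath t τ = ∑ n ∈ Finset.range N, (tentSqrt n τ : ℂ) • t n := by
  refine Finset.sum_subset (Finset.range_mono hN) fun n _ hn => ?_
  have h₁ : ⌊τ⌋₊ + 2 ≤ n := by simpa using hn
  have h₂ : ((⌊τ⌋₊ + 2 : ℕ) : ℝ) ≤ n := by exact_mod_cast h₁
  have h₃ := Nat.lt_floor_add_one τ
  push_cast at h₂
  rw [tentSqrt_eq_zero]
  · simp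
  · rw [abs_sub_comm]
    exact le_trans (by linarith) (le_abs_self _)

theorem isometryPath_eq_add (t : ℕ → M) {τ : ℝ} (hτ : 0 ≤ τ) :
    isometryPath t τ = (tentSqrt ⌊τ⌋₊ τ : ℂ) • t ⌊τ⌋₊ +
      (tentSqrt (⌊τ⌋₊ + 1) τ : ℂ) • t (⌊τ⌋₊ + 1) := by
  rw [isometryPath, Finset.sum_range_succ, Finset.sum_range_succ, Finset.sum_eq_zero, zero_add]
  intro n hn
  have h₁ : n + 1 ≤ ⌊τ⌋₊ := Finset.mem_range.mp hn
  have h₂ : ((n + 1 : ℕ) : ℝ) ≤ τ := (Nat.le_floor_iff hτ).mp h₁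
  push_cast at h₂
  rw [tentSqrt_eq_zero]
  · simp
  · exact le_trans (by linarith) (le_abs_self _)

theorem continuous_isometryPath (t : ℕ → M) : Continuous (isometryPath t) := by
  rw [continuous_iff_continuousAt]
  intro τ₀
  have hc : Continuous fun τ : ℝ =>
      ∑ n ∈ Finset.range (⌊τ₀ + 1⌋₊ + 2), (tentSqrt n τ : ℂ) • t n :=
    continuous_finsetSum _ fun n _ =>
      (Complex.continuous_ofReal.comp (continuous_tentSqrt n)).smul continuous_const
  refine hc.continuousAt.congr ?_
  filter_upwards [eventually_lt_nhds (show τ₀ < τ₀ + 1 by linarith)] with τ hτ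
  exact (isometryPath_eq_sum t (by gcongr)).symm

theorem OrthogonalIsometries.star_isometryPath_mul_self {t : ℕ → M} (ht : OrthogonalIsometries t)
    {τ : ℝ} (hτ : 0 ≤ τ) : star (isometryPath t τ) * isometryPath t τ = 1 := by
  rw [isometryPath_eq_add t hτ]
  have h := tentSqrt_floor hτ
  set c := tentSqrt ⌊τ⌋₊ τ
  set d := tentSqrt (⌊τ⌋₊ + 1) τ
  have hcd : star (c : ℂ) * c + star (d : ℂ) * d = 1 := by
    simp only [Complex.star_def, Complex.conj_ofReal]
    rw [← sq, ← sq]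
    exact_mod_cast h
  simp only [star_add, star_smul, mul_add, add_mul, smul_mul_smul_comm, ht.star_mul_self,
    ht.star_mul_of_ne ⌊τ⌋₊ (⌊τ⌋₊ + 1) (by simp), ht.star_mul_of_ne (⌊τ⌋₊ + 1) ⌊τ⌋₊ (by simp),
    smul_zero, add_zero, zero_add]
  rw [← add_smul, hcd, one_smul]

theorem norm_mul_isometryPath_le (t : ℕ → M) (x : M) {τ : ℝ} (hτ : 0 ≤ τ) :
    ‖x * isometryPath t τ‖ ≤ ‖x * t ⌊τ⌋₊‖ + ‖x * t (⌊τ⌋₊ + 1)‖ := by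
  have hle : ∀ n, ‖(tentSqrt n τ : ℂ)‖ ≤ 1 := fun n => by
    rw [Complex.norm_real, tentSqrt, Real.norm_of_nonneg (Real.sqrt_nonneg _), Real.sqrt_le_one]
    linarith [abs_nonneg (τ - n)]
  rw [isometryPath_eq_add t hτ, mul_add, mul_smul_comm, mul_smul_comm]
  refine (norm_add_le _ _).trans ?_
  rw [norm_smul, norm_smul]
  exact add_le_add (mul_le_of_le_one_left (norm_nonneg _) (hle _))
    (mul_le_of_le_one_left (norm_nonneg _) (hle _))

end IsometryPath

section Absorption

variable {G A B : Type*} [Group G] [TopologicalSpace G]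
  [NonUnitalCStarAlgebra A] [NonUnitalCStarAlgebra B]
  {α : CStarAction G A} {β : CStarAction G B}

theorem CStarAction.IsCuntzPair.cuntzRelations {t₁ t₂ : 𝓜(ℂ, B)} (h : β.IsCuntzPair t₁ t₂) :
    CuntzRelations t₁ t₂ :=
  ⟨h.left.isometry, h.right.isometry, h.sum_eq_one⟩

namespace CStarAction.IsCuntzSequence

variable {t : ℕ → 𝓜(ℂ, B)}

theorem tendsto_incl_mul (ht : β.IsCuntzSequence t) (b : B) :
    Tendsto (fun n => incl B b * t n) atTop (𝓝 0) := by
  have ho := ht.orthogonalIsometries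
  have hproj : Tendsto (fun n => incl B b * (t n * star (t n))) atTop (𝓝 0) := by
    have h := ((tendsto_add_atTop_iff_nat 1).mpr (ht.tendsto_mul_proj b)).sub
      (ht.tendsto_mul_proj b)
    rw [sub_self] at h
    refine h.congr fun n => ?_
    rw [← mul_sub, Finset.sum_range_succ, add_sub_cancel_left]
  refine squeeze_zero_norm (fun n => ?_) (by simpa using hproj.norm)
  calc ‖incl B b * t n‖ = ‖incl B b * (t n * star (t n)) * t n‖ := by
        rw [mul_assoc, mul_assoc (t n), ho.star_mul_self, mul_one]
    _ ≤ ‖incl B b * (t n * star (t n))‖ :=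
        (norm_mul_le _ _).trans (mul_le_of_le_one_right (norm_nonneg _) (ho.norm_le_one n))

theorem tendsto_mul_isometryPath (ht : β.IsCuntzSequence t) {x : 𝓜(ℂ, B)} (hx : MemIdeal x) :
    Tendsto (fun τ : ℝ => x * isometryPath t τ) atTop (𝓝 0) := by
  obtain ⟨b, rfl⟩ := hx
  have h : Tendsto (fun n => ‖incl B b * t n‖ + ‖incl B b * t (n + 1)‖) atTop (𝓝 0) := by
    have h₀ := (ht.tendsto_incl_mul b).norm
    simpa using h₀.add ((tendsto_add_atTop_iff_nat 1).mpr h₀)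
  refine squeeze_zero_norm' ?_ (h.comp tendsto_nat_floor_atTop)
  filter_upwards [eventually_ge_atTop 0] with τ hτ
  exact norm_mul_isometryPath_le t _ hτ

theorem eventually_forall_mem_norm_incl_mul_isometryPath_lt (ht : β.IsCuntzSequence t)
    {K : Set B} (hK : IsCompact K) {ε : ℝ} (hε : 0 < ε) :
    ∀ᶠ τ in atTop, ∀ b ∈ K, ‖incl B b * isometryPath t τ‖ < ε :=
  eventually_forall_mem_norm_lt_of_isCompact zero_le_one
    (f := fun τ => (AddMonoidHom.mulRight (isometryPath t τ)).comp
      ((incl B : B →⋆ₙₐ[ℂ] 𝓜(ℂ, B)) : B →+ 𝓜(ℂ, B)))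
    ((eventually_ge_atTop 0).mono fun τ hτ b => by
      have hpath := norm_le_one_of_star_mul_self_eq_one
        (ht.orthogonalIsometries.star_isometryPath_mul_self hτ)
      refine (norm_mul_le _ _).trans ?_
      rw [mul_comm]
      exact mul_le_mul hpath (norm_incl b).le (norm_nonneg _) zero_le_one)
    hK (fun b => ht.tendsto_mul_isometryPath (memIdeal_incl b)) hε

theorem eventually_forall_mem_norm_mul_isometryPath_lt (ht : β.IsCuntzSequence t) {X : Type*}
    [TopologicalSpace X] {K : Set X} (hK : IsCompact K) {x : X → 𝓜(ℂ, B)} (hx : Continuous x)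
    (hmem : ∀ p, MemIdeal (x p)) {ε : ℝ} (hε : 0 < ε) :
    ∀ᶠ τ in atTop, ∀ p ∈ K, ‖x p * isometryPath t τ‖ < ε := by
  choose c hc using hmem
  obtain rfl : (fun p => incl B (c p)) = x := funext hc
  have hcc : Continuous c := (isometry_incl (B := B)).isEmbedding.continuous_iff.mpr hx
  exact (ht.eventually_forall_mem_norm_incl_mul_isometryPath_lt (hK.image hcc) hε).mono
    fun τ hτ p hp => hτ _ (Set.mem_image_of_mem c hp)

theorem mult_isometryPath (ht : β.IsCuntzSequence t) (g : G) (τ : ℝ) :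
    β.mult g (isometryPath t τ) = isometryPath t τ := by
  simp only [isometryPath, map_sum, map_smul, ht.fixed]

end CStarAction.IsCuntzSequence

namespace CocycleRep

theorem intertwines_isometryPath {t : ℕ → 𝓜(ℂ, B)} {Φ Ψ : CocycleRep α β}
    (h : ∀ n, Intertwines (t n) Φ Ψ) (τ : ℝ) : Intertwines (isometryPath t τ) Φ Ψ where
  hom a := by
    simp only [isometryPath, Finset.mul_sum, Finset.sum_mul, mul_smul_comm, smul_mul_assoc,
      (h _).hom]
  coc g := by
    simp only [isometryPath, Finset.mul_sum, Finset.sum_mul, mul_smul_comm, smul_mul_assoc,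
      (h _).coc]

theorem intertwines_shift {t : ℕ → 𝓜(ℂ, B)} (ht : β.IsCuntzSequence t) {S : 𝓜(ℂ, B)}
    (hS : ∀ n, S * t n = t (n + 1)) {Φ Ψ : CocycleRep α β} (h : ∀ n, Intertwines (t n) Φ Ψ) :
    Intertwines S Ψ Ψ where
  hom a := ht.ext_right fun n => by
    rw [mul_assoc, hS, (h _).hom, mul_assoc, (h n).hom, ← mul_assoc, hS]
  coc g := ht.ext_right fun n => by
    rw [mul_assoc, hS, (h _).coc, mul_assoc, (h n).coc, ← mul_assoc, hS]

variable {J : Type*} {a : J → A}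

theorem values_sum {t₁ t₂ : 𝓜(ℂ, B)} (h : β.IsCuntzPair t₁ t₂) (Φ Ψ : CocycleRep α β) :
    ∀ i, (sum h Φ Ψ).values a i = t₁ * Φ.values a i * star t₁ + t₂ * Ψ.values a i * star t₂ :=
  Sum.rec (fun _ => rfl) fun _ => rfl

theorem intertwiningDefect_mul {s r : 𝓜(ℂ, B)} {Θ Ψ Ψ' : CocycleRep α β}
    (hr : ∀ g, β.mult g r = r) (h : Intertwines r Ψ Ψ') (i : J ⊕ G) :
    intertwiningDefect a Θ Ψ (s * r) i = intertwiningDefect a Θ Ψ' s i * r := by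
  rw [intertwiningDefect, intertwiningDefect, map_mul, hr, mul_assoc s, ← h.values_mul]
  noncomm_ring

/-- The adjoints of `φ(a)` and `u_g`, up to multiplication by unitaries, are governed by `a*` and
`g`. -/
def starIndex : A ⊕ G → A ⊕ G := Sum.map star id

theorem exists_star_mul_values_sub_eq (Θ Ψ : CocycleRep α β) (s : 𝓜(ℂ, B)) (i : A ⊕ G) :
    ∃ y z : 𝓜(ℂ, B), ‖y‖ ≤ 1 ∧ ‖z‖ ≤ 1 ∧
      star s * Θ.values id i - Ψ.values id i * star (β.mult (groupIndex i) s) =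
        y * star (intertwiningDefect id Θ Ψ s (starIndex i)) * z := by
  rcases i with a | g
  · have hone : ‖(1 : 𝓜(ℂ, B))‖ ≤ 1 := norm_le_one_of_star_mul_self_eq_one (by simp)
    refine ⟨1, 1, hone, hone, ?_⟩
    simp [intertwiningDefect, values, groupIndex, starIndex, β.mult_one_apply, map_star]
  · exact ⟨-Ψ.coc g, Θ.coc g, (norm_neg _).trans_le (Ψ.norm_coc_le g), Θ.norm_coc_le g,
      star_mul_sub_eq (Unitary.star_mul_self_of_mem (SetLike.coe_mem _))
        (Unitary.mul_star_self_of_mem (SetLike.coe_mem _))⟩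

/-- The differences of the components of `Ψ` and of `Ad(w) ∘ Φ`. -/
def conjDefect (a : J → A) (w : 𝓜(ℂ, B)) (Φ Ψ : CocycleRep α β) (i : J ⊕ G) : 𝓜(ℂ, B) :=
  Ψ.values a i - w * Φ.values a i * star (β.mult (groupIndex i) w)

theorem asympEquiv_of_norm_conjDefect_le {Φ Ψ : CocycleRep α β}
    {w : Set.Ici (1 : ℝ) → unitary 𝓜(ℂ, B)} {E : A ⊕ G → Set.Ici (1 : ℝ) → ℝ} (hw : Continuous w)
    (hmem : ∀ i τ, MemIdeal (conjDefect id (w τ : 𝓜(ℂ, B)) Φ Ψ i))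
    (hE : ∀ i τ, ‖conjDefect id (w τ : 𝓜(ℂ, B)) Φ Ψ i‖ ≤ E i τ)
    (hlim : ∀ i, Tendsto (E i) atTop (𝓝 0))
    (hunif : ∀ K : Set G, IsCompact K → ∀ ε > 0, ∀ᶠ τ in atTop, ∀ g ∈ K, E (.inr g) τ < ε) :
    AsympEquiv Φ Ψ := by
  have hhom : ∀ a τ, conjDefect id (w τ : 𝓜(ℂ, B)) Φ Ψ (.inl a) =
      Ψ.hom a - w τ * Φ.hom a * star (w τ : 𝓜(ℂ, B)) := fun a τ => by
    simp [conjDefect, values, groupIndex, β.mult_one_apply]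
  refine ⟨w, hw, fun a => ?_, fun a τ => hhom a τ ▸ hmem (.inl a) τ, fun K hK => ?_,
    fun τ g => hmem (.inr g) τ⟩
  · refine tendsto_iff_norm_sub_tendsto_zero.mpr
      (squeeze_zero (fun _ => norm_nonneg _) (fun τ => ?_) (hlim (.inl a)))
    rw [norm_sub_rev, ← hhom]
    exact hE (.inl a) τ
  · refine Metric.tendstoUniformlyOn_iff.mpr fun ε hε => ?_
    filter_upwards [hunif K hK ε hε] with τ hτ g hg
    rw [dist_eq_norm]
    exact (hE (.inr g) τ).trans_lt (hτ g hg)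

section AbsorbingUnitary

variable {s S T t₁ t₂ : 𝓜(ℂ, B)} {Θ Φ Ψ : CocycleRep α β}

theorem exists_conjDefect_absorbingUnitary_eq (hs : star s * s = 1) (hST : β.IsCuntzPair S T)
    (hS : Intertwines S Ψ Ψ) (hT : Intertwines T Φ Ψ) (h : β.IsCuntzPair t₁ t₂) (i : A ⊕ G) :
    ∃ y z : 𝓜(ℂ, B), ‖y‖ ≤ 1 ∧ ‖z‖ ≤ 1 ∧
      conjDefect id (absorbingUnitary s S T t₁ t₂) (sum h Θ Φ) Θ i =
        ((intertwiningDefect id Θ Ψ s i * (S - 1) * star (β.mult (groupIndex i) s) -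
          s * (S - 1) * (y * star (intertwiningDefect id Θ Ψ s (starIndex i)) * z)) * star t₁ +
          intertwiningDefect id Θ Ψ s i * T * star t₂) *
            star (β.mult (groupIndex i) (absorbingUnitary s S T t₁ t₂)) := by
  obtain ⟨y, z, hy, hz, hyz⟩ := exists_star_mul_values_sub_eq Θ Ψ s i
  refine ⟨y, z, hy, hz, ?_⟩
  rw [conjDefect, values_sum, ← hyz]
  exact sub_absorbingUnitary_conj hST.cuntzRelations hs h.cuntzRelations _ (hST.left.fixed _)
    (hST.right.fixed _) (h.left.fixed _) (h.right.fixed _) (hS.values_mul i) (hT.values_mul i)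

theorem norm_conjDefect_absorbingUnitary_le (hs : star s * s = 1) (hST : β.IsCuntzPair S T)
    (hS : Intertwines S Ψ Ψ) (hT : Intertwines T Φ Ψ) (h : β.IsCuntzPair t₁ t₂) (i : A ⊕ G) :
    ‖conjDefect id (absorbingUnitary s S T t₁ t₂) (sum h Θ Φ) Θ i‖ ≤
      3 * ‖intertwiningDefect id Θ Ψ s i‖ + 2 * ‖intertwiningDefect id Θ Ψ s (starIndex i)‖ := by
  have hw : ‖absorbingUnitary s S T t₁ t₂‖ ≤ 1 :=
    norm_coe_unitary_le_one ⟨_, hST.cuntzRelations.absorbingUnitary_mem hs h.cuntzRelations⟩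
  have hs₁ := norm_le_one_of_star_mul_self_eq_one hs
  obtain ⟨y, z, hy, hz, heq⟩ := exists_conjDefect_absorbingUnitary_eq (Θ := Θ) hs hST hS hT h i
  have hyz := norm_mul_le_of_le (norm_mul_le_of_le hy
    (norm_star (intertwiningDefect id Θ Ψ s (starIndex i))).le) hz
  rw [heq]
  refine (norm_absorbingUnitary_defect_le hs₁ ((β.norm_mult _ _).trans_le hs₁)
    (norm_le_one_of_star_mul_self_eq_one hST.left.isometry)
    (norm_le_one_of_star_mul_self_eq_one hST.right.isometry)
    (norm_le_one_of_star_mul_self_eq_one h.left.isometry)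
    (norm_le_one_of_star_mul_self_eq_one h.right.isometry)
    ((β.norm_mult _ _).trans_le hw)).trans ?_
  linarith

theorem memIdeal_conjDefect_absorbingUnitary (hs : star s * s = 1) (hST : β.IsCuntzPair S T)
    (hS : Intertwines S Ψ Ψ) (hT : Intertwines T Φ Ψ) (h : β.IsCuntzPair t₁ t₂)
    (hmem : ∀ i, MemIdeal (intertwiningDefect id Θ Ψ s i)) (i : A ⊕ G) :
    MemIdeal (conjDefect id (absorbingUnitary s S T t₁ t₂) (sum h Θ Φ) Θ i) := by
  obtain ⟨y, z, -, -, heq⟩ := exists_conjDefect_absorbingUnitary_eq (Θ := Θ) hs hST hS hT h i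
  rw [heq]
  exact ((((((hmem i).mul_right _).mul_right _).sub
    ((((hmem (starIndex i)).star.mul_left y).mul_right z).mul_left _)).mul_right _).add
      (((hmem i).mul_right _).mul_right _)).mul_right _

end AbsorbingUnitary

theorem asympEquiv_sum_of_intertwining_isometry {t : ℕ → 𝓜(ℂ, B)} (ht : β.IsCuntzSequence t)
    {Θ Φ Ψ Ψ' : CocycleRep α β} (hΨ : ∀ n, Intertwines (t n) Φ Ψ)
    (hΨ' : ∀ n, Intertwines (t n) Ψ Ψ') {s : 𝓜(ℂ, B)} (hs : star s * s = 1)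
    (hmem : ∀ i, MemIdeal (intertwiningDefect id Θ Ψ' s i))
    (hcont : Continuous fun g => intertwiningDefect id Θ Ψ' s (.inr g))
    {t₁ t₂ : 𝓜(ℂ, B)} (h : β.IsCuntzPair t₁ t₂) : AsympEquiv (sum h Θ Φ) Θ := by
  obtain ⟨S, hS, hshift⟩ := ht.exists_shift
  let R : Set.Ici (1 : ℝ) → 𝓜(ℂ, B) := fun τ => isometryPath t τ
  have hR : ∀ τ, star (s * R τ) * (s * R τ) = 1 := fun τ => by
    rw [star_mul, mul_assoc, ← mul_assoc (star s), hs, one_mul]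
    exact ht.orthogonalIsometries.star_isometryPath_mul_self (zero_le_one.trans τ.2)
  have hdefect : ∀ i τ, intertwiningDefect id Θ Ψ (s * R τ) i =
      intertwiningDefect id Θ Ψ' s i * R τ := fun i τ =>
    intertwiningDefect_mul (ht.mult_isometryPath · _) (intertwines_isometryPath hΨ' _) i
  have hSΨ := intertwines_shift ht hshift hΨ
  have hval : Tendsto (Subtype.val : Set.Ici (1 : ℝ) → ℝ) atTop atTop :=
    tendsto_comp_val_Ici_atTop.mpr tendsto_id
  have hlim : ∀ i, Tendsto (fun τ => intertwiningDefect id Θ Ψ' s i * R τ) atTop (𝓝 0) :=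
    fun i => (ht.tendsto_mul_isometryPath (hmem i)).comp hval
  refine asympEquiv_of_norm_conjDefect_le
    (w := fun τ => ⟨absorbingUnitary (s * R τ) S (t 0) t₁ t₂,
      hS.cuntzRelations.absorbingUnitary_mem (hR τ) h.cuntzRelations⟩)
    (E := fun i τ => 3 * ‖intertwiningDefect id Θ Ψ' s i * R τ‖ +
      2 * ‖intertwiningDefect id Θ Ψ' s (starIndex i) * R τ‖) ?_ (fun i τ => ?_) (fun i τ => ?_)
    (fun i => ?_) (fun K hK ε hε => ?_)
  · have hRc : Continuous R := (continuous_isometryPath t).comp continuous_subtype_val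
    refine Continuous.subtype_mk ?_ _
    unfold absorbingUnitary
    fun_prop
  · refine memIdeal_conjDefect_absorbingUnitary (hR τ) hS hSΨ (hΨ 0) h (fun j => ?_) i
    exact hdefect j τ ▸ (hmem j).mul_right _
  · simpa only [hdefect] using
      norm_conjDefect_absorbingUnitary_le (Θ := Θ) (hR τ) hS hSΨ (hΨ 0) h i
  · simpa using ((hlim i).norm.const_mul 3).add ((hlim (starIndex i)).norm.const_mul 2)
  · filter_upwards [hval.eventually (ht.eventually_forall_mem_norm_mul_isometryPath_lt hK hcont
      (fun g => hmem (.inr g)) (ε := ε / 5) (by positivity))] with τ hτ g hg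
    have hg' : ‖intertwiningDefect id Θ Ψ' s (.inr g) * R τ‖ < ε / 5 := hτ g hg
    simp only [starIndex, Sum.map_inr, id_eq]
    linarith

end CocycleRep

end Absorption

section StrictTopology

theorem continuous_of_equicontinuous_of_denseRange {X E Y ι : Type*} [TopologicalSpace X]
    [TopologicalSpace E] [UniformSpace Y] {F : X → E → Y} (hF : Equicontinuous F) {d : ι → E}
    (hd : DenseRange d) (h : ∀ i, Continuous (F · (d i))) (e : E) : Continuous (F · e) :=
  continuous_iff_continuousAt.mpr fun x =>
    (hF e).tendsto_of_mem_closure ((hF.continuous x).continuousAt.mono_left inf_le_left)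
      (Set.forall_mem_range.mpr fun i => (h i).tendsto x) (hd e)

theorem equicontinuous_uniformOnFun_of_lipschitzWith {X Y E F : Type*} [PseudoEMetricSpace E]
    [PseudoEMetricSpace F] (𝔖 : Set (Set Y)) {f : X → E → Y → F} {C : NNReal}
    (hf : ∀ x y, LipschitzWith C (f x · y)) :
    Equicontinuous fun x e => UniformOnFun.ofFun 𝔖 (f x e) := by
  have h : UniformEquicontinuous fun x e => UniformFun.ofFun (f x e) :=
    LipschitzWith.uniformEquicontinuous _ C fun x =>
      UniformFun.lipschitzWith_ofFun_iff.mpr (hf x)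
  exact UniformEquicontinuous.equicontinuous fun U hU =>
    h _ (UniformOnFun.uniformContinuous_ofUniformFun F 𝔖 hU)

variable {B : Type*} [NonUnitalCStarAlgebra B]

theorem StrictMultiplier.isUniformInducing_fst_snd :
    IsUniformInducing fun x : StrictMultiplier B =>
      ((fun b => (ofStrict x).fst b, fun b => (ofStrict x).snd b) : (B → B) × (B → B)) :=
  ⟨rfl⟩

theorem continuous_ofFun_toStrict_iff {X Y : Type*} [TopologicalSpace X] {𝔖 : Set (Set Y)}
    {f : X → Y → 𝓜(ℂ, B)} :
    (Continuous fun x => UniformOnFun.ofFun 𝔖 fun y => toStrict (f x y)) ↔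
      (∀ b, Continuous fun x => UniformOnFun.ofFun 𝔖 fun y => (f x y).fst b) ∧
        ∀ b, Continuous fun x => UniformOnFun.ofFun 𝔖 fun y => (f x y).snd b := by
  rw [(UniformOnFun.postcomp_isUniformInducing
      StrictMultiplier.isUniformInducing_fst_snd).isInducing.continuous_iff,
    UniformOnFun.uniformEquivProdArrow.toHomeomorph.comp_continuous_iff.symm]
  refine continuous_prodMk.trans (and_congr ?_ ?_)
  · refine ((UniformOnFun.uniformEquivPiComm 𝔖 fun _ : B => B).toHomeomorph.comp_continuous_iff
      |>.symm.trans ?_)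
    exact continuous_pi_iff
  · refine ((UniformOnFun.uniformEquivPiComm 𝔖 fun _ : B => B).toHomeomorph.comp_continuous_iff
      |>.symm.trans ?_)
    exact continuous_pi_iff

end StrictTopology

section CocycleRepTopology

variable {G A B : Type*} [Group G] [TopologicalSpace G]
  [NonUnitalCStarAlgebra A] [NonUnitalCStarAlgebra B]
  {α : CStarAction G A} {β : CStarAction G B}

namespace CocycleRep

theorem continuous_iff {X : Type*} [TopologicalSpace X] {F : X → CocycleRep α β} :
    Continuous F ↔
      (∀ a b, Continuous fun x => ((F x).hom a).fst b) ∧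
      (∀ b, Continuous fun x => UniformOnFun.ofFun {K : Set G | IsCompact K}
        fun g => ((F x).coc g : 𝓜(ℂ, B)).fst b) ∧
      ∀ b, Continuous fun x => UniformOnFun.ofFun {K : Set G | IsCompact K}
        fun g => ((F x).coc g : 𝓜(ℂ, B)).snd b := by
  rw [continuous_induced_rng]
  refine continuous_prodMk.trans (and_congr ?_ continuous_ofFun_toStrict_iff)
  refine continuous_pi_iff.trans ((forall_congr' fun a => continuous_toStrict_iff).trans
    ⟨fun h a => (h a).1, fun h a => ⟨h a, fun b => ?_⟩⟩)
  have hstar : ∀ Φ : CocycleRep α β, (Φ.hom a).snd b = star ((Φ.hom (star a)).fst (star b)) :=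
    fun Φ => by simp [map_star]
  simpa only [hstar] using (h (star a) (star b)).star

theorem continuous_hom_fst_of_denseRange {X ι κ : Type*} [TopologicalSpace X]
    {F : X → CocycleRep α β} {a : ι → A} (ha : DenseRange a) {b : κ → B} (hb : DenseRange b)
    (h : ∀ i j, Continuous fun x => ((F x).hom (a i)).fst (b j)) (a' : A) (b' : B) :
    Continuous fun x => ((F x).hom a').fst b' := by
  have hA : Equicontinuous fun x c => ((F x).hom c).fst b' :=
    (LipschitzWith.uniformEquicontinuous _ ‖b'‖₊ fun x => .of_dist_le_mul fun c d => by
      have hcd : ((F x).hom c).fst b' - ((F x).hom d).fst b' = ((F x).hom (c - d)).fst b' := by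
        simp
      rw [dist_eq_norm, dist_eq_norm, coe_nnnorm, hcd, mul_comm]
      exact ((F x).hom (c - d)).fst.le_of_opNorm_le
        ((DoubleCentralizer.norm_fst _).trans_le ((F x).norm_hom_le _)) b').equicontinuous
  have hB : ∀ i, Equicontinuous fun x => ((F x).hom (a i)).fst := fun i =>
    (LipschitzWith.uniformEquicontinuous _ ‖a i‖₊ fun x =>
      ((F x).hom (a i)).fst.lipschitz.weaken <|
        (DoubleCentralizer.nnnorm_fst _).trans_le ((F x).norm_hom_le _)).equicontinuous
  exact continuous_of_equicontinuous_of_denseRange hA ha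
    (fun i => continuous_of_equicontinuous_of_denseRange (hB i) hb (h i) b') a'

/-- The continuous function `g ↦ u_g b`. -/
def cocFst (Φ : CocycleRep α β) (b : B) : C(G, B) where
  toFun g := (Φ.coc g : 𝓜(ℂ, B)).fst b
  continuous_toFun := (continuous_toStrict_iff.mp Φ.continuous_coc).1 b

/-- The continuous function `g ↦ b u_g`. -/
def cocSnd (Φ : CocycleRep α β) (b : B) : C(G, B) where
  toFun g := (Φ.coc g : 𝓜(ℂ, B)).snd b
  continuous_toFun := (continuous_toStrict_iff.mp Φ.continuous_coc).2 b

/-- The functions `φ(a i) b j`, `g ↦ u_g (b j)` and `g ↦ (b j) u_g`. They determine the topology of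
the set of cocycle representations when `a` and `b` are dense: the products `b φ(a)` are the
adjoints of the products `φ(a*) b*`. -/
def coordinates {ι κ : Type*} (a : ι → A) (b : κ → B) (Φ : CocycleRep α β) :
    (ι → κ → B) × (κ → C(G, B)) × (κ → C(G, B)) :=
  (fun i j => (Φ.hom (a i)).fst (b j), fun j => Φ.cocFst (b j), fun j => Φ.cocSnd (b j))

theorem continuous_coordinates {ι κ : Type*} (a : ι → A) (b : κ → B) :
    Continuous (coordinates (α := α) (β := β) a b) := by
  obtain ⟨hhom, hfst, hsnd⟩ := continuous_iff.mp (continuous_id (X := CocycleRep α β))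
  refine .prodMk (continuous_pi fun i => continuous_pi fun j => hhom _ _)
    (.prodMk (continuous_pi fun j => ?_) (continuous_pi fun j => ?_))
  · exact (ContinuousMap.continuous_iff_continuous_uniformOnFun _).mpr (hfst _)
  · exact (ContinuousMap.continuous_iff_continuous_uniformOnFun _).mpr (hsnd _)

theorem continuous_of_continuous_coordinates {X ι κ : Type*} {_ : TopologicalSpace X}
    {F : X → CocycleRep α β} {a : ι → A} (ha : DenseRange a) {b : κ → B} (hb : DenseRange b)
    (hF : Continuous fun x => (F x).coordinates a b) : Continuous F := by
  obtain ⟨hhom, hcoc⟩ := continuous_prodMk.mp hF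
  obtain ⟨hfst, hsnd⟩ := continuous_prodMk.mp hcoc
  simp only [continuous_pi_iff, ContinuousMap.continuous_iff_continuous_uniformOnFun]
    at hhom hfst hsnd
  refine continuous_iff.mpr ⟨continuous_hom_fst_of_denseRange ha hb hhom,
    continuous_of_equicontinuous_of_denseRange
      (equicontinuous_uniformOnFun_of_lipschitzWith _ (C := 1) fun x g => ?_) hb hfst,
    continuous_of_equicontinuous_of_denseRange
      (equicontinuous_uniformOnFun_of_lipschitzWith _ (C := 1) fun x g => ?_) hb hsnd⟩
  · exact ((F x).coc g : 𝓜(ℂ, B)).fst.lipschitz.weaken <|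
      (DoubleCentralizer.nnnorm_fst _).trans_le ((F x).norm_coc_le g)
  · exact ((F x).coc g : 𝓜(ℂ, B)).snd.lipschitz.weaken <|
      (DoubleCentralizer.nnnorm_snd _).trans_le ((F x).norm_coc_le g)

theorem isInducing_coordinates {ι κ : Type*} {a : ι → A} (ha : DenseRange a) {b : κ → B}
    (hb : DenseRange b) : IsInducing (coordinates (α := α) (β := β) a b) :=
  ⟨le_antisymm (continuous_coordinates a b).le_induced <| continuous_id_iff_le.mp <|
    continuous_of_continuous_coordinates ha hb continuous_induced_dom⟩

instance instSecondCountableTopology [LocallyCompactSpace G] [SecondCountableTopology G]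
    [TopologicalSpace.SeparableSpace A] [TopologicalSpace.SeparableSpace B] :
    SecondCountableTopology (CocycleRep α β) :=
  have := UniformSpace.secondCountable_of_separable B
  (isInducing_coordinates (TopologicalSpace.denseRange_denseSeq A)
    (TopologicalSpace.denseRange_denseSeq B)).secondCountableTopology

end CocycleRep

end CocycleRepTopology

section Absorbing

variable {G A B : Type*} [Group G] [TopologicalSpace G]
  [NonUnitalCStarAlgebra A] [NonUnitalCStarAlgebra B]
  {α : CStarAction G A} {β : CStarAction G B}

namespace CocycleRep

theorem coc_one (Φ : CocycleRep α β) : (Φ.coc 1 : 𝓜(ℂ, B)) = 1 := by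
  have h : star (Φ.coc 1 : 𝓜(ℂ, B)) * Φ.coc (1 * 1) = star (Φ.coc 1 : 𝓜(ℂ, B)) * _ :=
    congrArg _ (Φ.coc_mul 1 1)
  rwa [β.mult_one_apply, ← mul_assoc, mul_one, Unitary.coe_star_mul_self, one_mul, eq_comm] at h

theorem coc_eq_mult_star_inv (Φ : CocycleRep α β) (g : G) :
    (Φ.coc g : 𝓜(ℂ, B)) = β.mult g (star (Φ.coc g⁻¹ : 𝓜(ℂ, B))) :=
  calc (Φ.coc g : 𝓜(ℂ, B))
      = Φ.coc g * β.mult g (Φ.coc g⁻¹ * star (Φ.coc g⁻¹ : 𝓜(ℂ, B))) := by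
        rw [Unitary.mul_star_self_of_mem (SetLike.coe_mem _), map_one, mul_one]
    _ = β.mult g (star (Φ.coc g⁻¹ : 𝓜(ℂ, B))) := by
        rw [map_mul, ← mul_assoc, ← Φ.coc_mul, mul_inv_cancel, Φ.coc_one, one_mul]

theorem norm_coc_sub_mul_incl (Φ Ψ : CocycleRep α β) (g : G) (b : B) :
    ‖(Φ.coc g - Ψ.coc g : 𝓜(ℂ, B)) * incl B (β.toHom g b)‖ =
      ‖(Φ.coc g⁻¹ : 𝓜(ℂ, B)).snd (star b) - (Ψ.coc g⁻¹ : 𝓜(ℂ, B)).snd (star b)‖ := by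
  rw [Φ.coc_eq_mult_star_inv, Ψ.coc_eq_mult_star_inv, ← map_sub, ← β.mult_incl, ← map_mul,
    β.norm_mult, ← star_sub, ← norm_star, star_mul, star_star, ← map_star, mul_sub, incl_mul,
    incl_mul, ← map_sub, norm_incl]

theorem eventually_norm_hom_sub_mul_incl_le (Ψ : CocycleRep α β) (a : A) (b : B) {ε : ℝ}
    (hε : 0 < ε) : ∀ᶠ Φ in 𝓝 Ψ, ‖(Φ.hom a - Ψ.hom a) * incl B b‖ ≤ ε := by
  have h := ((continuous_iff.mp continuous_id).1 a b).tendsto Ψ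
  filter_upwards [Metric.tendsto_nhds.mp h ε hε] with Φ hΦ
  rw [sub_mul, mul_incl, mul_incl, ← map_sub, norm_incl, ← dist_eq_norm]
  exact hΦ.le

theorem eventually_norm_coc_sub_mul_incl_le [IsTopologicalGroup G] (Ψ : CocycleRep α β)
    {K : Set G} (hK : IsCompact K) (b : B) {ε : ℝ} (hε : 0 < ε) :
    ∀ᶠ Φ in 𝓝 Ψ, ∀ g ∈ K, ‖(Φ.coc g - Ψ.coc g : 𝓜(ℂ, B)) * incl B (β.toHom g b)‖ ≤ ε := by
  have h := ((continuous_iff.mp continuous_id).2.2 (star b)).tendsto Ψ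
  filter_upwards [Metric.tendstoUniformlyOn_iff.mp
    (UniformOnFun.tendsto_iff_tendstoUniformlyOn.mp h _ hK.inv) ε hε] with Φ hΦ g hg
  rw [norm_coc_sub_mul_incl, ← dist_eq_norm, dist_comm]
  exact (hΦ g⁻¹ (Set.inv_mem_inv.mpr hg)).le

theorem exists_approximates_of_separable [IsTopologicalGroup G] {J : Type*} [TopologicalSpace J]
    [DiscreteTopology J] {C : Set (CocycleRep α β)} (hC : C.Nonempty)
    [TopologicalSpace.SeparableSpace C] (a : J → A) :
    ∃ Φ : ℕ → CocycleRep α β, (∀ n, Φ n ∈ C) ∧ ∀ Ψ ∈ C, Approximates a Φ Ψ := by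
  have := hC.to_subtype
  refine ⟨fun n => TopologicalSpace.denseSeq C n, fun n => Subtype.coe_prop _,
    fun Ψ hΨ b S hS ε hε => ?_⟩
  have hinl : IsCompact (Sum.inl ⁻¹' S) := IsClosedEmbedding.inl.isCompact_preimage hS
  have hinr : IsCompact (Sum.inr ⁻¹' S) := IsClosedEmbedding.inr.isCompact_preimage hS
  have hhom : ∀ᶠ Φ in 𝓝 Ψ, ∀ i ∈ Sum.inl ⁻¹' S, ‖(Φ.hom (a i) - Ψ.hom (a i)) * incl B b‖ ≤ ε :=
    (Filter.eventually_all_finite hinl.finite_of_discrete).mpr fun i _ =>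
      Ψ.eventually_norm_hom_sub_mul_incl_le (a i) b hε
  have hnhds : ∀ᶠ Φ : C in 𝓝 ⟨Ψ, hΨ⟩, (∀ i ∈ Sum.inl ⁻¹' S, _) ∧ ∀ g ∈ Sum.inr ⁻¹' S, _ :=
    (continuous_subtype_val.tendsto (⟨Ψ, hΨ⟩ : C)).eventually
      (hhom.and (Ψ.eventually_norm_coc_sub_mul_incl_le hinr b hε))
  obtain ⟨_, ⟨hk₁, hk₂⟩, k, rfl⟩ :=
    mem_closure_iff_nhds.mp (TopologicalSpace.denseRange_denseSeq C ⟨Ψ, hΨ⟩) _ hnhds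
  refine ⟨k, Sum.rec (fun i hi => ?_) fun g hg => ?_⟩
  · simpa [values, groupIndex, β.toHom_one_apply] using hk₁ i hi
  · exact hk₂ g hg

theorem exists_isAbsorbing_of_approximates [IsTopologicalGroup G] [SigmaCompactSpace G]
    [WeaklyLocallyCompactSpace G] (hB : IsSigmaUnital B) (hβ : β.IsStronglyStable)
    {C : Set (CocycleRep α β)} (hC : IsSigmaAdditive C) {a : ℕ → A} (ha : DenseRange a)
    {Φ : ℕ → CocycleRep α β} (hΦ : ∀ n, Φ n ∈ C) (happ : ∀ Ψ ∈ C, Approximates a Φ Ψ) :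
    ∃ Θ, IsAbsorbing C Θ := by
  obtain ⟨t, ht⟩ := hβ.exists_isCuntzSequence
  have hsum : ∀ Φ : ℕ → CocycleRep α β, (∀ n, Φ n ∈ C) →
      ∃ Ψ ∈ C, ∀ n, Intertwines (t n) (Φ n) Ψ := fun Φ hΦ => by
    obtain ⟨Ψ, hΨ, hint⟩ := exists_isCountableSum ht Φ
    exact ⟨Ψ, hC.sum_mem Φ hΦ t ht Ψ hΨ, hint⟩
  obtain ⟨Ω, hΩC, hΩ⟩ := hsum Φ hΦ
  obtain ⟨Θ, hΘC, hΘ⟩ := hsum (fun _ => Ω) fun _ => hΩC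
  refine ⟨Θ, hΘC, fun Φ₀ hΦ₀ t₁ t₂ h => ?_⟩
  obtain ⟨Ψ, hΨC, hΨ⟩ := hsum (fun _ => Φ₀) fun _ => hΦ₀
  obtain ⟨Ψ', hΨ'C, hΨ'⟩ := hsum (fun _ => Ψ) fun _ => hΨC
  obtain ⟨s, hs, hmem, hcont⟩ :=
    exists_intertwining_isometry hB ht hΩ hΘ ha (happ Ψ' hΨ'C)
  exact asympEquiv_sum_of_intertwining_isometry ht hΨ hΨ' hs hmem hcont h

end CocycleRep

end Absorbing

end

theorem theorem3p12_general {G A B : Type*}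
    [Group G] [TopologicalSpace G] [IsTopologicalGroup G]
    [SigmaCompactSpace G] [LocallyCompactSpace G]
    [NonUnitalCStarAlgebra A] [TopologicalSpace.SeparableSpace A]
    [NonUnitalCStarAlgebra B] (hB : IsSigmaUnital B)
    {α : CStarAction G A} {β : CStarAction G B} (hβ : β.IsStronglyStable)
    {C : Set (CocycleRep α β)} (hne : C.Nonempty) (hC : CocycleRep.IsSigmaAdditive C)
    [TopologicalSpace.SeparableSpace C] : ∃ Θ, CocycleRep.IsAbsorbing C Θ := by
  obtain ⟨_, hΦ, happ⟩ :=
    CocycleRep.exists_approximates_of_separable hne (TopologicalSpace.denseSeq A)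
  exact CocycleRep.exists_isAbsorbing_of_approximates hB hβ hC
    (TopologicalSpace.denseRange_denseSeq A) hΦ happ

theorem theorem3p12 {G A B : Type*}
    [Group G] [TopologicalSpace G] [IsTopologicalGroup G]
    [SecondCountableTopology G] [LocallyCompactSpace G]
    [NonUnitalCStarAlgebra A] [TopologicalSpace.SeparableSpace A]
    [NonUnitalCStarAlgebra B] (hB : IsSigmaUnital B)
    (α : CStarAction G A) (β : CStarAction G B) (hβ : β.IsStronglyStable)
    (C : Set (CocycleRep α β)) (hne : C.Nonempty) (hC : CocycleRep.IsSigmaAdditive C) :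
    (TopologicalSpace.SeparableSpace C → ∃ Θ, CocycleRep.IsAbsorbing C Θ) ∧
      (TopologicalSpace.SeparableSpace B → ∃ Θ, CocycleRep.IsAbsorbing C Θ) :=
  ⟨fun _ => theorem3p12_general hB hβ hne hC, fun _ => theorem3p12_general hB hβ hne hC⟩
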